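/- Let $A:\mathbb R\to\mathbb R$ be infinitely differentiable, and assume that $A$ and $A'$ vanish exponentially fast at $+\infty$ (i.e. are $O(e^{-cx})$ as $x\to+\infty$ for some $c>0$). Fix $s\in\mathbb R$ and put $$A_s(x,y)=A(x+y+s),\qquad K_s(x,y)=\int_0^\infty A(x+r+s)A(y+r+s)\,dr,\qquad a_s(x)=\int_0^\infty A(x+r+s)\,dr .$$ For a kernel $B(x,y)$ write $DB=\partial_xB$, $BD^{\intercal}=\partial_yB$, $DBD^{\intercal}=\partial_x\partial_yB$, and let $(D^{-1}B)(x,y)=-\int_x^\infty B(u,y)\,du$ be the antiderivative in $x$ vanishing at $+\infty$. Define $$K_s^{\rm sympl}(x,y)=K_s(x,y)-\tfrac12A(s+x)\,a_s(y),\qquad K_s^{\rm ortho}(x,y)=K_s(x,y)+A(s+x)\,(1-a_s(y)).$$ For a scalar kernel $K$, and for a $2\times2$-matrix-valued kernel $\mathbf K$, let $$\mathrm{Det}(I-K)=\sum_{n\ge0}\frac{(-1)^n}{n!}\int_{(0,\infty)^n}\det[K(x_i,x_j)]_{i,j=1}^n\,dx,\qquad \mathrm{Pf}(J-\mathbf K)=\sum_{n\ge0}\frac{(-1)^n}{n!}\int_{(0,\infty)^n}\mathrm{Pf}[\mathbf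 K(x_i,x_j)]_{i,j=1}^n\,dx,$$ with the $n=0$ terms equal to $1$, where for a $2n\times2n$ matrix $\mathrm{Pf}(M)=\frac1{2^nn!}\sum_{\sigma\in S_{2n}}\mathrm{sgn}(\sigma)\prod_{p=1}^nM_{\sigma(2p-1),\sigma(2p)}$, and $[\mathbf K(x_i,x_j)]_{i,j=1}^n$ is the $2n\times2n$ matrix with $2\times2$ blocks $\mathbf K(x_i,x_j)$. Then $x\mapsto(D^{-1}K_s)(x,y)$ has derivative $K_s(x,y)$ and tends to $0$ at $+\infty$, and the following hold. (1) (Symplectic-like.) The kernel $B=\tfrac12D^{-1}K_s^{\rm sympl}$ equals $\tfrac12(D^{-1}K_s)(x,y)+\tfrac14a_s(x)a_s(y)$. It is antisymmetric, the derivatives $DB$, $BD^{\intercal}$, $DBD^{\intercal}$ exist, the matrix kernel below is antisymmetric ($\mathbf K(x,y)=-\mathbf K(y,x)^{\intercal}$), the integrals and series defining both sides converge absolutely, and $$\mathrm{Det}(I-K_s^{\rm sympl})=\mathrm{Pf}\left(J-\begin{bmatrix}B&-BD^{\intercal}\\-DB&DBD^{\intercal}\end{bmatrix}\right)^2 .$$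 (2) (Orthogonal-like.) Let $\varepsilon(x,y)=\tfrac12\mathrm{sgn}(x-y)$, with $\mathrm{sgn}(0)=0$. The kernel $B(x,y)=(D^{-1}K_s)(x,y)+\tfrac12a_s(x)a_s(y)+\tfrac12\big(a_s(y)-a_s(x)\big)$ is antisymmetric, the derivatives $DB$, $BD^{\intercal}$, $DBD^{\intercal}$ exist, the matrix kernel below is antisymmetric, the integrals and series defining both sides converge absolutely, and $$\mathrm{Det}(I-K_s^{\rm ortho})=\mathrm{Pf}\left(J-\begin{bmatrix}B-\varepsilon&-BD^{\intercal}\\-DB&DBD^{\intercal}\end{bmatrix}\right)^2 .$$ Moreover $\varepsilon$ is antisymmetric; $D\varepsilon=I$, i.e. $\frac{d}{dx}\int_0^\infty\varepsilon(x,y)f(y)\,dy=f(x)$ for all $x>0$ and every $f$ that is continuous and integrable on $(0,\infty)$; $\varepsilon(x,0)=\tfrac12$ for $x>0$; and $\lim_{y\to+\infty}\varepsilon(x,y)=-\tfrac12$ for every $x$. -/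

import Mathlib

open MeasureTheory Filter Topology Set
open scoped ContDiff

noncomputable section

namespace FredholmPfaffian

/-! ### Fredholm determinants and Fredholm Pfaffians on the half-line -/

/-- Lebesgue measure on `(0, ∞)ⁿ`. -/
def halfLineMeasure (n : ℕ) : Measure (Fin n → ℝ) :=
  Measure.pi fun _ => (volume : Measure ℝ).restrict (Ioi 0)

/-- The Pfaffian of a matrix of size `2n × 2n`. Rows and columns are indexed by `Fin n × Fin 2`, in
the order `(0,0), (0,1), (1,0), (1,1), …`, so that a matrix of this type is an `n × n` array of
`2 × 2` blocks. -/
def pfaffian {n : ℕ} (M : Matrix (Fin n × Fin 2) (Fin n × Fin 2) ℝ) : ℝ :=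
  (1 / ((2 : ℝ) ^ n * (n.factorial : ℝ))) *
    ∑ σ : Equiv.Perm (Fin n × Fin 2),
      ((Equiv.Perm.sign σ : ℤ) : ℝ) * ∏ p : Fin n, M (σ (p, 0)) (σ (p, 1))

/-- The `n × n` matrix `K(xᵢ, xⱼ)` of a scalar kernel. -/
def scalarMatrix (K : ℝ → ℝ → ℝ) {n : ℕ} (x : Fin n → ℝ) : Matrix (Fin n) (Fin n) ℝ :=
  Matrix.of fun i j => K (x i) (x j)

/-- The `2n × 2n` matrix made of the `2 × 2` blocks `K(xᵢ, xⱼ)` of a matrix-valued kernel. -/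
def blockMatrix (K : ℝ → ℝ → Matrix (Fin 2) (Fin 2) ℝ) {n : ℕ} (x : Fin n → ℝ) :
    Matrix (Fin n × Fin 2) (Fin n × Fin 2) ℝ :=
  Matrix.of fun i j => K (x i.1) (x j.1) i.2 j.2

/-- The `n`-th term of the Fredholm series of `Det(I - K)` on `L²(ℝ₊)` (equal to `1` for
`n = 0`). -/
def fredholmDetTerm (K : ℝ → ℝ → ℝ) (n : ℕ) : ℝ :=
  ((-1 : ℝ) ^ n / (n.factorial : ℝ)) * ∫ x, (scalarMatrix K x).det ∂(halfLineMeasure n)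

/-- The Fredholm determinant `Det(I - K)` on `L²(ℝ₊)`. -/
def fredholmDet (K : ℝ → ℝ → ℝ) : ℝ := ∑' n, fredholmDetTerm K n

/-- All integrals in the Fredholm series of `Det(I - K)`, and the series, converge absolutely. -/
def FredholmDetConverges (K : ℝ → ℝ → ℝ) : Prop :=
  (∀ n : ℕ, Integrable (fun x : Fin n → ℝ => (scalarMatrix K x).det) (halfLineMeasure n)) ∧
    Summable (fredholmDetTerm K)

/-- The `n`-th term of the series of the Fredholm Pfaffian `Pf(J - K)` on `L²(ℝ₊)` (equal to `1`
for `n = 0`). -/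
def fredholmPfTerm (K : ℝ → ℝ → Matrix (Fin 2) (Fin 2) ℝ) (n : ℕ) : ℝ :=
  ((-1 : ℝ) ^ n / (n.factorial : ℝ)) * ∫ x, pfaffian (blockMatrix K x) ∂(halfLineMeasure n)

/-- The Fredholm Pfaffian `Pf(J - K)` on `L²(ℝ₊)`. -/
def fredholmPf (K : ℝ → ℝ → Matrix (Fin 2) (Fin 2) ℝ) : ℝ := ∑' n, fredholmPfTerm K n

/-- All integrals in the series of `Pf(J - K)`, and the series, converge absolutely. -/
def FredholmPfConverges (K : ℝ → ℝ → Matrix (Fin 2) (Fin 2) ℝ) : Prop :=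
  (∀ n : ℕ, Integrable (fun x : Fin n → ℝ => pfaffian (blockMatrix K x)) (halfLineMeasure n)) ∧
    Summable (fredholmPfTerm K)

/-! ### Differentiation of kernels -/

/-- The kernel of `D B`, that is `∂ₓ B(x, y)`. -/
def D (B : ℝ → ℝ → ℝ) (x y : ℝ) : ℝ := deriv (fun t => B t y) x

/-- The kernel of `B Dᵀ`, that is `∂_y B(x, y)`. -/
def mulDT (B : ℝ → ℝ → ℝ) (x y : ℝ) : ℝ := deriv (fun t => B x t) y

/-- The kernel of `D⁻¹ B`: the antiderivative in the first variable that vanishes at `+∞`. -/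
def DInv (B : ℝ → ℝ → ℝ) (x y : ℝ) : ℝ := -∫ u in Ioi x, B u y

/-- All derivatives in `D B`, `B Dᵀ` and `D B Dᵀ` exist. -/
def HasBlockDerivatives (B : ℝ → ℝ → ℝ) : Prop :=
  (∀ x y : ℝ, DifferentiableAt ℝ (fun t => B t y) x) ∧
  (∀ x y : ℝ, DifferentiableAt ℝ (fun t => B x t) y) ∧
  (∀ x y : ℝ, DifferentiableAt ℝ (fun t => mulDT B t y) x)

/-- A scalar kernel with `B(x, y) = -B(y, x)`. -/
def IsSkew (B : ℝ → ℝ → ℝ) : Prop := ∀ x y : ℝ, B x y = -B y x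

/-- A `2 × 2` matrix-valued kernel with `K(x, y) = -K(y, x)ᵀ`. -/
def IsBlockSkew (K : ℝ → ℝ → Matrix (Fin 2) (Fin 2) ℝ) : Prop :=
  ∀ x y : ℝ, K x y = -(K y x).transpose

/-! ### The kernels -/

/-- `f` vanishes exponentially fast at `+∞`. -/
def ExpDecay (f : ℝ → ℝ) : Prop :=
  ∃ c : ℝ, 0 < c ∧ f =O[atTop] fun x => Real.exp (-c * x)

/-- `A_s(x, y) = A(x + y + s)`. -/
def kernelA (A : ℝ → ℝ) (s x y : ℝ) : ℝ := A (x + y + s)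

/-- `K_s = A_s²` on the half-line. -/
def kernelK (A : ℝ → ℝ) (s x y : ℝ) : ℝ :=
  ∫ r in Ioi (0 : ℝ), kernelA A s x r * kernelA A s y r

/-- The function `A_s |1⟩`, which is also `⟨1| A_s` since `A_s` is symmetric. -/
def kernelAOne (A : ℝ → ℝ) (s x : ℝ) : ℝ := ∫ r in Ioi (0 : ℝ), kernelA A s x r

/-- The symplectic-like kernel. -/
def kernelSympl (A : ℝ → ℝ) (s x y : ℝ) : ℝ :=
  kernelK A s x y - (1 / 2) * A (s + x) * kernelAOne A s y

/-- The orthogonal-like kernel. -/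
def kernelOrtho (A : ℝ → ℝ) (s x y : ℝ) : ℝ :=
  kernelK A s x y + A (s + x) * (1 - kernelAOne A s y)

/-- `B^(sympl) = ½ D⁻¹ K_s^(sympl)`. -/
def bSympl (A : ℝ → ℝ) (s x y : ℝ) : ℝ := (1 / 2) * DInv (kernelSympl A s) x y

/-- `B^(ortho) = D⁻¹ K_s + ½ A_s|1⟩⟨1|A_s + ½ (|1⟩⟨1|A_s - A_s|1⟩⟨1|)`. -/
def bOrtho (A : ℝ → ℝ) (s x y : ℝ) : ℝ :=
  DInv (kernelK A s) x y + (1 / 2) * (kernelAOne A s x * kernelAOne A s y) +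
    (1 / 2) * (kernelAOne A s y - kernelAOne A s x)

/-- The sign kernel `ε(x, y) = ½ sgn(x - y)`. -/
def signKernel (x y : ℝ) : ℝ := (1 / 2) * Real.sign (x - y)

/-- The matrix kernel of the symplectic-like Fredholm Pfaffian. -/
def pfKernelSympl (A : ℝ → ℝ) (s x y : ℝ) : Matrix (Fin 2) (Fin 2) ℝ :=
  !![bSympl A s x y, -mulDT (bSympl A s) x y;
     -D (bSympl A s) x y, D (mulDT (bSympl A s)) x y]

/-- The matrix kernel of the orthogonal-like Fredholm Pfaffian. -/
def pfKernelOrtho (A : ℝ → ℝ) (s x y : ℝ) : Matrix (Fin 2) (Fin 2) ℝ :=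
  !![bOrtho A s x y - signKernel x y, -mulDT (bOrtho A s) x y;
     -D (bOrtho A s) x y, D (mulDT (bOrtho A s)) x y]

end FredholmPfaffian

end

open MeasureTheory Filter Topology Set
open scoped ContDiff

noncomputable section

/-! Put F(x) = A(x + s). Every kernel here is built from F by pairings ∫₀^∞ f(x+r) g(y+r) dr, tails
∫₀^∞ F(x+r) dr and products. Both sides of each identity are continuous in (F, F') for exponentially
weighted bounds, so it suffices to treat a dense class on which everything is finite-dimensional:
the sums Σ αₖ exp(-λₖ x), whose pairings are governed by the Cauchy matrix G = (1/(λₖ+λₗ)).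

Two facts turn the Fredholm series into finite determinants. An Andréief argument gives Det(I - Σ
fₖ⊗gₖ) = det(1 - (⟨gₖ, fₗ⟩)) (`fredholmDet_finiteRank`). A de Bruijn argument gives Pf(J - ΨβΨᵀ)² =
det(1 + βW), where W is the skew Gram matrix of the two rows of Ψ (`fredholmPf_pairKernel_sq`). The
second rests on three properties of finite Pfaffians: behaviour under congruence, the expansion of
Pf(J - V) in principal minors, and Pf² = det. The last follows from writing J - zV = P J Pᵀ for
small z, with P a square root near 1, and continuing analytically in z.

Symplectic-like case: let Λ = diag(λ), S the skew Gram matrix of exp(-λₖ x) and λₖ exp(-λₖ x), and β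
the skew coefficient matrix of B. The two sides are det(1 + β·2GΛ) and det(1 + βS), and 2GΛ = S +
11ᵀ. The rank-one term is invisible because uᵀ(1+βS)⁻¹βu = 0 by skewness
(`det_one_add_mul_add_vecMulVec`).

Orthogonal-like case: the constant function 1 is adjoined to the exponentials in order to carry
½(a(y) - a(x)), so the skew matrices acquire a border. The sign kernel has infinite rank. It is
replaced by step kernels, whose effect on the finite determinant is explicit and which, in the
limit, halve S. The remaining algebraic identity is `det_bordered`: in the invertible case both
sides equal det(1+βS)(1-p/2)² with p = uᵀ(1+βS)⁻¹v.

The limits use Hadamard's inequality. In each 2×2 block one component decays and the other is merely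
bounded, so the non-decaying ε does no harm, and `fredholmSeries_tendsto` applies. The approximation
comes from Weierstrass' theorem for F' in the variable t = exp(-μx), integrated once to reach F
(`exists_expSum_near`). -/

namespace FredholmPfaffian

/-! ### Pfaffians of matrices of `2 × 2` blocks -/

section BlockPf

set_option linter.unusedSectionVars false

variable {ι κ : Type*} [Fintype ι] [DecidableEq ι] [Fintype κ] [DecidableEq κ]

/-- The signed sum over permutations that defines the Pfaffian, without its normalisation. -/
def pfSum (M : Matrix (ι × Fin 2) (ι × Fin 2) ℝ) : ℝ :=
  ∑ σ : Equiv.Perm (ι × Fin 2),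
    ((Equiv.Perm.sign σ : ℤ) : ℝ) * ∏ p : ι, M (σ (p, 0)) (σ (p, 1))

/-- The Pfaffian of a matrix of `2 × 2` blocks indexed by a finite type. -/
def blockPf (M : Matrix (ι × Fin 2) (ι × Fin 2) ℝ) : ℝ :=
  (1 / ((2 : ℝ) ^ Fintype.card ι * ((Fintype.card ι).factorial : ℝ))) * pfSum M

theorem pfaffian_eq_blockPf {n : ℕ} (M : Matrix (Fin n × Fin 2) (Fin n × Fin 2) ℝ) :
    pfaffian M = blockPf M := by
  simp [pfaffian, blockPf, pfSum]

theorem pfSum_submatrix_equiv (e : ι ≃ κ) (M : Matrix (κ × Fin 2) (κ × Fin 2) ℝ) :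
    pfSum (M.submatrix (Prod.map e id) (Prod.map e id)) = pfSum M := by
  unfold pfSum
  rw [← (Equiv.permCongr (e.prodCongr (Equiv.refl (Fin 2)))).sum_comp]
  refine Finset.sum_congr rfl fun σ _ => ?_
  rw [Equiv.Perm.sign_permCongr, ← e.prod_comp]
  congr 1
  refine Finset.prod_congr rfl fun p _ => ?_
  simp [Equiv.permCongr_apply]

theorem blockPf_submatrix_equiv (e : ι ≃ κ) (M : Matrix (κ × Fin 2) (κ × Fin 2) ℝ) :
    blockPf (M.submatrix (Prod.map e id) (Prod.map e id)) = blockPf M := by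
  rw [blockPf, blockPf, pfSum_submatrix_equiv, Fintype.card_congr e]

theorem blockPf_smul (c : ℝ) (M : Matrix (ι × Fin 2) (ι × Fin 2) ℝ) :
    blockPf (c • M) = c ^ Fintype.card ι * blockPf M := by
  simp only [blockPf, pfSum, Matrix.smul_apply, smul_eq_mul, Finset.prod_mul_distrib,
    Finset.prod_const, Finset.card_univ, Finset.mul_sum]
  refine Finset.sum_congr rfl fun σ _ => ?_
  ring

/-- The permutation sum of `M - Mᵀ`. -/
theorem pfSum_sub_transpose (M : Matrix (ι × Fin 2) (ι × Fin 2) ℝ) :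
    pfSum (M - M.transpose) = 2 ^ Fintype.card ι * pfSum M := by
  -- In the expanded product, `S` records the factors taken from `M`. For the others, precomposing
  -- with the swap inside the block costs exactly the sign of the factor `-M`, so each of the `2 ^
  -- card ι` choices contributes the same sum.
  have key : ∀ S : Finset ι, ∑ σ : Equiv.Perm (ι × Fin 2), ((Equiv.Perm.sign σ : ℤ) : ℝ) *
      ((∏ p ∈ S, M (σ (p, 0)) (σ (p, 1))) *
        ∏ p ∈ Finset.univ \ S, -M (σ (p, 1)) (σ (p, 0))) = pfSum M := by
    intro S
    let π : Equiv.Perm (ι × Fin 2) :=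
      Equiv.prodCongrRight fun p => if p ∈ S then 1 else Equiv.swap 0 1
    have hsign : ((Equiv.Perm.sign π : ℤ) : ℝ) = ∏ p ∈ Finset.univ \ S, (-1 : ℝ) := by
      rw [Equiv.Perm.sign_prodCongrRight, ← Finset.prod_sdiff (Finset.subset_univ S)]
      rw [Finset.prod_congr rfl fun p hp => by
        rw [if_neg (Finset.mem_sdiff.1 hp).2, Equiv.Perm.sign_swap (by decide)],
        Finset.prod_congr (s₁ := S) rfl fun p hp => by rw [if_pos hp, Equiv.Perm.sign_one]]
      simp
    unfold pfSum
    rw [← Equiv.sum_comp (Equiv.mulRight π)]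
    refine Finset.sum_congr rfl fun σ _ => ?_
    have h1 : ∏ p ∈ S, M ((σ * π) (p, 0)) ((σ * π) (p, 1)) =
        ∏ p ∈ S, M (σ (p, 0)) (σ (p, 1)) :=
      Finset.prod_congr rfl fun p hp => by simp [π, hp]
    have h2 : ∏ p ∈ Finset.univ \ S, -M ((σ * π) (p, 1)) ((σ * π) (p, 0)) =
        (∏ p ∈ Finset.univ \ S, (-1 : ℝ)) *
          ∏ p ∈ Finset.univ \ S, M (σ (p, 0)) (σ (p, 1)) := by
      rw [← Finset.prod_mul_distrib]
      exact Finset.prod_congr rfl fun p hp => by simp [π, (Finset.mem_sdiff.1 hp).2]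
    have h3 : (∏ p ∈ Finset.univ \ S, (-1 : ℝ)) * (∏ p ∈ Finset.univ \ S, (-1 : ℝ)) = 1 := by
      rw [← Finset.prod_mul_distrib]; simp
    rw [Equiv.coe_mulRight, h1, h2, Equiv.Perm.sign_mul, Units.val_mul, Int.cast_mul, hsign,
      ← Finset.prod_sdiff (Finset.subset_univ S)]
    linear_combination (((Equiv.Perm.sign σ : ℤ) : ℝ) * (∏ p ∈ S, M (σ (p, 0)) (σ (p, 1))) *
      ∏ p ∈ Finset.univ \ S, M (σ (p, 0)) (σ (p, 1))) * h3
  have : pfSum (M - M.transpose) = ∑ S ∈ (Finset.univ : Finset ι).powerset, pfSum M := by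
    rw [← Finset.sum_congr rfl fun S _ => key S, Finset.sum_comm]
    refine Finset.sum_congr rfl fun σ _ => ?_
    rw [← Finset.mul_sum, ← Finset.prod_add]
    simp [sub_eq_add_neg]
  rw [this]
  simp

/-- Expansion of the Pfaffian of `T β Tᵀ` in minors of `T`. -/
theorem pfSum_mul_mul_transpose {γ : Type*} [Fintype γ] [DecidableEq γ]
    (T : Matrix (ι × Fin 2) γ ℝ) (β : Matrix γ γ ℝ) :
    pfSum (T * β * T.transpose) =
      ∑ f : ι → γ × γ, (∏ p, β (f p).1 (f p).2) *
        (T.submatrix id fun q : ι × Fin 2 => if q.2 = 0 then (f q.1).1 else (f q.1).2).det := by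
  unfold pfSum
  have h : ∀ i j, (T * β * T.transpose) i j = ∑ x : γ × γ, β x.1 x.2 * (T i x.1 * T j x.2) := by
    intro i j
    simp only [Matrix.mul_apply, Matrix.transpose_apply, Finset.sum_mul, Fintype.sum_prod_type]
    rw [Finset.sum_comm]
    exact Finset.sum_congr rfl fun _ _ => Finset.sum_congr rfl fun _ _ => by ring
  simp_rw [h, Finset.prod_univ_sum, Fintype.piFinset_univ, Finset.mul_sum]
  rw [Finset.sum_comm]
  refine Finset.sum_congr rfl fun f _ => ?_
  rw [Matrix.det_apply', Finset.mul_sum]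
  refine Finset.sum_congr rfl fun σ _ => ?_
  rw [Finset.prod_mul_distrib, Fintype.prod_prod_type]
  simp only [Fin.prod_univ_two, Matrix.submatrix_apply, id]
  simp
  ring

/-- The Pfaffian of a congruent matrix. -/
theorem blockPf_congruence (P M : Matrix (ι × Fin 2) (ι × Fin 2) ℝ) :
    blockPf (P * M * P.transpose) = P.det * blockPf M := by
  unfold blockPf
  rw [mul_left_comm]
  congr 1
  rw [pfSum_mul_mul_transpose]
  -- A choice of a pair of columns for every block is the same as a self-map of the index set. Maps
  -- that are not bijective repeat a column of `P` and drop out; permutations contribute their sign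
  -- times `P.det`.
  let F : (ι → (ι × Fin 2) × (ι × Fin 2)) ≃ (ι × Fin 2 → ι × Fin 2) :=
    { toFun := fun f q => if q.2 = 0 then (f q.1).1 else (f q.1).2
      invFun := fun g p => (g (p, 0), g (p, 1))
      left_inv := fun f => by ext p <;> simp
      right_inv := fun g => by
        funext ⟨p, c⟩
        fin_cases c <;> simp }
  rw [← F.symm.sum_comp]
  have hF : ∀ g : ι × Fin 2 → ι × Fin 2, (fun q : ι × Fin 2 =>
      if q.2 = 0 then (F.symm g q.1).1 else (F.symm g q.1).2) = g := fun g => F.right_inv g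
  simp_rw [hF]
  have h0 : ∀ g : ι × Fin 2 → ι × Fin 2, ¬ Function.Bijective g →
      (∏ p, M (F.symm g p).1 (F.symm g p).2) * (P.submatrix id g).det = 0 := by
    intro g hg
    rw [Finite.injective_iff_bijective.symm, Function.Injective] at hg
    push Not at hg
    obtain ⟨a, b, hab, hne⟩ := hg
    rw [Matrix.det_zero_of_column_eq hne (by simp [hab]), mul_zero]
  unfold pfSum
  rw [Finset.mul_sum]
  symm
  refine Finset.sum_of_injOn (fun σ : Equiv.Perm (ι × Fin 2) => (σ : ι × Fin 2 → ι × Fin 2))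
    (fun a _ b _ h => DFunLike.coe_injective h) (fun _ _ => Finset.mem_coe.2 (Finset.mem_univ _))
    (fun g _ hg => h0 g fun hb => hg ⟨Equiv.ofBijective g hb, by simp, rfl⟩) fun σ _ => ?_
  rw [Matrix.det_permute']
  simp only [F, Equiv.coe_fn_symm_mk]
  ring

/-- The permutation sum that computes the Pfaffian of `M - Mᵀ`. -/
def skewPf (M : Matrix (ι × Fin 2) (ι × Fin 2) ℝ) : ℝ :=
  (1 / ((Fintype.card ι).factorial : ℝ)) * pfSum M

theorem blockPf_sub_transpose (M : Matrix (ι × Fin 2) (ι × Fin 2) ℝ) :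
    blockPf (M - M.transpose) = skewPf M := by
  rw [blockPf, skewPf, pfSum_sub_transpose]
  field_simp

theorem skewPf_submatrix_equiv (e : ι ≃ κ) (M : Matrix (κ × Fin 2) (κ × Fin 2) ℝ) :
    skewPf (M.submatrix (Prod.map e id) (Prod.map e id)) = skewPf M := by
  rw [skewPf, skewPf, pfSum_submatrix_equiv, Fintype.card_congr e]

/-- The principal submatrix on the blocks for which a predicate holds. -/
abbrev blockSub (p : ι → Prop) (M : Matrix (ι × Fin 2) (ι × Fin 2) ℝ) :
    Matrix (Subtype p × Fin 2) (Subtype p × Fin 2) ℝ :=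
  M.submatrix (Prod.map Subtype.val id) (Prod.map Subtype.val id)

/-! ### Expansion of Pf(J - V) in principal Pfaffian minors -/

theorem single_eq_zero_of_ne (i : ι) (t : ℝ) (σ : Equiv.Perm (ι × Fin 2)) {p : ι}
    (hp : p ≠ (σ⁻¹ (i, 0)).1) :
    Matrix.single (i, (0 : Fin 2)) (i, (1 : Fin 2)) t (σ (p, 0)) (σ (p, 1)) = 0 := by
  have h : (i, (0 : Fin 2)) ≠ σ (p, 0) := fun hc => hp (by rw [hc]; simp)
  simp [h]

/-- A permutation hits the index `(i, 0)` only once, so at most one factor sees the perturbation and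
the product is affine in `t`. -/
theorem prod_add_single (i : ι) (t : ℝ) (M : Matrix (ι × Fin 2) (ι × Fin 2) ℝ)
    (σ : Equiv.Perm (ι × Fin 2)) :
    ∏ p, (M + Matrix.single (i, (0 : Fin 2)) (i, (1 : Fin 2)) t) (σ (p, 0)) (σ (p, 1)) =
      (∏ p, M (σ (p, 0)) (σ (p, 1))) +
        ∑ p, Matrix.single (i, (0 : Fin 2)) (i, (1 : Fin 2)) t (σ (p, 0)) (σ (p, 1)) *
          ∏ q ∈ Finset.univ.erase p, M (σ (q, 0)) (σ (q, 1)) := by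
  set r := (σ⁻¹ (i, (0 : Fin 2))).1 with hr
  rw [Finset.sum_eq_single r (fun p _ hp => by rw [single_eq_zero_of_ne i t σ hp, zero_mul])
    (by simp), ← Finset.mul_prod_erase _ _ (Finset.mem_univ r),
    ← Finset.mul_prod_erase Finset.univ (fun p => M (σ (p, 0)) (σ (p, 1))) (Finset.mem_univ r),
    ← add_mul]
  congr 1
  refine Finset.prod_congr rfl fun p hp => ?_
  rw [Matrix.add_apply, single_eq_zero_of_ne i t σ (Finset.ne_of_mem_erase hp), add_zero]

/-- The permutations that fix the `i`-th block pointwise come from the other blocks. -/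
theorem sum_perm_fixing (i : ι) (M : Matrix (ι × Fin 2) (ι × Fin 2) ℝ) :
    ∑ σ : Equiv.Perm (ι × Fin 2), ((Equiv.Perm.sign σ : ℤ) : ℝ) *
      (Matrix.single (i, (0 : Fin 2)) (i, (1 : Fin 2)) 1 (σ (i, 0)) (σ (i, 1)) *
        ∏ q ∈ Finset.univ.erase i, M (σ (q, 0)) (σ (q, 1))) =
      pfSum (blockSub (fun j => j ≠ i) M) := by
  let e : {j // j ≠ i} × Fin 2 ≃ {x : ι × Fin 2 // x.1 ≠ i} :=
    { toFun := fun x => ⟨(x.1.1, x.2), x.1.2⟩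
      invFun := fun x => (⟨x.1.1, x.2⟩, x.1.2)
      left_inv := fun _ => rfl
      right_inv := fun _ => rfl }
  have hfix : ∀ (ρ : Equiv.Perm ({j // j ≠ i} × Fin 2)) (c : Fin 2),
      ρ.extendDomain e (i, c) = (i, c) := fun ρ c =>
    Equiv.Perm.extendDomain_apply_not_subtype _ _ (by simp)
  have hmov : ∀ (ρ : Equiv.Perm ({j // j ≠ i} × Fin 2)) (x : {j // j ≠ i} × Fin 2),
      ρ.extendDomain e (x.1.1, x.2) = ((ρ x).1.1, (ρ x).2) := fun ρ x =>
    Equiv.Perm.extendDomain_apply_image ρ e x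
  unfold pfSum
  symm
  refine Finset.sum_of_injOn (fun ρ => ρ.extendDomain e)
    (fun a _ b _ h => Equiv.Perm.extendDomainHom_injective e h)
    (fun _ _ => Finset.mem_coe.2 (Finset.mem_univ _)) (fun σ _ hσ => ?_) fun ρ _ => ?_
  -- A permutation outside the range of the extension map must move a point of the block `i`, and
  -- then the elementary matrix kills its term. If it fixed the block pointwise, it would restrict
  -- to the complement and lie in the range.
  · by_cases h : (i, (0 : Fin 2)) = σ (i, 0) ∧ (i, (1 : Fin 2)) = σ (i, 1)
    · exfalso
      apply hσ
      have hp : ∀ a : ι × Fin 2, ¬ a.1 ≠ i → σ a = a := by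
        rintro ⟨a, c⟩ ha
        obtain rfl : a = i := not_not.1 ha
        fin_cases c
        · exact h.1.symm
        · exact h.2.symm
      refine ⟨e.symm.permCongr ((Equiv.Perm.subtypeEquivSubtypePerm _).symm ⟨σ, hp⟩), by simp, ?_⟩
      have h2 := (Equiv.Perm.subtypeEquivSubtypePerm fun x : ι × Fin 2 => x.1 ≠ i).apply_symm_apply
        ⟨σ, hp⟩
      have h3 := congrArg Subtype.val h2
      refine Eq.trans ?_ h3
      ext1 a
      beta_reduce
      by_cases ha : a.1 ≠ i
      · rw [Equiv.Perm.extendDomain_apply_subtype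
            (p := fun x : ι × Fin 2 => x.1 ≠ i) (b := a) _ _ ha,
          Equiv.Perm.subtypeEquivSubtypePerm_apply_of_mem
            (p := fun x : ι × Fin 2 => x.1 ≠ i) _ ha]
        simp [Equiv.permCongr_apply]
      · rw [Equiv.Perm.extendDomain_apply_not_subtype
            (p := fun x : ι × Fin 2 => x.1 ≠ i) (b := a) _ _ ha,
          Equiv.Perm.subtypeEquivSubtypePerm_apply_of_not_mem
            (p := fun x : ι × Fin 2 => x.1 ≠ i) _ ha]
    · rw [Matrix.single_apply_of_ne _ _ _ _ _ h]; simp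
  · simp only [hfix, Equiv.Perm.sign_extendDomain, Matrix.single_apply_same, one_mul]
    congr 1
    rw [Finset.prod_subtype (Finset.univ.erase i) (p := fun j => j ≠ i) (by simp)
      (fun q => M (ρ.extendDomain e (q, 0)) (ρ.extendDomain e (q, 1)))]
    exact Finset.prod_congr rfl fun q _ => by
      rw [hmov ρ (q, 0), hmov ρ (q, 1)]; rfl

/-- Expansion of the permutation sum in one entry of a diagonal block. -/
theorem pfSum_add_single (i : ι) (t : ℝ) (M : Matrix (ι × Fin 2) (ι × Fin 2) ℝ) :
    pfSum (M + Matrix.single (i, (0 : Fin 2)) (i, (1 : Fin 2)) t) =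
      pfSum M + t * (Fintype.card ι * pfSum (blockSub (fun j => j ≠ i) M)) := by
  have hp : ∀ p : ι, ∑ σ : Equiv.Perm (ι × Fin 2), ((Equiv.Perm.sign σ : ℤ) : ℝ) *
      (Matrix.single (i, (0 : Fin 2)) (i, (1 : Fin 2)) t (σ (p, 0)) (σ (p, 1)) *
        ∏ q ∈ Finset.univ.erase p, M (σ (q, 0)) (σ (q, 1))) =
      t * pfSum (blockSub (fun j => j ≠ i) M) := by
    intro p
    -- Exchanging two whole blocks is a product of two transpositions, hence even. So every position
    -- `p` contributes as much as `p = i`, which produces the factor `card ι`.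
    let π : Equiv.Perm (ι × Fin 2) := Equiv.prodCongrLeft fun _ => Equiv.swap p i
    have hπ : Equiv.Perm.sign π = 1 := by
      rw [Equiv.Perm.sign_prodCongrLeft]
      simp
    rw [← sum_perm_fixing, Finset.mul_sum, ← Equiv.sum_comp (Equiv.mulRight π)]
    refine Finset.sum_congr rfl fun σ _ => ?_
    rw [Equiv.coe_mulRight, Equiv.Perm.sign_mul, hπ, mul_one]
    have h1 : ∀ c, (σ * π) (p, c) = σ (i, c) := fun c => by simp [π]
    have h2 : ∏ q ∈ Finset.univ.erase p, M ((σ * π) (q, 0)) ((σ * π) (q, 1)) =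
        ∏ q ∈ Finset.univ.erase i, M (σ (q, 0)) (σ (q, 1)) := by
      refine Finset.prod_equiv (Equiv.swap p i) (fun q => ?_) fun q _ => by simp [π]
      simp only [Finset.mem_erase, Finset.mem_univ, and_true, ne_eq]
      rw [Equiv.swap_apply_eq_iff, Equiv.swap_apply_right]
    rw [h1, h1, h2, Matrix.single_apply, Matrix.single_apply]
    split_ifs <;> ring
  have : pfSum (M + Matrix.single (i, (0 : Fin 2)) (i, (1 : Fin 2)) t) =
      pfSum M + ∑ p : ι, t * pfSum (blockSub (fun j => j ≠ i) M) := by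
    rw [← Finset.sum_congr rfl fun p _ => hp p, Finset.sum_comm]
    unfold pfSum
    rw [← Finset.sum_add_distrib]
    refine Finset.sum_congr rfl fun σ _ => ?_
    rw [prod_add_single, mul_add, Finset.mul_sum]
  rw [this]
  simp only [Finset.sum_const, Finset.card_univ, nsmul_eq_mul]
  ring

/-- The factor `card ι` of the unnormalised expansion turns `1 / n!` into `1 / (n - 1)!`, the
normalisation of the smaller matrix. -/
theorem skewPf_add_single (i : ι) (t : ℝ) (M : Matrix (ι × Fin 2) (ι × Fin 2) ℝ) :
    skewPf (M + Matrix.single (i, (0 : Fin 2)) (i, (1 : Fin 2)) t) =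
      skewPf M + t * skewPf (blockSub (fun j => j ≠ i) M) := by
  obtain ⟨n, hn⟩ : ∃ n, Fintype.card ι = n + 1 :=
    Nat.exists_eq_succ_of_ne_zero (Fintype.card_pos_iff.2 ⟨i⟩).ne'
  have hc : Fintype.card {j // j ≠ i} = n := by
    rw [Fintype.card_subtype_compl, hn]; simp
  rw [skewPf, skewPf, skewPf, pfSum_add_single, hc, hn, Nat.factorial_succ]
  push_cast
  field_simp

/-- The upper triangular half of the symplectic form on the blocks of a set. -/
def upperForm (S : Finset ι) : Matrix (ι × Fin 2) (ι × Fin 2) ℝ :=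
  ∑ i ∈ S, Matrix.single (i, (0 : Fin 2)) (i, (1 : Fin 2)) 1

theorem skewPf_blockSub_add_single (S : Finset ι) {i : ι} (hi : i ∈ S)
    (M : Matrix (ι × Fin 2) (ι × Fin 2) ℝ) :
    skewPf (blockSub (· ∈ S) (M + Matrix.single (i, (0 : Fin 2)) (i, (1 : Fin 2)) 1)) =
      skewPf (blockSub (· ∈ S) M) + skewPf (blockSub (· ∈ S.erase i) M) := by
  have h1 : blockSub (· ∈ S) (M + Matrix.single (i, (0 : Fin 2)) (i, (1 : Fin 2)) 1) =
      blockSub (· ∈ S) M +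
        Matrix.single ((⟨i, hi⟩ : {j // j ∈ S}), (0 : Fin 2)) (⟨i, hi⟩, (1 : Fin 2)) 1 := by
    ext ⟨⟨a, ha⟩, c⟩ ⟨⟨b, hb⟩, d⟩
    simp [Matrix.single_apply]
  rw [h1, skewPf_add_single, one_mul]
  congr 1
  let e : {j // j ∈ S.erase i} ≃ {j : {j // j ∈ S} // j ≠ ⟨i, hi⟩} :=
    { toFun := fun j => ⟨⟨j.1, Finset.mem_of_mem_erase j.2⟩, fun h =>
        Finset.ne_of_mem_erase j.2 (congrArg Subtype.val h)⟩
      invFun := fun j => ⟨j.1.1, Finset.mem_erase.2 ⟨fun h => j.2 (Subtype.ext h), j.1.2⟩⟩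
      left_inv := fun _ => rfl
      right_inv := fun _ => rfl }
  rw [← skewPf_submatrix_equiv e]
  rfl

/-- Induction on the blocks that receive the symplectic form: each new one is either kept or
deleted. The ambient set `S` varies in the induction because deletion shrinks it. -/
theorem skewPf_blockSub_add_upperForm (T : Finset ι) :
    ∀ (S : Finset ι), T ⊆ S → ∀ M : Matrix (ι × Fin 2) (ι × Fin 2) ℝ,
      skewPf (blockSub (· ∈ S) (M + upperForm T)) =
        ∑ R ∈ T.powerset, skewPf (blockSub (· ∈ S \ R) M) := by
  induction T using Finset.induction_on with
  | empty =>
    intro S _ M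
    rw [Finset.powerset_empty, Finset.sum_singleton, Finset.sdiff_empty, upperForm,
      Finset.sum_empty, add_zero]
  | insert i T hi ih =>
    intro S hS M
    have hiS : i ∈ S := hS (Finset.mem_insert_self i T)
    have hTS : T ⊆ S := (Finset.subset_insert i T).trans hS
    have h1 : M + upperForm (insert i T) =
        (M + upperForm T) + Matrix.single (i, (0 : Fin 2)) (i, (1 : Fin 2)) 1 := by
      rw [upperForm, upperForm, Finset.sum_insert hi]; abel
    rw [h1, skewPf_blockSub_add_single S hiS, ih S hTS,
      ih (S.erase i) fun j hj => Finset.mem_erase.2 ⟨fun h => hi (h ▸ hj), hTS hj⟩,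
      Finset.sum_powerset_insert hi]
    congr 1
    refine Finset.sum_congr rfl fun R _ => ?_
    have : S.erase i \ R = S \ insert i R := by
      ext x; simp only [Finset.mem_sdiff, Finset.mem_erase, Finset.mem_insert]; tauto
    rw [this]

/-- The Pfaffian of `J + M - Mᵀ` is the sum of the Pfaffians of the principal parts. -/
theorem skewPf_add_upperForm (M : Matrix (ι × Fin 2) (ι × Fin 2) ℝ) :
    skewPf (M + upperForm Finset.univ) = ∑ S : Finset ι, skewPf (blockSub (· ∈ S) M) := by
  have h := skewPf_blockSub_add_upperForm (Finset.univ : Finset ι) Finset.univ subset_rfl M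
  have h2 := skewPf_submatrix_equiv (Equiv.subtypeUnivEquiv fun x : ι => Finset.mem_univ x)
    (M + upperForm Finset.univ)
  rw [← h2]
  refine Eq.trans h ?_
  rw [Finset.powerset_univ]
  refine Fintype.sum_equiv (Function.Involutive.toPerm (compl : Finset ι → Finset ι) compl_involutive) _ _ fun R => ?_
  rw [Function.Involutive.coe_toPerm, Finset.compl_eq_univ_sdiff]

/-- The symplectic form `J`. -/
def symplForm (ι : Type*) [Fintype ι] [DecidableEq ι] : Matrix (ι × Fin 2) (ι × Fin 2) ℝ :=
  upperForm Finset.univ - (upperForm Finset.univ).transpose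

theorem blockPf_symplForm_sub {V : Matrix (ι × Fin 2) (ι × Fin 2) ℝ} (hV : V.transpose = -V) :
    blockPf (symplForm ι - V) =
      ∑ S : Finset ι, (-1) ^ S.card * blockPf (blockSub (· ∈ S) V) := by
  have h1 : symplForm ι - V = ((-(1 / 2 : ℝ)) • V + upperForm Finset.univ) -
      ((-(1 / 2 : ℝ)) • V + upperForm Finset.univ).transpose := by
    rw [Matrix.transpose_add, Matrix.transpose_smul, hV, symplForm]
    ext a b
    simp only [Matrix.sub_apply, Matrix.add_apply, Matrix.smul_apply, Matrix.neg_apply,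
      smul_eq_mul]
    ring
  rw [h1, blockPf_sub_transpose, skewPf_add_upperForm]
  -- The factor `-1/2` makes `M - Mᵀ` equal to `-V`; the sign is then pulled out of each minor by
  -- homogeneity, one `-1` per block.
  refine Finset.sum_congr rfl fun S _ => ?_
  have h2 : -blockSub (· ∈ S) V = blockSub (· ∈ S) ((-(1 / 2 : ℝ)) • V) -
      (blockSub (· ∈ S) ((-(1 / 2 : ℝ)) • V)).transpose := by
    ext a b
    have := congrFun (congrFun hV (Prod.map Subtype.val id a)) (Prod.map Subtype.val id b)
    simp only [Matrix.transpose_apply, Matrix.neg_apply] at this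
    simp [this]
    ring
  rw [← blockPf_sub_transpose, ← h2, ← neg_one_smul ℝ, blockPf_smul]
  simp

end BlockPf

/-! ### The square of the Pfaffian -/

section Square

variable {ι κ : Type*} [Fintype ι] [DecidableEq ι] [Fintype κ] [DecidableEq κ]

/-- Square roots near the identity that inherit an anti-symmetry. -/
theorem eventually_exists_sqrt {R : Type*} [NormedRing R] [NormedAlgebra ℝ R] [CompleteSpace R]
    (τ : R → R) (hτ : Continuous τ) (h1 : τ 1 = 1) (hmul : ∀ x, τ (x * x) = τ x * τ x) :
    ∀ᶠ Q in 𝓝 (1 : R), τ Q = Q → ∃ P, P * P = Q ∧ τ P = P := by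
  let f : R → R := fun x => x * x
  let e : R ≃L[ℝ] R := ContinuousLinearEquiv.smulLeft (Units.mk0 (2 : ℝ) two_ne_zero)
  have hf : HasStrictFDerivAt f (e : R →L[ℝ] R) 1 := by
    have h := (hasStrictFDerivAt_id (𝕜 := ℝ) (1 : R)).mul' (hasStrictFDerivAt_id (𝕜 := ℝ) (1 : R))
    refine h.congr_fderiv ?_
    ext x
    simp [e, two_smul, Units.smul_def]
  let g := hf.localInverse f e 1
  have hf1 : f 1 = 1 := by simp [f]
  have hg1 : g 1 = 1 := by
    have := hf.localInverse_apply_image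
    rwa [hf1] at this
  have hgc : ContinuousAt g 1 := by
    have := hf.localInverse_continuousAt
    rwa [hf1] at this
  have hr : ∀ᶠ y in 𝓝 (1 : R), f (g y) = y := by
    have := hf.eventually_right_inverse
    rwa [hf1] at this
  have hl : ∀ᶠ x in 𝓝 (1 : R), g (f x) = x := hf.eventually_left_inverse
  have ht : Tendsto (fun y => τ (g y)) (𝓝 1) (𝓝 1) := by
    have h : Tendsto (fun y => τ (g y)) (𝓝 1) (𝓝 (τ (g 1))) :=
      (hτ.tendsto (g 1)).comp hgc
    rwa [hg1, h1] at h
  -- Squaring is locally invertible at `1`, its derivative there being `2`. If `τ` fixes `Q`, then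
  -- `τ (g Q)` is another square root of `Q` near `1`, so local injectivity forces it to be `g Q`.
  filter_upwards [hr, ht.eventually hl] with Q h2 h3 hQ
  refine ⟨g Q, h2, ?_⟩
  have h4 : f (τ (g Q)) = Q := by
    change τ (g Q) * τ (g Q) = Q
    rw [← hmul]
    exact (congrArg τ h2).trans hQ
  rw [h4] at h3
  exact h3.symm

theorem symplForm_apply (a b : ι × Fin 2) :
    symplForm ι a b = if a.1 = b.1 then (if a.2 = 0 ∧ b.2 = 1 then 1 else
      if a.2 = 1 ∧ b.2 = 0 then -1 else 0) else 0 := by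
  obtain ⟨i, c⟩ := a
  obtain ⟨j, d⟩ := b
  simp only [symplForm, upperForm, Matrix.sub_apply, Matrix.transpose_apply, Matrix.sum_apply,
    Matrix.single_apply, Prod.mk.injEq]
  by_cases hij : i = j
  · subst hij
    fin_cases c <;> fin_cases d <;> simp
  · have h1 : ∀ x, ¬ (x = i ∧ x = j) := fun x h => hij (h.1 ▸ h.2)
    have h2 : ∀ x, ¬ (x = j ∧ x = i) := fun x h => hij (h.2 ▸ h.1)
    rw [if_neg hij, Finset.sum_eq_zero, Finset.sum_eq_zero, sub_zero]
    · intro x _; rw [if_neg]; rintro ⟨⟨rfl, _⟩, ⟨rfl, _⟩⟩; exact hij rfl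
    · intro x _; rw [if_neg]; rintro ⟨⟨rfl, _⟩, ⟨rfl, _⟩⟩; exact hij rfl

theorem symplForm_transpose : (symplForm ι).transpose = -symplForm ι := by
  simp [symplForm]

theorem symplForm_mul_self : symplForm ι * symplForm ι = -1 := by
  ext ⟨i, c⟩ ⟨j, d⟩
  rw [Matrix.mul_apply, Fintype.sum_prod_type, Finset.sum_eq_single i
    (fun k _ hk => by simp [symplForm_apply, hk.symm]) (by simp), Fin.sum_univ_two]
  by_cases hij : i = j
  · subst hij
    fin_cases c <;> fin_cases d <;> simp [symplForm_apply]
  · simp [symplForm_apply, hij]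

theorem blockPf_symplForm : blockPf (symplForm ι) = 1 := by
  have h := blockPf_symplForm_sub (V := (0 : Matrix (ι × Fin 2) (ι × Fin 2) ℝ)) (by simp)
  rw [sub_zero] at h
  rw [h, Finset.sum_eq_single ∅]
  · simp [blockPf, pfSum]
  · intro S _ hS
    obtain ⟨i, hi⟩ := Finset.nonempty_iff_ne_empty.2 hS
    have : blockPf (blockSub (· ∈ S) (0 : Matrix (ι × Fin 2) (ι × Fin 2) ℝ)) = 0 := by
      have h0 : blockSub (· ∈ S) (0 : Matrix (ι × Fin 2) (ι × Fin 2) ℝ) =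
          (0 : ℝ) • (0 : Matrix ({x // x ∈ S} × Fin 2) ({x // x ∈ S} × Fin 2) ℝ) := by
        ext; simp
      rw [h0, blockPf_smul, zero_pow, zero_mul]
      exact (Fintype.card_pos_iff.2 ⟨⟨i, hi⟩⟩).ne'
    rw [this, mul_zero]
  · simp

theorem det_symplForm : (symplForm ι).det = 1 := by
  have h : blockPf (symplForm ι * symplForm ι * (symplForm ι).transpose) =
      (symplForm ι).det * blockPf (symplForm ι) := blockPf_congruence _ _
  rw [symplForm_mul_self, symplForm_transpose, blockPf_symplForm] at h
  simpa [blockPf_symplForm] using h.symm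

/-- Near `J` a skew matrix is congruent to `J`: if `P * P = 1 + z V J` and `J Pᵀ = P J`, then `P J
Pᵀ = P P J = J - z V`. Both sides then equal `P.det ^ 2`. -/
theorem eventually_blockPf_sq (V : Matrix (ι × Fin 2) (ι × Fin 2) ℝ) (hV : V.transpose = -V) :
    ∀ᶠ z in 𝓝 (0 : ℝ), blockPf (symplForm ι - z • V) ^ 2 = (symplForm ι - z • V).det := by
  let J := symplForm ι
  have hJJ : J * J = -1 := symplForm_mul_self
  have hJT : J.transpose = -J := symplForm_transpose
  let := Matrix.linftyOpNormedRing (n := ι × Fin 2) (α := ℝ)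
  let := Matrix.linftyOpNormedAlgebra (n := ι × Fin 2) (α := ℝ) (R := ℝ)
  -- This is the adjoint with respect to the form `J`. It reverses products, which does not matter
  -- for squares, and it fixes `1 + z V J` because `V` is skew.
  let τ : Matrix (ι × Fin 2) (ι × Fin 2) ℝ → Matrix (ι × Fin 2) (ι × Fin 2) ℝ :=
    fun P => -(J * P.transpose * J)
  have hτ : Continuous τ := by fun_prop
  have hmul : ∀ x, τ (x * x) = τ x * τ x := fun x => by
    simp only [τ, Matrix.transpose_mul, neg_mul_neg]
    have : J * x.transpose * J * (J * x.transpose * J) =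
        J * x.transpose * (J * J) * x.transpose * J := by simp only [mul_assoc]
    rw [this, hJJ]
    simp [mul_assoc]
  have h := eventually_exists_sqrt τ hτ (by simp [τ, hJJ]) hmul
  have hc : Tendsto (fun z : ℝ => 1 + z • (V * J)) (𝓝 0) (𝓝 1) := by
    have : Continuous fun z : ℝ => 1 + z • (V * J) := by fun_prop
    simpa using this.tendsto 0
  filter_upwards [hc.eventually h] with z hz
  obtain ⟨P, hP, hτP⟩ := hz (by
    simp only [τ, Matrix.transpose_add, Matrix.transpose_one, Matrix.transpose_smul,
      Matrix.transpose_mul, hJT, hV, neg_mul_neg, mul_add, add_mul, mul_one, hJJ]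
    have : J * z • (J * V) * J = z • ((J * J) * V * J) := by
      simp only [Matrix.mul_smul, Matrix.smul_mul, mul_assoc]
    rw [this, hJJ]
    simp [add_comm])
  have h1 : J * P.transpose = P * J := by
    have : τ P * J = J * P.transpose := by
      simp only [τ]
      rw [neg_mul, mul_assoc, hJJ]
      simp
    rw [← this, hτP]
  have h2 : J - z • V = P * J * P.transpose := by
    rw [mul_assoc, h1, ← mul_assoc, hP, add_mul, Matrix.smul_mul, mul_assoc, hJJ]
    simp [sub_eq_add_neg]
  change blockPf (J - z • V) ^ 2 = (J - z • V).det
  rw [h2, blockPf_congruence, Matrix.det_mul, Matrix.det_mul, Matrix.det_transpose]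
  simp only [J, blockPf_symplForm, det_symplForm]
  ring

theorem analyticAt_det {R : Type*} [Fintype R] [DecidableEq R] {F : ℝ → Matrix R R ℝ} {z : ℝ}
    (hF : ∀ i j, AnalyticAt ℝ (fun t => F t i j) z) : AnalyticAt ℝ (fun t => (F t).det) z := by
  simp only [Matrix.det_apply']
  fun_prop

/-- The square of the Pfaffian of a skew-symmetric matrix is its determinant. -/
theorem blockPf_sq {M : Matrix (ι × Fin 2) (ι × Fin 2) ℝ} (hM : M.transpose = -M) :
    blockPf M ^ 2 = M.det := by
  -- The segment `J - z V` joins `J` to `M`. Both sides are polynomial in `z`, so their agreement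
  -- near `z = 0` persists to `z = 1`.
  let V := symplForm ι - M
  have hV : V.transpose = -V := by
    simp [V, symplForm_transpose, hM]
    abel
  have h1 : AnalyticOnNhd ℝ (fun z : ℝ => blockPf (symplForm ι - z • V) ^ 2) univ := by
    intro z _
    simp only [blockPf, pfSum, Matrix.sub_apply, Matrix.smul_apply, smul_eq_mul]
    fun_prop
  have h2 : AnalyticOnNhd ℝ (fun z : ℝ => (symplForm ι - z • V).det) univ := by
    intro z _
    refine analyticAt_det fun i j => ?_
    simp only [Matrix.sub_apply, Matrix.smul_apply, smul_eq_mul]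
    fun_prop
  have := congrFun (h1.eq_of_eventuallyEq h2 (eventually_blockPf_sq V hV)) 1
  simpa [V] using this

end Square

/-! ### Fredholm series of kernels of finite rank -/

section FiniteRank

set_option linter.unusedSectionVars false

variable {κ : Type*} [Fintype κ] [DecidableEq κ]

/-- A sum over functions of a quantity that only depends on the image of an injection. -/
theorem sum_functions_eq_factorial_mul (n : ℕ) (h : (Fin n → κ) → ℝ) (g : Finset κ → ℝ)
    (h0 : ∀ f, ¬ Function.Injective f → h f = 0)
    (h1 : ∀ (S : Finset κ) (e : Fin n ≃ S), h (fun i => e i) = g S) :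
    ∑ f, h f = n.factorial * ∑ S ∈ Finset.powersetCard n Finset.univ, g S := by
  have hsurj : ∀ f : Fin n → κ, Function.Injective f → ∀ S, Finset.univ.image f = S →
      ∃ e : Fin n ≃ S, (fun i => (e i : κ)) = f := by
    intro f hf S hS
    refine ⟨Equiv.ofBijective (fun i => ⟨f i, hS ▸ Finset.mem_image_of_mem f (Finset.mem_univ i)⟩)
      ⟨fun a b hab => hf (congrArg Subtype.val hab), ?_⟩, rfl⟩
    rintro ⟨y, hy⟩
    rw [← hS] at hy
    obtain ⟨i, -, rfl⟩ := Finset.mem_image.1 hy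
    exact ⟨i, rfl⟩
  have himg : ∀ (S : Finset κ) (e : Fin n ≃ S), Finset.univ.image (fun i => (e i : κ)) = S := by
    intro S e
    ext y
    simp only [Finset.mem_image, Finset.mem_univ, true_and]
    exact ⟨fun ⟨i, hi⟩ => hi ▸ (e i).2, fun hy => ⟨e.symm ⟨y, hy⟩, by simp⟩⟩
  have hinj : ∀ (S : Finset κ) (e : Fin n ≃ S), Function.Injective fun i => (e i : κ) :=
    fun S e => Subtype.val_injective.comp e.injective
  rw [← Finset.sum_filter_add_sum_filter_not Finset.univ Function.Injective,
    Finset.sum_eq_zero (s := Finset.univ.filter fun f => ¬ Function.Injective f)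
      (fun f hf => h0 f (Finset.mem_filter.1 hf).2), add_zero,
    ← Finset.sum_fiberwise_of_maps_to (t := Finset.powersetCard n Finset.univ)
      (g := fun f => Finset.univ.image f), Finset.mul_sum]
  · refine Finset.sum_congr rfl fun S hS => ?_
    have hcard : Fintype.card S = n := by
      rw [Fintype.card_coe]; exact (Finset.mem_powersetCard.1 hS).2
    rw [Finset.sum_congr rfl (g := fun _ => g S), Finset.sum_const, nsmul_eq_mul]
    · congr 2
      have : (Finset.univ : Finset (Fin n ≃ S)).card = n.factorial := by
        rw [Finset.card_univ, Fintype.card_equiv (Fintype.equivOfCardEq (by simp [hcard])),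
          Fintype.card_fin]
      rw [← this]
      symm
      refine Finset.card_bij (fun e _ i => (e i : κ)) (fun e _ => ?_) (fun e _ e' _ he => ?_)
        fun f hf => ?_
      · simp only [Finset.mem_filter, Finset.mem_univ, true_and]
        exact ⟨hinj S e, himg S e⟩
      · ext i
        exact congrFun he i
      · simp only [Finset.mem_filter, Finset.mem_univ, true_and] at hf
        obtain ⟨e, he⟩ := hsurj f hf.1 S hf.2
        exact ⟨e, Finset.mem_univ _, he⟩
    · intro f hf
      simp only [Finset.mem_filter, Finset.mem_univ, true_and] at hf
      obtain ⟨e, rfl⟩ := hsurj f hf.1 S hf.2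
      exact h1 S e
  · intro f hf
    rw [Finset.mem_powersetCard]
    refine ⟨Finset.subset_univ _, ?_⟩
    rw [Finset.card_image_of_injective _ (Finset.mem_filter.1 hf).2]
    simp

/-- Finite rank makes a Fredholm series terminate: no subset has more than `card κ` elements. -/
theorem tsum_powersetCard (a : Finset κ → ℝ) (t : ℕ → ℝ)
    (ht : ∀ n, t n = ∑ S ∈ Finset.powersetCard n Finset.univ, a S) :
    ∑' n, t n = ∑ S, a S := by
  rw [tsum_eq_sum (s := Finset.range (Fintype.card κ + 1)), ← Finset.powerset_univ,
    Finset.sum_powerset]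
  · exact Finset.sum_congr rfl fun n _ => ht n
  · intro n hn
    rw [ht, Finset.powersetCard_eq_empty.2, Finset.sum_empty]
    simpa using hn

theorem det_one_sub_eq_sum_minors (G : Matrix κ κ ℝ) :
    (1 - G).det = ∑ S : Finset κ, (-1) ^ S.card *
      (G.submatrix (Subtype.val : S → κ) (Subtype.val : S → κ)).det := by
  classical
  let p : Polynomial ℝ := (1 + (Polynomial.X : Polynomial ℝ) • G.map Polynomial.C).det
  have hp : p.eval (-1) = (1 - G).det := by
    change Polynomial.evalRingHom (-1) p = _
    rw [RingHom.map_det]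
    congr 1
    ext i j
    by_cases hij : i = j <;> simp [hij, sub_eq_add_neg]
  have hc := Matrix.coeff_det_one_add_X_smul_eq_sum_minors G
  rw [← hp, Polynomial.eval_eq_sum_range' (n := Fintype.card κ + 1), ← Finset.powerset_univ,
    Finset.sum_powerset]
  · refine Finset.sum_congr rfl fun n _ => ?_
    rw [hc, Finset.sum_mul]
    refine Finset.sum_congr rfl fun S hS => ?_
    rw [(Finset.mem_powersetCard.1 hS).2, mul_comm]
  · rw [Nat.lt_succ_iff, Polynomial.natDegree_le_iff_coeff_eq_zero]
    intro n hn
    rw [hc, Finset.powersetCard_eq_empty.2 (by simpa using hn), Finset.sum_empty]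

/-- The determinant of a kernel of finite rank, expanded in the functions that define it. -/
theorem det_scalarMatrix_finiteRank {n : ℕ} (f g : κ → ℝ → ℝ) (x : Fin n → ℝ) :
    (scalarMatrix (fun x y => ∑ k, f k x * g k y) x).det =
      ∑ c : Fin n → κ, ∑ σ : Equiv.Perm (Fin n), ((Equiv.Perm.sign σ : ℤ) : ℝ) *
        ∏ i, (g (c i) (x i) * f (c (σ i)) (x i)) := by
  rw [Matrix.det_apply']
  simp only [scalarMatrix, Matrix.of_apply, Finset.prod_univ_sum, Fintype.piFinset_univ,
    Finset.mul_sum]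
  rw [Finset.sum_comm]
  refine Finset.sum_congr rfl fun c _ => ?_
  rw [← Equiv.sum_comp (Equiv.inv (Equiv.Perm (Fin n)))]
  refine Finset.sum_congr rfl fun σ _ => ?_
  rw [Equiv.inv_apply, Equiv.Perm.sign_inv, Finset.prod_mul_distrib, Finset.prod_mul_distrib,
    ← Equiv.prod_comp σ (fun i => f (c i) (x (σ⁻¹ i)))]
  simp [mul_comm]

/-- Andréief's identity: grouping the factors by the variable `x i` separates the multiple integral
into entries of the Gram matrix. -/
theorem integral_det_finiteRank {f g : κ → ℝ → ℝ}
    (hfg : ∀ k l, IntegrableOn (fun x => g k x * f l x) (Ioi 0)) (n : ℕ) :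
    ∫ x : Fin n → ℝ, (scalarMatrix (fun x y => ∑ k, f k x * g k y) x).det ∂halfLineMeasure n =
      ∑ c : Fin n → κ,
        ((Matrix.of fun k l => ∫ x in Ioi 0, g k x * f l x).submatrix c c).det := by
  have hi : ∀ (c : Fin n → κ) (σ : Equiv.Perm (Fin n)),
      Integrable (fun x : Fin n → ℝ => ((Equiv.Perm.sign σ : ℤ) : ℝ) *
        ∏ i, (g (c i) (x i) * f (c (σ i)) (x i))) (halfLineMeasure n) := fun c σ =>
    (Integrable.fintype_prod (f := fun i x => g (c i) x * f (c (σ i)) x)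
      fun i => hfg _ _).const_mul _
  simp only [det_scalarMatrix_finiteRank]
  rw [integral_finsetSum _ fun c _ => integrable_finsetSum _ fun σ _ => hi c σ]
  refine Finset.sum_congr rfl fun c _ => ?_
  rw [integral_finsetSum _ fun σ _ => hi c σ, ← Matrix.det_transpose, Matrix.det_apply']
  refine Finset.sum_congr rfl fun σ _ => ?_
  rw [integral_const_mul, halfLineMeasure,
    integral_fintype_prod_eq_prod (f := fun i x => g (c i) x * f (c (σ i)) x)]
  simp

/-- The Fredholm determinant of a kernel of finite rank is a finite determinant. -/
theorem fredholmDet_finiteRank {f g : κ → ℝ → ℝ}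
    (hfg : ∀ k l, IntegrableOn (fun x => g k x * f l x) (Ioi 0)) :
    fredholmDet (fun x y => ∑ k, f k x * g k y) =
      (1 - Matrix.of fun k l => ∫ x in Ioi 0, g k x * f l x).det := by
  rw [det_one_sub_eq_sum_minors, fredholmDet]
  refine tsum_powersetCard _ _ fun n => ?_
  rw [fredholmDetTerm, integral_det_finiteRank hfg,
    sum_functions_eq_factorial_mul n _ fun S => Matrix.det (Matrix.submatrix
      (Matrix.of fun k l => ∫ x in Ioi 0, g k x * f l x) (Subtype.val : S → κ) Subtype.val)]
  · rw [← mul_assoc, div_mul_cancel₀ _ (by positivity), Finset.mul_sum]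
    refine Finset.sum_congr rfl fun S hS => ?_
    rw [(Finset.mem_powersetCard.1 hS).2]
  · intro c hc
    rw [Function.Injective] at hc
    push Not at hc
    obtain ⟨i, j, hij, hne⟩ := hc
    refine Matrix.det_zero_of_row_eq hne ?_
    ext k
    simp [hij]
  · intro S e
    rw [← Matrix.det_submatrix_equiv_self e]
    rfl

/-! ### De Bruijn's formula and Fredholm Pfaffians of finite rank -/

/-- The two rows of functions that make up a matrix kernel of finite rank. -/
def rowPair (φ ψ : κ → ℝ → ℝ) (c : Fin 2) (k : κ) (x : ℝ) : ℝ := if c = 0 then φ k x else ψ k x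

/-- The matrix kernel `Ψ(x) β Ψ(y)ᵀ`, where `Ψ` has the rows `φ` and `ψ`. -/
def pairKernel (φ ψ : κ → ℝ → ℝ) (β : Matrix κ κ ℝ) (x y : ℝ) : Matrix (Fin 2) (Fin 2) ℝ :=
  Matrix.of fun a b => ∑ k, ∑ l, rowPair φ ψ a k x * β k l * rowPair φ ψ b l y

/-- One of the two components of a pair. -/
def pick (i : κ × κ) (c : Fin 2) : κ := if c = 0 then i.1 else i.2

theorem pfaffian_pairKernel {n : ℕ} (φ ψ : κ → ℝ → ℝ) {β : Matrix κ κ ℝ}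
    (hβ : β.transpose = -β) (x : Fin n → ℝ) :
    pfaffian (blockMatrix (pairKernel φ ψ β) x) =
      (1 / (n.factorial : ℝ)) * ∑ f : Fin n → κ × κ, (∏ p, (1 / 2) * β (f p).1 (f p).2) *
        ∑ σ : Equiv.Perm (Fin n × Fin 2), ((Equiv.Perm.sign σ : ℤ) : ℝ) *
          ∏ i, (φ (pick (f (σ (i, 0)).1) (σ (i, 0)).2) (x i) *
            ψ (pick (f (σ (i, 1)).1) (σ (i, 1)).2) (x i)) := by
  let T : Matrix (Fin n × Fin 2) κ ℝ := Matrix.of fun q k => rowPair φ ψ q.2 k (x q.1)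
  -- Halving `β` presents the skew matrix as `N - Nᵀ`, so that its Pfaffian is the permutation sum
  -- of `N` with no power of `2`.
  have h1 : blockMatrix (pairKernel φ ψ β) x = T * ((1 / 2 : ℝ) • β) * T.transpose -
      (T * ((1 / 2 : ℝ) • β) * T.transpose).transpose := by
    have h2 : (T * ((1 / 2 : ℝ) • β) * T.transpose).transpose =
        -(T * ((1 / 2 : ℝ) • β) * T.transpose) := by
      simp [Matrix.transpose_mul, hβ, Matrix.mul_assoc]
    rw [h2, sub_neg_eq_add]
    ext a b
    simp only [blockMatrix, pairKernel, Matrix.of_apply, Matrix.add_apply, Matrix.mul_apply,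
      Matrix.transpose_apply, Matrix.smul_apply, smul_eq_mul, T, ← Finset.sum_add_distrib,
      Finset.sum_mul]
    rw [Finset.sum_comm]
    exact Finset.sum_congr rfl fun _ _ => Finset.sum_congr rfl fun _ _ => by ring
  rw [pfaffian_eq_blockPf, h1, blockPf_sub_transpose, skewPf, Fintype.card_fin,
    pfSum_mul_mul_transpose]
  congr 1
  refine Finset.sum_congr rfl fun f _ => ?_
  simp only [Matrix.smul_apply, smul_eq_mul]
  congr 1
  rw [← Matrix.det_transpose, Matrix.det_apply']
  refine Finset.sum_congr rfl fun σ _ => ?_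
  rw [Fintype.prod_prod_type]
  congr 1
  refine Finset.prod_congr rfl fun i _ => ?_
  simp [Fin.prod_univ_two, T, rowPair, pick]

theorem measurable_pfaffian_pairKernel {φ ψ : κ → ℝ → ℝ} (hφ : ∀ k, Measurable (φ k))
    (hψ : ∀ k, Measurable (ψ k)) (β : Matrix κ κ ℝ) (n : ℕ) :
    Measurable fun x : Fin n → ℝ => pfaffian (blockMatrix (pairKernel φ ψ β) x) := by
  have : ∀ a k, Measurable (rowPair φ ψ a k) := by
    intro a k
    fin_cases a
    · exact hφ k
    · exact hψ k
  simp only [pfaffian, blockMatrix, pairKernel, Matrix.of_apply]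
  fun_prop

/-- The skew pairing `∫ (φₖ ψₗ - ψₖ φₗ)`. -/
def skewGram (φ ψ : κ → ℝ → ℝ) : Matrix κ κ ℝ :=
  Matrix.of fun k l => (∫ x in Ioi 0, φ k x * ψ l x) - ∫ x in Ioi 0, φ l x * ψ k x

theorem skewGram_transpose (φ ψ : κ → ℝ → ℝ) : (skewGram φ ψ).transpose = -skewGram φ ψ := by
  ext; simp [skewGram]

/-- The skew form on pairs of indices whose Pfaffian minors are the terms of the Fredholm
Pfaffian of a kernel of finite rank. -/
def pairForm (β W : Matrix κ κ ℝ) : Matrix ((κ × κ) × Fin 2) ((κ × κ) × Fin 2) ℝ :=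
  Matrix.of fun a b => (if a.2 = 0 then (1 / 2) * β a.1.1 a.1.2 else 1) *
    (if b.2 = 0 then (1 / 2) * β b.1.1 b.1.2 else 1) * W (pick a.1 a.2) (pick b.1 b.2)

theorem pairForm_transpose {β W : Matrix κ κ ℝ} (hW : W.transpose = -W) :
    (pairForm β W).transpose = -pairForm β W := by
  ext a b
  have := congrFun (congrFun hW (pick a.1 a.2)) (pick b.1 b.2)
  simp only [Matrix.transpose_apply, Matrix.neg_apply] at this
  simp only [pairForm, Matrix.transpose_apply, Matrix.neg_apply, Matrix.of_apply, this]
  ring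

/-- After expansion each variable occurs in one `φ` and one `ψ`, so integration leaves a permutation
sum in `∫ φₖ ψₗ`, that is, a Pfaffian of the skew Gram matrix. The weights `½ β` enter through a
diagonal congruence. The terms become Pfaffian minors indexed by pairs of indices. -/
theorem integral_pfaffian_pairKernel {φ ψ : κ → ℝ → ℝ} {β : Matrix κ κ ℝ}
    (hβ : β.transpose = -β) (hφψ : ∀ k l, IntegrableOn (fun x => φ k x * ψ l x) (Ioi 0)) (n : ℕ) :
    ∫ x : Fin n → ℝ, pfaffian (blockMatrix (pairKernel φ ψ β) x) ∂halfLineMeasure n =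
      ∑ f : Fin n → κ × κ, blockPf ((pairForm β (skewGram φ ψ)).submatrix
        (Prod.map f id) (Prod.map f id)) := by
  have hi : ∀ (f : Fin n → κ × κ) (σ : Equiv.Perm (Fin n × Fin 2)),
      Integrable (fun x : Fin n → ℝ => ((Equiv.Perm.sign σ : ℤ) : ℝ) *
        ∏ i, (φ (pick (f (σ (i, 0)).1) (σ (i, 0)).2) (x i) *
            ψ (pick (f (σ (i, 1)).1) (σ (i, 1)).2) (x i))) (halfLineMeasure n) := fun f σ =>
    (Integrable.fintype_prod (f := fun i x => φ (pick (f (σ (i, 0)).1) (σ (i, 0)).2) x *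
      ψ (pick (f (σ (i, 1)).1) (σ (i, 1)).2) x) fun i => hφψ _ _).const_mul _
  simp only [pfaffian_pairKernel φ ψ hβ]
  rw [integral_const_mul, integral_finsetSum _ fun f _ =>
    (integrable_finsetSum _ fun σ _ => hi f σ).const_mul _, Finset.mul_sum]
  refine Finset.sum_congr rfl fun f _ => ?_
  rw [integral_const_mul, integral_finsetSum _ fun σ _ => hi f σ]
  let H : Matrix κ κ ℝ := Matrix.of fun k l => ∫ x in Ioi 0, φ k x * ψ l x
  let c : Fin n × Fin 2 → κ := fun q => pick (f q.1) q.2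
  have h1 : ∀ σ : Equiv.Perm (Fin n × Fin 2), ∫ x : Fin n → ℝ, ((Equiv.Perm.sign σ : ℤ) : ℝ) *
        ∏ i, (φ (pick (f (σ (i, 0)).1) (σ (i, 0)).2) (x i) *
            ψ (pick (f (σ (i, 1)).1) (σ (i, 1)).2) (x i)) ∂halfLineMeasure n =
      ((Equiv.Perm.sign σ : ℤ) : ℝ) *
        ∏ i, H.submatrix c c (σ (i, 0)) (σ (i, 1)) := by
    intro σ
    rw [integral_const_mul, halfLineMeasure, integral_fintype_prod_eq_prod (f := fun i x =>
      φ (pick (f (σ (i, 0)).1) (σ (i, 0)).2) x * ψ (pick (f (σ (i, 1)).1) (σ (i, 1)).2) x)]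
    rfl
  rw [Finset.sum_congr rfl fun σ _ => h1 σ]
  have h2 : (1 / (n.factorial : ℝ)) * pfSum (H.submatrix c c) =
      blockPf ((skewGram φ ψ).submatrix c c) := by
    have h3 : (skewGram φ ψ).submatrix c c =
        H.submatrix c c - (H.submatrix c c).transpose := by
      ext; simp [skewGram, H]
    rw [h3, blockPf_sub_transpose, skewPf, Fintype.card_fin]
  let d : Fin n × Fin 2 → ℝ := fun q => if q.2 = 0 then (1 / 2) * β (f q.1).1 (f q.1).2 else 1
  have h4 : (pairForm β (skewGram φ ψ)).submatrix (Prod.map f id) (Prod.map f id) =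
      Matrix.diagonal d * (skewGram φ ψ).submatrix c c * (Matrix.diagonal d).transpose := by
    ext a b
    rw [Matrix.diagonal_transpose, Matrix.mul_diagonal, Matrix.diagonal_mul]
    simp [pairForm, d, c]
    ring_nf
  rw [h4, blockPf_congruence, ← h2, Matrix.det_diagonal, Fintype.prod_prod_type]
  simp only [Fin.prod_univ_two, d, pfSum]
  simp
  ring_nf

theorem det_symplForm_sub_pairForm {β W : Matrix κ κ ℝ} (hβ : β.transpose = -β) :
    (symplForm (κ × κ) - pairForm β W).det = (1 + β * W).det := by
  -- The block of a pair `(k, l)` has the columns `½ β k l • eₖ` and `eₗ`. Hence `Q J Qᵀ` is the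
  -- antisymmetrisation of `½ β`, which is `β`, and the large determinant contracts to size `κ` by
  -- `det (1 + X Y) = det (1 + Y X)`.
  let Q : Matrix κ ((κ × κ) × Fin 2) ℝ := Matrix.of fun k a =>
    if k = pick a.1 a.2 then (if a.2 = 0 then (1 / 2) * β a.1.1 a.1.2 else 1) else 0
  have hV : pairForm β W = Q.transpose * W * Q := by
    ext a b
    simp only [Matrix.mul_apply, Matrix.transpose_apply, Q, Matrix.of_apply, ite_mul, zero_mul,
      mul_ite, mul_zero, Finset.sum_ite_eq', Finset.mem_univ, if_true, pairForm]
    simp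
    split_ifs <;> ring
  have hQ : Q * symplForm (κ × κ) * Q.transpose = β := by
    ext k l
    have h := congrFun (congrFun hβ k) l
    simp only [Matrix.transpose_apply, Matrix.neg_apply] at h
    have h1 : ∀ a, (Q * symplForm (κ × κ)) k a =
        if a.2 = 0 then - Q k (a.1, 1) else Q k (a.1, 0) := by
      rintro ⟨i, c⟩
      rw [Matrix.mul_apply, Fintype.sum_prod_type, Finset.sum_eq_single i
        (fun j _ hj => by simp [symplForm_apply, hj]) (by simp), Fin.sum_univ_two]
      fin_cases c <;> simp [symplForm_apply]
    rw [Matrix.mul_apply, Fintype.sum_prod_type, Fintype.sum_prod_type]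
    simp only [h1, Fin.sum_univ_two, Matrix.transpose_apply]
    simp [Q, pick, Finset.sum_add_distrib]
    rw [h]
    ring
  have hJ : symplForm (κ × κ) - pairForm β W =
      symplForm (κ × κ) * (1 + (symplForm (κ × κ) * Q.transpose) * (W * Q)) := by
    have h : symplForm (κ × κ) * ((symplForm (κ × κ) * Q.transpose) * (W * Q)) =
        (symplForm (κ × κ) * symplForm (κ × κ)) * (Q.transpose * W * Q) := by
      simp only [Matrix.mul_assoc]
    rw [mul_add, mul_one, h, symplForm_mul_self, hV, neg_one_mul, sub_eq_add_neg]
  rw [hJ, Matrix.det_mul, det_symplForm, one_mul, Matrix.det_one_add_mul_comm, Matrix.mul_assoc,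
    ← Matrix.mul_assoc Q, hQ, Matrix.det_one_add_mul_comm]

/-- The square of the Fredholm Pfaffian of a kernel of finite rank is a finite determinant. -/
theorem fredholmPf_pairKernel_sq {φ ψ : κ → ℝ → ℝ} {β : Matrix κ κ ℝ}
    (hβ : β.transpose = -β) (hφψ : ∀ k l, IntegrableOn (fun x => φ k x * ψ l x) (Ioi 0)) :
    fredholmPf (pairKernel φ ψ β) ^ 2 = (1 + β * skewGram φ ψ).det := by
  have hV := pairForm_transpose (β := β) (skewGram_transpose φ ψ)
  have h : fredholmPf (pairKernel φ ψ β) =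
      blockPf (symplForm (κ × κ) - pairForm β (skewGram φ ψ)) := by
    rw [blockPf_symplForm_sub hV, fredholmPf]
    refine tsum_powersetCard _ _ fun n => ?_
    rw [fredholmPfTerm, integral_pfaffian_pairKernel hβ hφψ, sum_functions_eq_factorial_mul n _
      fun S => blockPf (blockSub (· ∈ S) (pairForm β (skewGram φ ψ)))]
    · rw [← mul_assoc, div_mul_cancel₀ _ (by positivity), Finset.mul_sum]
      refine Finset.sum_congr rfl fun S hS => ?_
      rw [(Finset.mem_powersetCard.1 hS).2]
    · intro f hf
      rw [Function.Injective] at hf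
      push Not at hf
      obtain ⟨i, j, hij, hne⟩ := hf
      -- A repeated pair gives two equal rows; the vanishing of the Pfaffian is read off from its
      -- square, the determinant.
      rw [← sq_eq_zero_iff, blockPf_sq]
      · refine Matrix.det_zero_of_row_eq (i := (i, 0)) (j := (j, 0)) (by simpa using hne) ?_
        ext k
        simp [hij]
      · rw [Matrix.transpose_submatrix, hV]
        rfl
    · intro S e
      rw [← blockPf_submatrix_equiv e]
      rfl
  rw [h, blockPf_sq, det_symplForm_sub_pairForm hβ]
  rw [Matrix.transpose_sub, symplForm_transpose, hV]
  abel

end FiniteRank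

/-! ### Convergence of Fredholm series -/

/-- Hadamard's inequality, read off from the bound on the Euclidean volume form evaluated at the
rows. -/
theorem abs_det_le_prod_norm {n : ℕ} (M : Matrix (Fin n) (Fin n) ℝ) :
    |M.det| ≤ ∏ i, ‖(WithLp.toLp 2 (M i) : EuclideanSpace ℝ (Fin n))‖ := by
  let b := EuclideanSpace.basisFun (Fin n) ℝ
  have : Fact (Module.finrank ℝ (EuclideanSpace ℝ (Fin n)) = n) := ⟨by simp⟩
  have h := b.toBasis.orientation.abs_volumeForm_apply_le fun i => WithLp.toLp 2 (M i)
  rw [Orientation.volumeForm_robust _ b rfl, Module.Basis.det_apply, ← Matrix.det_transpose] at h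
  convert h using 3
  ext i j
  simp [b, Module.Basis.toMatrix_apply]

/-- Hadamard's inequality for matrices with bounded entries. -/
theorem abs_det_le_of_abs_le {ι : Type*} [Fintype ι] [DecidableEq ι] {M : Matrix ι ι ℝ} {C : ℝ}
    (hM : ∀ i j, |M i j| ≤ C) :
    |M.det| ≤ (C * √(Fintype.card ι)) ^ Fintype.card ι := by
  let e := Fintype.equivFin ι
  rw [← Matrix.det_submatrix_equiv_self e.symm]
  refine (abs_det_le_prod_norm _).trans ?_
  calc ∏ i, ‖(WithLp.toLp 2 (M.submatrix e.symm e.symm i) : EuclideanSpace ℝ _)‖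
      ≤ ∏ _i : Fin (Fintype.card ι), (C * √(Fintype.card ι)) := by
        refine Finset.prod_le_prod (fun _ _ => norm_nonneg _) fun i _ => ?_
        have hC : 0 ≤ C := (abs_nonneg _).trans (hM (e.symm i) (e.symm i))
        rw [EuclideanSpace.norm_eq, Real.sqrt_le_left (by positivity), mul_pow,
          Real.sq_sqrt (by positivity)]
        calc ∑ j, ‖M (e.symm i) (e.symm j)‖ ^ 2 ≤ ∑ _j : Fin (Fintype.card ι), C ^ 2 :=
              Finset.sum_le_sum fun j _ => by
                rw [Real.norm_eq_abs]
                exact pow_le_pow_left₀ (abs_nonneg _) (hM _ _) 2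
          _ = C ^ 2 * Fintype.card ι := by simp [mul_comm]
    _ = _ := by simp

theorem summable_hadamard (R : ℝ) (hR : 0 ≤ R) :
    Summable fun n : ℕ => R ^ n * √(2 * n) ^ n / (n.factorial : ℝ) := by
  have h1 : Summable fun n : ℕ => (4 * Real.exp 1 * R ^ 2) ^ n / (n.factorial : ℝ) :=
    Real.summable_pow_div_factorial _
  have h2 : Summable fun n : ℕ => (1 / 2 : ℝ) ^ n := summable_geometric_two
  refine Summable.of_nonneg_of_le (fun n => by positivity) (fun n => ?_) (h1.add h2)
  set a := (4 * Real.exp 1 * R ^ 2) ^ n / (n.factorial : ℝ) with ha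
  set b := (1 / 2 : ℝ) ^ n with hb
  have ha0 : 0 ≤ a := by positivity
  have hb0 : 0 ≤ b := by positivity
  have hnf : (0 : ℝ) < n.factorial := by positivity
  have h3 : (n : ℝ) ^ n / n.factorial ≤ Real.exp 1 ^ n := by
    rw [← Real.exp_nat_mul, mul_one]
    exact Real.pow_div_factorial_le_exp _ (by positivity) n
  -- Squaring exposes `n ^ n / n!`, which is at most `e ^ n`. Splitting the result as a product of
  -- two summable sequences gives a term at most `a + b`; the `4` in `a` compensates the geometric
  -- factor `b`.
  have h4 : (R ^ n * √(2 * n) ^ n / (n.factorial : ℝ)) ^ 2 ≤ a * b := by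
    have : (R ^ n * √(2 * n) ^ n / (n.factorial : ℝ)) ^ 2 =
        ((R ^ 2) ^ n * 2 ^ n / n.factorial) * ((n : ℝ) ^ n / n.factorial) := by
      rw [div_pow, mul_pow, ← pow_mul (√(2 * n)), mul_comm n 2, pow_mul,
        Real.sq_sqrt (by positivity), mul_pow]
      ring
    rw [this]
    calc _ ≤ ((R ^ 2) ^ n * 2 ^ n / n.factorial) * Real.exp 1 ^ n :=
          mul_le_mul_of_nonneg_left h3 (by positivity)
      _ = a * b := by
          rw [ha, hb, mul_pow, mul_pow, show (4 : ℝ) = 2 * 2 by norm_num, mul_pow, one_div, inv_pow]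
          field_simp
  refine le_of_sq_le_sq ?_ (by positivity)
  nlinarith [mul_nonneg ha0 hb0]

theorem ae_halfLineMeasure_pos (n : ℕ) : ∀ᵐ x ∂halfLineMeasure n, ∀ i, 0 < x i := by
  rw [ae_all_iff]
  intro i
  exact (Measure.tendsto_eval_ae_ae (μ := fun _ : Fin n => (volume : Measure ℝ).restrict (Ioi 0))
    (i := i)).eventually (ae_restrict_mem measurableSet_Ioi)

/-- Dominated convergence for Fredholm series whose terms satisfy a Hadamard bound. -/
theorem fredholmSeries_tendsto {F : ℕ → ∀ n, (Fin n → ℝ) → ℝ} {G : ∀ n, (Fin n → ℝ) → ℝ}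
    {C c : ℝ} (hC : 0 ≤ C) (hc : 0 < c)
    (hmeas : ∀ j n, AEStronglyMeasurable (F j n) (halfLineMeasure n))
    (hbound : ∀ j n (x : Fin n → ℝ), (∀ i, 0 < x i) →
      |F j n x| ≤ √(2 * n) ^ n * ∏ i, (C * Real.exp (-c * x i)))
    (hlim : ∀ n (x : Fin n → ℝ), (∀ i, 0 < x i) →
      Tendsto (fun j => F j n x) atTop (𝓝 (G n x))) :
    ((∀ n, Integrable (G n) (halfLineMeasure n)) ∧
      Summable fun n : ℕ => ((-1 : ℝ) ^ n / (n.factorial : ℝ)) * ∫ x, G n x ∂halfLineMeasure n) ∧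
    Tendsto (fun j => ∑' n : ℕ, ((-1 : ℝ) ^ n / (n.factorial : ℝ)) *
        ∫ x, F j n x ∂halfLineMeasure n) atTop
      (𝓝 (∑' n : ℕ, ((-1 : ℝ) ^ n / (n.factorial : ℝ)) * ∫ x, G n x ∂halfLineMeasure n)) := by
  -- One majorant serves twice: it dominates the integrands for fixed `n`, and its integrals,
  -- divided by `n!`, dominate the series.
  let B : ∀ n, (Fin n → ℝ) → ℝ := fun n x => √(2 * n) ^ n * ∏ i, (C * Real.exp (-c * x i))
  have hexp : IntegrableOn (fun x => C * Real.exp (-c * x)) (Ioi 0) :=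
    (exp_neg_integrableOn_Ioi 0 hc).const_mul C
  have hB : ∀ n, Integrable (B n) (halfLineMeasure n) := fun n =>
    (Integrable.fintype_prod (f := fun (_ : Fin n) x => C * Real.exp (-c * x))
      fun _ => hexp).const_mul _
  have hBint : ∀ n, ∫ x, B n x ∂halfLineMeasure n = √(2 * n) ^ n * (C / c) ^ n := by
    intro n
    simp only [B]
    rw [integral_const_mul, halfLineMeasure,
      integral_fintype_prod_eq_prod (f := fun (_ : Fin n) x => C * Real.exp (-c * x))]
    rw [integral_const_mul, integral_exp_mul_Ioi (by linarith)]
    simp [div_eq_mul_inv]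
  have hFB : ∀ j n, ∀ᵐ x ∂halfLineMeasure n, ‖F j n x‖ ≤ B n x := fun j n => by
    filter_upwards [ae_halfLineMeasure_pos n] with x hx using hbound j n x hx
  have hFG : ∀ n, ∀ᵐ x ∂halfLineMeasure n, Tendsto (fun j => F j n x) atTop (𝓝 (G n x)) :=
    fun n => by
      filter_upwards [ae_halfLineMeasure_pos n] with x hx using hlim n x hx
  have hGB : ∀ n, ∀ᵐ x ∂halfLineMeasure n, ‖G n x‖ ≤ B n x := fun n => by
    filter_upwards [ae_halfLineMeasure_pos n] with x hx
    exact le_of_tendsto (hlim n x hx).norm (Eventually.of_forall fun j => hbound j n x hx)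
  have hterm : ∀ (n : ℕ) (H : (Fin n → ℝ) → ℝ), (∀ᵐ x ∂halfLineMeasure n, ‖H x‖ ≤ B n x) →
      ‖((-1 : ℝ) ^ n / (n.factorial : ℝ)) * ∫ x, H x ∂halfLineMeasure n‖ ≤
        (C / c) ^ n * √(2 * n) ^ n / (n.factorial : ℝ) := by
    intro n H hH
    have h1 := norm_integral_le_of_norm_le (hB n) hH
    rw [hBint] at h1
    rw [norm_mul, norm_div, norm_pow, norm_neg, norm_one, one_pow, Real.norm_natCast,
      mul_comm ((C / c) ^ n), one_div, inv_mul_eq_div]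
    gcongr
  have hs := summable_hadamard (C / c) (by positivity)
  refine ⟨⟨fun n => ?_, ?_⟩, ?_⟩
  · exact (hB n).mono' (aestronglyMeasurable_of_tendsto_ae atTop (fun j => hmeas j n) (hFG n))
      (hGB n)
  · exact hs.of_norm_bounded fun n => hterm n _ (hGB n)
  · refine tendsto_tsum_of_dominated_convergence hs (fun n => ?_)
      (Eventually.of_forall fun j n => hterm n _ (hFB j n))
    exact (tendsto_integral_of_dominated_convergence (B n) (fun j => hmeas j n) (hB n)
      (fun j => hFB j n) (hFG n)).const_mul _

/-! ### Hadamard bounds and continuity for Fredholm determinants and Pfaffians -/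

theorem abs_det_scalarMatrix_le {K : ℝ → ℝ → ℝ} {C c : ℝ} (hC : 0 ≤ C)
    (hK : ∀ x y, 0 < x → 0 < y → |K x y| ≤ C * Real.exp (-c * x)) {n : ℕ} (x : Fin n → ℝ)
    (hx : ∀ i, 0 < x i) :
    |(scalarMatrix K x).det| ≤ √(2 * n) ^ n * ∏ i, (C * Real.exp (-c * x i)) := by
  let M : Matrix (Fin n) (Fin n) ℝ :=
    Matrix.of fun i j => Real.exp (c * x i) * K (x i) (x j)
  have hM : ∀ i j, |M i j| ≤ C := by
    intro i j
    simp only [M, Matrix.of_apply, abs_mul, Real.abs_exp]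
    calc _ ≤ Real.exp (c * x i) * (C * Real.exp (-c * x i)) := by
          gcongr; exact hK _ _ (hx i) (hx j)
      _ = C := by rw [mul_left_comm, ← Real.exp_add]; simp
  have h1 : scalarMatrix K x = Matrix.diagonal (fun i => Real.exp (-c * x i)) * M := by
    ext i j
    rw [Matrix.diagonal_mul]
    simp only [M, scalarMatrix, Matrix.of_apply]
    rw [← mul_assoc, ← Real.exp_add]; simp
  have h2 := abs_det_le_of_abs_le hM
  rw [Fintype.card_fin] at h2
  rw [h1, Matrix.det_mul, Matrix.det_diagonal, abs_mul, Finset.abs_prod]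
  simp only [Real.abs_exp]
  rw [Finset.prod_mul_distrib, Finset.prod_const, Finset.card_univ, Fintype.card_fin]
  -- The bound with `√n` is weakened to `√(2 * n)` so that determinants and Pfaffians share one
  -- majorant.
  calc _ ≤ (∏ i, Real.exp (-c * x i)) * (C * √(2 * n)) ^ n := by
        gcongr
        refine h2.trans ?_
        gcongr
        linarith [(Nat.cast_nonneg n : (0 : ℝ) ≤ n)]
    _ = _ := by rw [mul_pow]; ring

/-- The weights of the two components of a matrix kernel. -/
def compWeight (c : ℝ) (a : Fin 2) (x : ℝ) : ℝ := if a = 0 then 1 else Real.exp (-c * x)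

theorem abs_pfaffian_blockMatrix_le {K : ℝ → ℝ → Matrix (Fin 2) (Fin 2) ℝ} {C c : ℝ}
    (hC : 0 ≤ C) (hskew : ∀ x y, 0 < x → 0 < y → K x y = -(K y x).transpose)
    (hK : ∀ x y a b, 0 < x → 0 < y → |K x y a b| ≤ C * (compWeight c a x * compWeight c b y))
    {n : ℕ} (x : Fin n → ℝ) (hx : ∀ i, 0 < x i) :
    |pfaffian (blockMatrix K x)| ≤ √(2 * n) ^ n * ∏ i, (C * Real.exp (-c * x i)) := by
  have hw : ∀ a x, 0 < compWeight c a x := fun a x => by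
    unfold compWeight; split_ifs <;> positivity
  -- Conjugating by the weights leaves a skew matrix with entries bounded by `C`. The weights
  -- multiply to one exponential per variable, which suffices even though the first component of
  -- each block does not decay.
  let d : Fin n × Fin 2 → ℝ := fun q => compWeight c q.2 (x q.1)
  let M : Matrix (Fin n × Fin 2) (Fin n × Fin 2) ℝ :=
    Matrix.of fun p q => (d p)⁻¹ * blockMatrix K x p q * (d q)⁻¹
  have hd : ∀ q, 0 < d q := fun q => hw _ _
  have hM : ∀ p q, |M p q| ≤ C := by
    intro p q
    simp only [M, Matrix.of_apply, abs_mul, abs_inv, abs_of_pos (hd _)]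
    have := hK (x p.1) (x q.1) p.2 q.2 (hx _) (hx _)
    calc _ ≤ (d p)⁻¹ * (C * (d p * d q)) * (d q)⁻¹ := by
          have := hd p
          have := hd q
          gcongr
          assumption
      _ = C := by
          have := (hd p).ne'
          have := (hd q).ne'
          field_simp
  have h1 : blockMatrix K x = Matrix.diagonal d * M * (Matrix.diagonal d).transpose := by
    ext p q
    rw [Matrix.diagonal_transpose, Matrix.mul_diagonal, Matrix.diagonal_mul]
    have := (hd p).ne'
    have := (hd q).ne'
    simp only [M, Matrix.of_apply]
    field_simp
  have hMskew : M.transpose = -M := by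
    ext p q
    have := congrFun (congrFun (hskew (x q.1) (x p.1) (hx _) (hx _)) q.2) p.2
    simp only [M, Matrix.transpose_apply, Matrix.neg_apply, Matrix.of_apply, blockMatrix] at this ⊢
    rw [this]
    ring
  have h2 := abs_det_le_of_abs_le hM
  rw [← blockPf_sq hMskew, abs_pow, Fintype.card_prod, Fintype.card_fin, Fintype.card_fin,
    mul_comm n 2, pow_mul, ← pow_mul, mul_comm 2 n, pow_mul] at h2
  have h3 : |blockPf M| ≤ (C * √(2 * n)) ^ n := by
    refine le_of_sq_le_sq (h2.trans (le_of_eq ?_)) (by positivity)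
    push_cast
    ring_nf
  have hdet : ∏ q, d q = ∏ i, Real.exp (-c * x i) := by
    rw [Fintype.prod_prod_type]
    simp [d, compWeight]
  rw [pfaffian_eq_blockPf, h1, blockPf_congruence, Matrix.det_diagonal, hdet, abs_mul,
    Finset.abs_prod]
  simp only [Real.abs_exp]
  rw [Finset.prod_mul_distrib, Finset.prod_const, Finset.card_univ, Fintype.card_fin]
  calc _ ≤ (∏ i, Real.exp (-c * x i)) * (C * √(2 * n)) ^ n := by gcongr
    _ = _ := by rw [mul_pow]; ring

theorem fredholmDet_tendsto {K : ℕ → ℝ → ℝ → ℝ} {L : ℝ → ℝ → ℝ} {C c : ℝ}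
    (hC : 0 ≤ C) (hc : 0 < c)
    (hmeas : ∀ j n, AEStronglyMeasurable (fun x : Fin n → ℝ => (scalarMatrix (K j) x).det)
      (halfLineMeasure n))
    (hbound : ∀ j x y, 0 < x → 0 < y → |K j x y| ≤ C * Real.exp (-c * x))
    (hlim : ∀ x y, 0 < x → 0 < y → Tendsto (fun j => K j x y) atTop (𝓝 (L x y))) :
    FredholmDetConverges L ∧ Tendsto (fun j => fredholmDet (K j)) atTop (𝓝 (fredholmDet L)) := by
  refine fredholmSeries_tendsto hC hc hmeas
    (fun j n x hx => abs_det_scalarMatrix_le hC (hbound j) x hx) fun n x hx => ?_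
  simp only [Matrix.det_apply']
  exact tendsto_finsetSum _ fun σ _ => (tendsto_finsetProd _ fun i _ =>
    hlim _ _ (hx _) (hx _)).const_mul _

theorem fredholmPf_tendsto {K : ℕ → ℝ → ℝ → Matrix (Fin 2) (Fin 2) ℝ}
    {L : ℝ → ℝ → Matrix (Fin 2) (Fin 2) ℝ} {C c : ℝ} (hC : 0 ≤ C) (hc : 0 < c)
    (hmeas : ∀ j n, AEStronglyMeasurable (fun x : Fin n → ℝ => pfaffian (blockMatrix (K j) x))
      (halfLineMeasure n))
    (hskew : ∀ j x y, 0 < x → 0 < y → K j x y = -(K j y x).transpose)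
    (hbound : ∀ j x y a b, 0 < x → 0 < y →
      |K j x y a b| ≤ C * (compWeight c a x * compWeight c b y))
    (hlim : ∀ x y a b, 0 < x → 0 < y → Tendsto (fun j => K j x y a b) atTop (𝓝 (L x y a b))) :
    FredholmPfConverges L ∧ Tendsto (fun j => fredholmPf (K j)) atTop (𝓝 (fredholmPf L)) := by
  refine fredholmSeries_tendsto hC hc hmeas
    (fun j n x hx => abs_pfaffian_blockMatrix_le hC (hskew j) (hbound j) x hx) fun n x hx => ?_
  simp only [pfaffian]
  exact (tendsto_finsetSum _ fun σ _ => (tendsto_finsetProd _ fun i _ =>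
    hlim _ _ _ _ (hx _) (hx _)).const_mul _).const_mul _

/-! ### Determinant identities for products of skew-symmetric matrices -/

section SkewDet

open Matrix

set_option linter.unusedSectionVars false

variable {ι : Type*} [Fintype ι] [DecidableEq ι]

theorem dotProduct_mulVec_self_of_skew {Y : Matrix ι ι ℝ} (hY : Y.transpose = -Y) (u : ι → ℝ) :
    u ⬝ᵥ (Y *ᵥ u) = 0 := by
  have h : u ⬝ᵥ (Y *ᵥ u) = -(u ⬝ᵥ (Y *ᵥ u)) := by
    conv_lhs => rw [dotProduct_comm, ← vecMul_transpose, ← dotProduct_mulVec, hY, neg_mulVec,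
      dotProduct_neg]
  linarith

theorem isUnit_det_transpose_add {β W : Matrix ι ι ℝ} (hβ : β.transpose = -β)
    (hW : W.transpose = -W) (h : IsUnit (1 + β * W).det) :
    (1 + β * W).transpose = 1 + W * β ∧ IsUnit (1 + W * β).det := by
  have h1 : (1 + β * W).transpose = 1 + W * β := by simp [transpose_mul, hβ, hW]
  exact ⟨h1, by rwa [← h1, det_transpose]⟩

theorem inv_mul_eq_mul_inv {β W : Matrix ι ι ℝ} (h : IsUnit (1 + β * W).det)
    (h' : IsUnit (1 + W * β).det) : (1 + β * W)⁻¹ * β = β * (1 + W * β)⁻¹ := by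
  have h1 : (1 + β * W) * β = β * (1 + W * β) := by
    rw [add_mul, mul_add, one_mul, mul_one, Matrix.mul_assoc]
  calc (1 + β * W)⁻¹ * β = (1 + β * W)⁻¹ * (β * (1 + W * β)) * (1 + W * β)⁻¹ := by
        rw [Matrix.mul_assoc, Matrix.mul_assoc, mul_nonsing_inv _ h', mul_one]
    _ = β * (1 + W * β)⁻¹ := by
        rw [← h1, ← Matrix.mul_assoc, nonsing_inv_mul _ h, one_mul]

/-- Transposition puts the inverse on the other side of `β`, and the push-through identity brings it
back. -/
theorem transpose_inv_mul_of_skew {β W : Matrix ι ι ℝ} (hβ : β.transpose = -β)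
    (hW : W.transpose = -W) (h : IsUnit (1 + β * W).det) :
    ((1 + β * W)⁻¹ * β).transpose = -((1 + β * W)⁻¹ * β) := by
  obtain ⟨h1, h2⟩ := isUnit_det_transpose_add hβ hW h
  rw [inv_mul_eq_mul_inv h h2, transpose_mul, transpose_nonsing_inv, hβ, ← inv_mul_eq_mul_inv h h2]
  rw [transpose_add, transpose_mul, hβ, hW]
  simp

theorem det_one_add_mul_add_vecMulVec_of_isUnit {β W : Matrix ι ι ℝ} (hβ : β.transpose = -β)
    (hW : W.transpose = -W) (u : ι → ℝ) (h : IsUnit (1 + β * W).det) :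
    (1 + β * (W + vecMulVec u u)).det = (1 + β * W).det := by
  have h1 : 1 + β * (W + vecMulVec u u) =
      (1 + β * W) + replicateCol Unit (β *ᵥ u) * replicateRow Unit u := by
    rw [mul_add, add_assoc, mul_vecMulVec, vecMulVec_eq Unit]
  -- The correction in the matrix determinant lemma is a quadratic form of a skew matrix, hence
  -- zero.
  have h2 : replicateRow Unit u * (1 + β * W)⁻¹ * replicateCol Unit (β *ᵥ u) = 0 := by
    ext i j
    have := dotProduct_mulVec_self_of_skew (transpose_inv_mul_of_skew hβ hW h) u
    rw [← mulVec_mulVec] at this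
    rw [Matrix.mul_assoc]
    exact this
  rw [h1, det_add_replicateCol_mul_replicateRow h, h2]
  simp

theorem eventually_isUnit_det {F : ℝ → Matrix ι ι ℝ} (hF : Continuous F) (h0 : F 0 = 1) :
    ∀ᶠ z in 𝓝 (0 : ℝ), IsUnit (F z).det := by
  have : Tendsto (fun z => (F z).det) (𝓝 0) (𝓝 1) := by
    have h := (hF.matrix_det).tendsto 0
    rwa [h0, det_one] at h
  filter_upwards [this.eventually_ne one_ne_zero] with z hz using hz.isUnit

/-- Adding a symmetric rank-one matrix to one of two skew-symmetric matrices does not change the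
determinant of `1` plus their product. -/
theorem det_one_add_mul_add_vecMulVec {β W : Matrix ι ι ℝ} (hβ : β.transpose = -β)
    (hW : W.transpose = -W) (u : ι → ℝ) :
    (1 + β * (W + vecMulVec u u)).det = (1 + β * W).det := by
  -- Invertibility is removed by scaling `β`: near `z = 0` the matrix is invertible, and both
  -- determinants are polynomial in `z`.
  have h1 : AnalyticOnNhd ℝ (fun z : ℝ => (1 + (z • β) * (W + vecMulVec u u)).det) univ := by
    intro z _
    refine analyticAt_det fun i j => ?_
    simp only [Matrix.add_apply, smul_mul, Matrix.smul_apply, smul_eq_mul]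
    fun_prop
  have h2 : AnalyticOnNhd ℝ (fun z : ℝ => (1 + (z • β) * W).det) univ := by
    intro z _
    refine analyticAt_det fun i j => ?_
    simp only [Matrix.add_apply, smul_mul, Matrix.smul_apply, smul_eq_mul]
    fun_prop
  have h3 : ∀ᶠ z in 𝓝 (0 : ℝ), IsUnit (1 + (z • β) * W).det :=
    eventually_isUnit_det (F := fun z : ℝ => 1 + (z • β) * W) (by fun_prop) (by simp)
  have := congrFun (h1.eq_of_eventuallyEq h2 (h3.mono fun z hz =>
    det_one_add_mul_add_vecMulVec_of_isUnit (by simp [hβ]) hW u hz)) 1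
  simpa using this

/-! ### Determinants with a border -/

theorem det_fromBlocks_col_row (A : Matrix ι ι ℝ) (b r : ι → ℝ) {d : ℝ} (hd : d ≠ 0) :
    (fromBlocks A (replicateCol Unit b) (replicateRow Unit r) (d • 1)).det =
      d * (A - d⁻¹ • vecMulVec b r).det := by
  let _ : Invertible (d • (1 : Matrix Unit Unit ℝ)) :=
    ⟨d⁻¹ • 1, by simp [smul_smul, hd], by simp [smul_smul, hd]⟩
  rw [det_fromBlocks₂₂]
  congr 1
  · simp
  · change (A - replicateCol Unit b * (d⁻¹ • (1 : Matrix Unit Unit ℝ)) * replicateRow Unit r).det = _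
    rw [Matrix.mul_smul, Matrix.mul_one, Matrix.smul_mul, ← vecMulVec_eq]

theorem det_add_two_vecMulVec {X : Matrix ι ι ℝ} (hX : IsUnit X.det) (a b c d : ι → ℝ) :
    (X + vecMulVec a c + vecMulVec b d).det = X.det *
      ((1 + c ⬝ᵥ (X⁻¹ *ᵥ a)) * (1 + d ⬝ᵥ (X⁻¹ *ᵥ b)) -
        (c ⬝ᵥ (X⁻¹ *ᵥ b)) * (d ⬝ᵥ (X⁻¹ *ᵥ a))) := by
  let U : Matrix ι (Fin 2) ℝ := of fun i j => if j = 0 then a i else b i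
  let V : Matrix (Fin 2) ι ℝ := of fun j i => if j = 0 then c i else d i
  have h1 : X + vecMulVec a c + vecMulVec b d = X + U * V := by
    ext i j
    simp [U, V, Matrix.mul_apply, vecMulVec_apply, add_assoc]
  rw [h1, det_add_mul U V hX, det_fin_two]
  congr 1
  have h : ∀ i j, (V * X⁻¹ * U) i j = (V i) ⬝ᵥ (X⁻¹ *ᵥ fun k => U k j) := fun i j => by
    rw [Matrix.mul_assoc]; rfl
  simp only [Matrix.add_apply, h, one_apply_eq, one_apply_ne (zero_ne_one (α := Fin 2)),
    one_apply_ne (zero_ne_one (α := Fin 2)).symm, zero_add]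
  rfl

/-- The two sides of the determinant identity for kernels with a constant added. -/
def borderedForm (β : Matrix ι ι ℝ) (v : ι → ℝ) : Matrix (ι ⊕ Unit) (ι ⊕ Unit) ℝ :=
  fromBlocks β (replicateCol Unit (-v)) (replicateRow Unit v) 0

theorem borderedForm_transpose {β : Matrix ι ι ℝ} (hβ : β.transpose = -β) (v : ι → ℝ) :
    (borderedForm β v).transpose = -borderedForm β v := by
  rw [borderedForm, fromBlocks_transpose, fromBlocks_neg, hβ]
  congr 1 <;> ext <;> simp

theorem det_bordered_of_isUnit {β S : Matrix ι ι ℝ} (hβ : β.transpose = -β)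
    (hS : S.transpose = -S) (u v : ι → ℝ) (h : IsUnit (1 + β * S).det)
    (hd : 1 - (1 / 2) * (v ⬝ᵥ u) ≠ 0) :
    (1 + borderedForm β ((1 / 2 : ℝ) • v) * borderedForm S u).det =
      (1 + (β + (1 / 2 : ℝ) • vecMulVec v v) * (S + (1 / 2 : ℝ) • vecMulVec u u) -
        vecMulVec v u).det := by
  set X := 1 + β * S with hX
  set t := v ⬝ᵥ u with ht
  obtain ⟨hT, hU⟩ := isUnit_det_transpose_add hβ hS h
  have f1 : u ⬝ᵥ (X⁻¹ *ᵥ (β *ᵥ u)) = 0 := by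
    rw [mulVec_mulVec]
    exact dotProduct_mulVec_self_of_skew (transpose_inv_mul_of_skew hβ hS h) u
  have hSX : S * X⁻¹ = (1 + S * β)⁻¹ * S := (inv_mul_eq_mul_inv hU h).symm
  have f2 : (v ᵥ* S) ⬝ᵥ (X⁻¹ *ᵥ v) = 0 := by
    rw [← dotProduct_mulVec, mulVec_mulVec, hSX]
    exact dotProduct_mulVec_self_of_skew (transpose_inv_mul_of_skew hS hβ hU) v
  have f3 : (v ᵥ* S) ⬝ᵥ (X⁻¹ *ᵥ (β *ᵥ u)) = t - u ⬝ᵥ (X⁻¹ *ᵥ v) := by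
    have h1 : S * (X⁻¹ * β) = 1 - (X⁻¹).transpose := by
      rw [transpose_nonsing_inv, hX, hT, inv_mul_eq_mul_inv h hU, ← Matrix.mul_assoc]
      calc S * β * (1 + S * β)⁻¹ = ((1 + S * β) - 1) * (1 + S * β)⁻¹ := by
            rw [add_sub_cancel_left]
        _ = _ := by rw [sub_mul, mul_nonsing_inv _ hU, one_mul]
    rw [← dotProduct_mulVec, mulVec_mulVec, mulVec_mulVec, Matrix.mul_assoc, h1, sub_mulVec, one_mulVec,
      dotProduct_sub, mulVec_transpose, dotProduct_comm v (u ᵥ* X⁻¹), ← dotProduct_mulVec]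
  -- Both sides are now rank-two updates of `X`; the left one arises by Schur complement at the
  -- corner `1 - t / 2`. With the scalar products `f1`, `f2`, `f3`, each reduces to `X.det * (1 - p
  -- / 2) ^ 2`.
  set p := u ⬝ᵥ (X⁻¹ *ᵥ v) with hp
  have hR : 1 + (β + (1 / 2 : ℝ) • vecMulVec v v) * (S + (1 / 2 : ℝ) • vecMulVec u u) -
      vecMulVec v u = X + vecMulVec (β *ᵥ u) ((1 / 2 : ℝ) • u) +
        vecMulVec v ((1 / 2 : ℝ) • (v ᵥ* S) + (t / 4 - 1) • u) := by
    have e1 : vecMulVec v v * vecMulVec u u = t • vecMulVec v u := by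
      rw [vecMulVec_mul_vecMulVec, vecMulVec_smul]
    rw [hX, add_mul, mul_add, mul_add, Matrix.mul_smul, mul_vecMulVec, Matrix.smul_mul,
      Matrix.smul_mul, Matrix.mul_smul, vecMulVec_mul, e1]
    ext i j
    simp only [Matrix.add_apply, Matrix.sub_apply, Matrix.smul_apply, vecMulVec_apply,
      Pi.add_apply, Pi.smul_apply, smul_eq_mul]
    ring
  have hL : 1 + borderedForm β ((1 / 2 : ℝ) • v) * borderedForm S u =
      fromBlocks (X - (1 / 2 : ℝ) • vecMulVec v u) (replicateCol Unit (-(β *ᵥ u)))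
        (replicateRow Unit ((1 / 2 : ℝ) • (v ᵥ* S))) ((1 - (1 / 2) * t) • 1) := by
    rw [borderedForm, borderedForm, fromBlocks_multiply, ← fromBlocks_one, fromBlocks_add]
    congr 1
    · rw [← vecMulVec_eq, hX]
      ext i j
      simp [vecMulVec_apply]
      ring
    · ext i j
      simp [mulVec, Matrix.mul_apply, dotProduct]
    · ext i j
      simp [vecMul, Matrix.mul_apply, dotProduct, Finset.mul_sum]
    · ext i j
      simp [Matrix.mul_apply, dotProduct, ht, Finset.mul_sum, sub_eq_add_neg]
  have hL2 : X - (1 / 2 : ℝ) • vecMulVec v u - (1 - (1 / 2) * t)⁻¹ •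
      vecMulVec (-(β *ᵥ u)) ((1 / 2 : ℝ) • (v ᵥ* S)) =
      X + vecMulVec (β *ᵥ u) (((1 - (1 / 2) * t)⁻¹ * (1 / 2)) • (v ᵥ* S)) +
        vecMulVec v ((-(1 / 2) : ℝ) • u) := by
    ext i j
    simp only [Matrix.add_apply, Matrix.sub_apply, Matrix.smul_apply, vecMulVec_apply,
      Pi.neg_apply, Pi.smul_apply, smul_eq_mul]
    ring
  rw [hL, det_fromBlocks_col_row _ _ _ hd, hL2, det_add_two_vecMulVec h, hR,
    det_add_two_vecMulVec h]
  simp only [smul_dotProduct, add_dotProduct, f1, f2, f3, smul_eq_mul, ← hp]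
  have hd2 : 2 - t ≠ 0 := fun h0 => hd (by linarith)
  field_simp
  ring

theorem det_bordered {β S : Matrix ι ι ℝ} (hβ : β.transpose = -β)
    (hS : S.transpose = -S) (u v : ι → ℝ) :
    (1 + borderedForm β ((1 / 2 : ℝ) • v) * borderedForm S u).det =
      (1 + (β + (1 / 2 : ℝ) • vecMulVec v v) * (S + (1 / 2 : ℝ) • vecMulVec u u) -
        vecMulVec v u).det := by
  -- `β` and `v` are scaled together, so that near `z = 0` both `1 + β S` and the corner entry are
  -- invertible.
  have h1 : AnalyticOnNhd ℝ (fun z : ℝ => (1 + borderedForm (z • β) ((1 / 2 : ℝ) • z • v) *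
      borderedForm S u).det) univ := by
    intro z _
    refine analyticAt_det fun i j => ?_
    have h : (fun z : ℝ => (1 + borderedForm (z • β) ((1 / 2 : ℝ) • z • v) *
        borderedForm S u) i j) = fun z => (1 : Matrix (ι ⊕ Unit) (ι ⊕ Unit) ℝ) i j +
          z * (borderedForm β ((1 / 2 : ℝ) • v) * borderedForm S u) i j := by
      funext z
      have : borderedForm (z • β) ((1 / 2 : ℝ) • z • v) =
          z • borderedForm β ((1 / 2 : ℝ) • v) := by
        rw [borderedForm, borderedForm, fromBlocks_smul]
        congr 1 <;> ext <;> simp <;> ring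
      rw [this, smul_mul, Matrix.add_apply, Matrix.smul_apply, smul_eq_mul]
    rw [h]
    fun_prop
  have h2 : AnalyticOnNhd ℝ (fun z : ℝ => (1 + (z • β + (1 / 2 : ℝ) • vecMulVec (z • v) (z • v)) *
      (S + (1 / 2 : ℝ) • vecMulVec u u) - vecMulVec (z • v) u).det) univ := by
    intro z _
    refine analyticAt_det fun i j => ?_
    simp only [Matrix.sub_apply, Matrix.add_apply, Matrix.mul_apply, Matrix.smul_apply,
      vecMulVec_apply, Pi.smul_apply, smul_eq_mul]
    fun_prop
  have h3 : ∀ᶠ z in 𝓝 (0 : ℝ), IsUnit (1 + (z • β) * S).det :=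
    eventually_isUnit_det (F := fun z : ℝ => 1 + (z • β) * S) (by fun_prop) (by simp)
  have h4 : ∀ᶠ z in 𝓝 (0 : ℝ), 1 - (1 / 2) * ((z • v) ⬝ᵥ u) ≠ 0 := by
    have hc : Continuous fun z : ℝ => 1 - (1 / 2) * ((z • v) ⬝ᵥ u) := by
      simp only [smul_dotProduct, smul_eq_mul]
      fun_prop
    exact (hc.tendsto 0).eventually_ne (by simp)
  have := congrFun (h1.eq_of_eventuallyEq h2 ((h3.and h4).mono fun z hz =>
    det_bordered_of_isUnit (by simp [hβ]) hS u (z • v) hz.1 hz.2)) 1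
  simpa using this

end SkewDet

/-! ### Exponentially decaying functions and their pairings -/

/-- Continuous functions bounded by a multiple of `exp (-c x)` on every half-line `[T, ∞)`. -/
structure Decays (c : ℝ) (f : ℝ → ℝ) : Prop where
  cont : Continuous f
  bound : ∀ T : ℝ, ∃ C : ℝ, 0 ≤ C ∧ ∀ x, T ≤ x → |f x| ≤ C * Real.exp (-c * x)

/-- The pairing `∫₀^∞ f(x + r) g(y + r) dr`. -/
def pairing (f g : ℝ → ℝ) (x y : ℝ) : ℝ := ∫ r in Ioi (0 : ℝ), f (x + r) * g (y + r)

/-- The integral `∫₀^∞ f(x + r) dr`. -/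
def tail (f : ℝ → ℝ) (x : ℝ) : ℝ := ∫ r in Ioi (0 : ℝ), f (x + r)

variable {c : ℝ} {f f' g g' : ℝ → ℝ}

theorem pairing_comm (f g : ℝ → ℝ) (x y : ℝ) : pairing f g x y = pairing g f y x := by
  simp only [pairing, mul_comm]

theorem tail_eq (f : ℝ → ℝ) (x : ℝ) : tail f x = ∫ u in Ioi x, f u := by
  have h := (measurePreserving_add_left (volume : Measure ℝ) x).setIntegral_preimage_emb
    (measurableEmbedding_addLeft x) f (Ioi x)
  rw [preimage_const_add_Ioi, sub_self] at h
  exact h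

theorem integrableOn_of_abs_le (hc : 0 < c) (hf : Continuous f) {T C : ℝ}
    (h : ∀ x, T ≤ x → |f x| ≤ C * Real.exp (-c * x)) : IntegrableOn f (Ioi T) := by
  refine ((exp_neg_integrableOn_Ioi T hc).const_mul C).mono' hf.aestronglyMeasurable ?_
  filter_upwards [ae_restrict_mem measurableSet_Ioi] with x hx using h x (le_of_lt hx)

theorem Decays.integrableOn (hc : 0 < c) (hf : Decays c f) (T : ℝ) : IntegrableOn f (Ioi T) := by
  obtain ⟨C, -, h⟩ := hf.bound T
  exact integrableOn_of_abs_le hc hf.cont h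

theorem Decays.tendsto_zero (hc : 0 < c) (hf : Decays c f) : Tendsto f atTop (𝓝 0) := by
  obtain ⟨C, -, h⟩ := hf.bound 0
  refine squeeze_zero_norm' (eventually_ge_atTop 0 |>.mono fun x hx => h x hx) ?_
  have h1 : Tendsto (fun x : ℝ => -c * x) atTop atBot :=
    tendsto_id.const_mul_atTop_of_neg (neg_lt_zero.2 hc)
  simpa using (Real.tendsto_exp_atBot.comp h1).const_mul C

theorem abs_tail_le (hc : 0 < c) {T C : ℝ} (h : ∀ x, T ≤ x → |f x| ≤ C * Real.exp (-c * x))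
    {x : ℝ} (hx : T ≤ x) : |tail f x| ≤ C / c * Real.exp (-c * x) := by
  rw [tail_eq]
  have h1 := norm_integral_le_of_norm_le (μ := volume.restrict (Ioi x)) (f := f)
    (g := fun u => C * Real.exp (-c * u)) ((exp_neg_integrableOn_Ioi x hc).const_mul C) (by
      filter_upwards [ae_restrict_mem measurableSet_Ioi] with u hu
      exact h u (hx.trans (le_of_lt hu)))
  rw [integral_const_mul, integral_exp_mul_Ioi (by linarith)] at h1
  refine h1.trans (le_of_eq ?_)
  field_simp

theorem hasDerivAt_tail (hc : 0 < c) (hf : Decays c f) (x : ℝ) :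
    HasDerivAt (tail f) (-f x) x := by
  have h : tail f = fun u => (∫ t in Ioi 0, f t) - ∫ t in (0 : ℝ)..u, f t := by
    funext u
    rw [tail_eq, ← intervalIntegral.integral_Ioi_sub_Ioi' (hf.integrableOn hc 0)
      (hf.integrableOn hc u)]
    ring
  rw [h]
  exact ((hf.cont.integral_hasStrictDerivAt 0 x).hasDerivAt).const_sub _

theorem Decays.tail (hc : 0 < c) (hf : Decays c f) : Decays c (tail f) where
  cont := continuous_iff_continuousAt.2 fun x => (hasDerivAt_tail hc hf x).continuousAt
  bound T := by
    obtain ⟨C, hC, h⟩ := hf.bound T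
    exact ⟨C / c, by positivity, fun x hx => abs_tail_le hc h hx⟩

theorem Decays.neg (hf : Decays c f) : Decays c fun x => -f x where
  cont := hf.cont.neg
  bound T := by simpa using hf.bound T

theorem abs_mul_shift_le {C₁ C₂ T : ℝ}
    (hf : ∀ x, T ≤ x → |f x| ≤ C₁ * Real.exp (-c * x))
    (hg : ∀ x, T ≤ x → |g x| ≤ C₂ * Real.exp (-c * x)) {x y r : ℝ} (hx : T ≤ x) (hy : T ≤ y)
    (hr : 0 ≤ r) : |f (x + r) * g (y + r)| ≤
      C₁ * C₂ * (Real.exp (-c * x) * Real.exp (-c * y)) * Real.exp (-(2 * c) * r) := by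
  have h1 := hf (x + r) (by linarith)
  have h2 := hg (y + r) (by linarith)
  rw [abs_mul]
  refine (mul_le_mul h1 h2 (abs_nonneg _) ((abs_nonneg _).trans h1)).trans (le_of_eq ?_)
  rw [show -c * (x + r) = -c * x + -c * r by ring, show -c * (y + r) = -c * y + -c * r by ring,
    show -(2 * c) * r = -c * r + -c * r by ring, Real.exp_add, Real.exp_add, Real.exp_add]
  ring

theorem integrableOn_pairing (hc : 0 < c) (hf : Decays c f) (hg : Decays c g) (x y : ℝ) :
    IntegrableOn (fun r => f (x + r) * g (y + r)) (Ioi 0) := by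
  obtain ⟨C₁, -, h1⟩ := hf.bound (min x y)
  obtain ⟨C₂, -, h2⟩ := hg.bound (min x y)
  have := hf.cont
  have := hg.cont
  refine ((exp_neg_integrableOn_Ioi 0 (by positivity : 0 < 2 * c)).const_mul
    (C₁ * C₂ * (Real.exp (-c * x) * Real.exp (-c * y)))).mono'
    (Continuous.aestronglyMeasurable (by fun_prop)) ?_
  filter_upwards [ae_restrict_mem measurableSet_Ioi] with r hr
  exact abs_mul_shift_le h1 h2 (min_le_left x y) (min_le_right x y) (le_of_lt hr)

theorem abs_pairing_le (hc : 0 < c) {C₁ C₂ T : ℝ}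
    (hf : ∀ x, T ≤ x → |f x| ≤ C₁ * Real.exp (-c * x))
    (hg : ∀ x, T ≤ x → |g x| ≤ C₂ * Real.exp (-c * x)) {x y : ℝ} (hx : T ≤ x) (hy : T ≤ y) :
    |pairing f g x y| ≤ C₁ * C₂ / (2 * c) * (Real.exp (-c * x) * Real.exp (-c * y)) := by
  have h1 := norm_integral_le_of_norm_le (μ := volume.restrict (Ioi (0 : ℝ)))
    (f := fun r => f (x + r) * g (y + r)) ((exp_neg_integrableOn_Ioi 0
      (by positivity : 0 < 2 * c)).const_mul
      (C₁ * C₂ * (Real.exp (-c * x) * Real.exp (-c * y)))) (by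
      filter_upwards [ae_restrict_mem measurableSet_Ioi] with r hr
      exact abs_mul_shift_le hf hg hx hy (le_of_lt hr))
  rw [integral_const_mul, integral_exp_mul_Ioi (by linarith)] at h1
  refine h1.trans (le_of_eq ?_)
  simp
  field_simp

theorem hasDerivAt_pairing (hc : 0 < c) (hf : Decays c f) (hf' : Decays c f') (hg : Decays c g)
    (hd : ∀ x, HasDerivAt f (f' x) x) (x y : ℝ) :
    HasDerivAt (fun t => pairing f g t y) (pairing f' g x y) x := by
  obtain ⟨C₁, hC₁, h1⟩ := hf'.bound (min (x - 1) y)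
  obtain ⟨C₂, hC₂, h2⟩ := hg.bound (min (x - 1) y)
  have := hf.cont
  have := hf'.cont
  have := hg.cont
  refine (hasDerivAt_integral_of_dominated_loc_of_deriv_le (s := Metric.ball x 1)
    (μ := volume.restrict (Ioi 0)) (F := fun t r => f (t + r) * g (y + r)) (F' := fun t r => f' (t + r) * g (y + r))
    (bound := fun r => C₁ * C₂ * (Real.exp (-c * (x - 1)) * Real.exp (-c * y)) *
      Real.exp (-(2 * c) * r)) (Metric.ball_mem_nhds x one_pos)
    (Eventually.of_forall fun t => Continuous.aestronglyMeasurable (by fun_prop))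
    (integrableOn_pairing hc hf hg x y) (Continuous.aestronglyMeasurable (by fun_prop)) ?_
    ((exp_neg_integrableOn_Ioi 0 (by positivity : 0 < 2 * c)).const_mul _) ?_).2
  · filter_upwards [ae_restrict_mem measurableSet_Ioi] with r hr t ht
    rw [Metric.mem_ball, Real.dist_eq, abs_lt] at ht
    refine (abs_mul_shift_le h1 h2 (x := t) (by
      exact (min_le_left _ _).trans (by linarith)) (min_le_right _ _) (le_of_lt hr)).trans ?_
    have h3 : Real.exp (-c * t) ≤ Real.exp (-c * (x - 1)) :=
      Real.exp_le_exp.2 (by nlinarith [ht.1])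
    gcongr
  · exact Eventually.of_forall fun r t _ => ((hd (t + r)).comp_add_const t r).mul_const _

theorem Decays.pairing_left (hc : 0 < c) (hf : Decays c f) (hf' : Decays c f') (hg : Decays c g)
    (hd : ∀ x, HasDerivAt f (f' x) x) (y : ℝ) : Decays c fun x => pairing f g x y where
  cont := continuous_iff_continuousAt.2 fun x =>
    (hasDerivAt_pairing hc hf hf' hg hd x y).continuousAt
  bound T := by
    obtain ⟨C₁, hC₁, h1⟩ := hf.bound (min T y)
    obtain ⟨C₂, hC₂, h2⟩ := hg.bound (min T y)
    refine ⟨C₁ * C₂ / (2 * c) * Real.exp (-c * y), by positivity, fun x hx => ?_⟩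
    refine (abs_pairing_le hc h1 h2 ((min_le_left _ _).trans hx) (min_le_right _ _)).trans
      (le_of_eq (by ring))

/-- Integration by parts. -/
theorem pairing_add_pairing (hc : 0 < c) (hf : Decays c f) (hf' : Decays c f') (hg : Decays c g)
    (hg' : Decays c g') (hdf : ∀ x, HasDerivAt f (f' x) x) (hdg : ∀ x, HasDerivAt g (g' x) x)
    (x y : ℝ) : pairing f' g x y + pairing f g' x y = -(f x * g y) := by
  have h1 := integrableOn_pairing hc hf' hg x y
  have h2 := integrableOn_pairing hc hf hg' x y
  rw [pairing, pairing, ← integral_add h1 h2]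
  have h3 : Tendsto (fun r => f (x + r) * g (y + r)) atTop (𝓝 0) := by
    have := ((hf.tendsto_zero hc).comp (tendsto_atTop_add_const_left atTop x tendsto_id)).mul
      ((hg.tendsto_zero hc).comp (tendsto_atTop_add_const_left atTop y tendsto_id))
    simpa using this
  have h4 := integral_Ioi_of_hasDerivAt_of_tendsto' (f := fun r => f (x + r) * g (y + r)) (m := 0)
    (f' := fun r => f' (x + r) * g (y + r) + f (x + r) * g' (y + r)) (a := 0)
    (fun r _ => ?_) (h1.add h2) h3
  · simpa using h4
  · exact ((hdf (x + r)).comp_const_add x r).mul ((hdg (y + r)).comp_const_add y r)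

/-- No exchange of integrals is needed: the right-hand side has derivative `-pairing f g` and
vanishes at infinity. -/
theorem integral_pairing (hc : 0 < c) (hf : Decays c f) (hf' : Decays c f') (hg : Decays c g)
    (hd : ∀ x, HasDerivAt f (f' x) x) (x y : ℝ) :
    ∫ u in Ioi x, pairing f g u y = pairing (tail f) g x y := by
  have h1 := (hf.tail hc).pairing_left hc hf.neg hg (hasDerivAt_tail hc hf) y
  have h2 := (hf.pairing_left hc hf' hg hd y).integrableOn hc x
  have h3 := hasDerivAt_pairing hc (hf.tail hc) hf.neg hg (hasDerivAt_tail hc hf)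
  have h4 : ∀ u, pairing (fun t => -f t) g u y = -pairing f g u y := fun u => by
    simp only [pairing, neg_mul, integral_neg]
  have h5 := integral_Ioi_of_hasDerivAt_of_tendsto' (f := fun u => pairing (tail f) g u y) (m := 0)
    (f' := fun u => -pairing f g u y) (a := x) (fun u _ => ?_) h2.neg (h1.tendsto_zero hc)
  · rw [integral_neg] at h5
    linarith
  · have := h3 u y
    rwa [h4] at this

theorem pairing_tendsto {F G : ℕ → ℝ → ℝ} (hc : 0 < c) {C₁ C₂ : ℝ}
    (hFc : ∀ j, Continuous (F j)) (hGc : ∀ j, Continuous (G j))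
    (hF : ∀ j x, 0 ≤ x → |F j x| ≤ C₁ * Real.exp (-c * x))
    (hG : ∀ j x, 0 ≤ x → |G j x| ≤ C₂ * Real.exp (-c * x))
    (hFf : ∀ x, 0 ≤ x → Tendsto (fun j => F j x) atTop (𝓝 (f x)))
    (hGg : ∀ x, 0 ≤ x → Tendsto (fun j => G j x) atTop (𝓝 (g x))) {x y : ℝ}
    (hx : 0 ≤ x) (hy : 0 ≤ y) :
    Tendsto (fun j => pairing (F j) (G j) x y) atTop (𝓝 (pairing f g x y)) := by
  refine tendsto_integral_of_dominated_convergence (fun r => C₁ * C₂ * (Real.exp (-c * x) *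
    Real.exp (-c * y)) * Real.exp (-(2 * c) * r)) (fun j => ?_)
    ((exp_neg_integrableOn_Ioi 0 (by positivity : 0 < 2 * c)).const_mul _) (fun j => ?_) ?_
  · have := hFc j
    have := hGc j
    exact Continuous.aestronglyMeasurable (by fun_prop)
  · filter_upwards [ae_restrict_mem measurableSet_Ioi] with r hr
    exact abs_mul_shift_le (hF j) (hG j) hx hy (le_of_lt hr)
  · filter_upwards [ae_restrict_mem measurableSet_Ioi] with r hr
    have hr : 0 < r := hr
    exact (hFf _ (by linarith)).mul (hGg _ (by linarith))

theorem tail_tendsto {F : ℕ → ℝ → ℝ} (hc : 0 < c) {C₁ : ℝ} (hFc : ∀ j, Continuous (F j))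
    (hF : ∀ j x, 0 ≤ x → |F j x| ≤ C₁ * Real.exp (-c * x))
    (hFf : ∀ x, 0 ≤ x → Tendsto (fun j => F j x) atTop (𝓝 (f x))) {x : ℝ} (hx : 0 ≤ x) :
    Tendsto (fun j => tail (F j) x) atTop (𝓝 (tail f x)) := by
  refine tendsto_integral_of_dominated_convergence (fun r => C₁ * Real.exp (-c * x) *
    Real.exp (-c * r)) (fun j => ?_)
    ((exp_neg_integrableOn_Ioi 0 hc).const_mul _) (fun j => ?_) ?_
  · have := hFc j
    exact Continuous.aestronglyMeasurable (by fun_prop)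
  · filter_upwards [ae_restrict_mem measurableSet_Ioi] with r hr
    have hr : 0 < r := hr
    refine (hF j (x + r) (by linarith)).trans (le_of_eq ?_)
    rw [mul_add, Real.exp_add, mul_assoc]
  · filter_upwards [ae_restrict_mem measurableSet_Ioi] with r hr
    have hr : 0 < r := hr
    exact hFf _ (by linarith)

theorem exists_decays (hf : Continuous f) (h : ExpDecay f) : ∃ c, 0 < c ∧ Decays c f := by
  obtain ⟨c, hc, hO⟩ := h
  refine ⟨c, hc, hf, fun T => ?_⟩
  obtain ⟨C, hC⟩ := hO.bound
  obtain ⟨R, hR⟩ := eventually_atTop.1 hC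
  -- The growth condition acts only beyond `R`; compactness covers what remains of the half-line.
  obtain ⟨B, hB⟩ := (isCompact_Icc (a := T) (b := max T R)).exists_bound_of_continuousOn
    (f := fun x => f x * Real.exp (c * x)) (by fun_prop)
  refine ⟨max C (max B 0), le_max_of_le_right (le_max_right _ _), fun x hx => ?_⟩
  rcases le_total R x with hRx | hRx
  · have := hR x hRx
    rw [Real.norm_eq_abs, Real.norm_eq_abs, Real.abs_exp] at this
    exact this.trans (by gcongr; exact le_max_left _ _)
  · have := hB x ⟨hx, hRx.trans (le_max_right _ _)⟩
    rw [Real.norm_eq_abs, abs_mul, Real.abs_exp] at this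
    have h1 : |f x| = |f x| * Real.exp (c * x) * Real.exp (-c * x) := by
      rw [mul_assoc, ← Real.exp_add]; simp
    rw [h1]
    gcongr
    exact this.trans ((le_max_left _ _).trans (le_max_right _ _))

theorem Decays.of_le {c₁ : ℝ} (h : c ≤ c₁) (hf : Decays c₁ f) : Decays c f where
  cont := hf.cont
  bound T := by
    obtain ⟨C, hC, hb⟩ := hf.bound T
    refine ⟨C * Real.exp (-(c₁ - c) * T), by positivity, fun x hx => (hb x hx).trans ?_⟩
    rw [mul_assoc, ← Real.exp_add]
    gcongr
    nlinarith

theorem Decays.shift (hf : Decays c f) (s : ℝ) : Decays c fun x => f (x + s) where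
  cont := by have := hf.cont; fun_prop
  bound T := by
    obtain ⟨C, hC, hb⟩ := hf.bound (T + s)
    refine ⟨C * Real.exp (-c * s), by positivity, fun x hx => (hb (x + s) (by linarith)).trans ?_⟩
    rw [mul_assoc, ← Real.exp_add]
    gcongr
    linarith

/-! ### The kernels in terms of pairings -/

/-- The symplectic-like scalar kernel of a function. -/
def scalarSympl (F : ℝ → ℝ) (x y : ℝ) : ℝ := pairing F F x y - (1 / 2) * F x * tail F y

/-- The orthogonal-like scalar kernel of a function. -/
def scalarOrtho (F : ℝ → ℝ) (x y : ℝ) : ℝ := pairing F F x y + F x * (1 - tail F y)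

/-- The antiderivative in the first variable of half the symplectic-like kernel. -/
def skewSympl (F : ℝ → ℝ) (x y : ℝ) : ℝ :=
  -((1 / 2) * pairing (tail F) F x y) + (1 / 4) * (tail F x * tail F y)

/-- The smooth skew kernel of the orthogonal-like case. -/
def skewOrtho (F : ℝ → ℝ) (x y : ℝ) : ℝ :=
  -pairing (tail F) F x y + (1 / 2) * (tail F x * tail F y) + (1 / 2) * (tail F y - tail F x)

/-- The first derivative of `skewSympl`. -/
def skewSymplD (F : ℝ → ℝ) (x y : ℝ) : ℝ :=
  (1 / 2) * pairing F F x y - (1 / 4) * (F x * tail F y)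

/-- The first derivative of `skewOrtho`. -/
def skewOrthoD (F : ℝ → ℝ) (x y : ℝ) : ℝ :=
  pairing F F x y - (1 / 2) * (F x * tail F y) + (1 / 2) * F x

/-- The matrix kernel of the symplectic-like case. -/
def blockSympl (F F' : ℝ → ℝ) (x y : ℝ) : Matrix (Fin 2) (Fin 2) ℝ :=
  !![skewSympl F x y, skewSymplD F y x;
     -skewSymplD F x y, -((1 / 2) * pairing F' F x y + (1 / 4) * (F x * F y))]

/-- The matrix kernel of the orthogonal-like case, with a general kernel in place of the sign
kernel. -/
def blockOrtho (F F' : ℝ → ℝ) (e : ℝ → ℝ → ℝ) (x y : ℝ) : Matrix (Fin 2) (Fin 2) ℝ :=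
  !![skewOrtho F x y - e x y, skewOrthoD F y x;
     -skewOrthoD F x y, -(pairing F' F x y + (1 / 2) * (F x * F y))]

variable {c : ℝ} {F F' : ℝ → ℝ}

/-- Integration by parts for `tail F` against itself. This relation is what makes the kernels `B`
antisymmetric. -/
theorem pairing_tail_add_swap (hc : 0 < c) (hF : Decays c F) (x y : ℝ) :
    pairing (tail F) F x y + pairing (tail F) F y x = tail F x * tail F y := by
  have h := pairing_add_pairing hc (hF.tail hc) hF.neg (hF.tail hc) hF.neg
    (hasDerivAt_tail hc hF) (hasDerivAt_tail hc hF) x y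
  have h1 : pairing (fun t => -F t) (tail F) x y = -pairing (tail F) F y x := by
    rw [pairing_comm]; simp only [pairing, mul_neg, integral_neg]
  have h2 : pairing (tail F) (fun t => -F t) x y = -pairing (tail F) F x y := by
    simp only [pairing, mul_neg, integral_neg]
  rw [h1, h2] at h
  linarith

theorem pairing_deriv_add_swap (hc : 0 < c) (hF : Decays c F) (hF' : Decays c F')
    (hd : ∀ x, HasDerivAt F (F' x) x) (x y : ℝ) :
    pairing F' F x y + pairing F' F y x = -(F x * F y) := by
  rw [← pairing_add_pairing hc hF hF' hF hF' hd hd, pairing_comm F' F y x]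

theorem skewSympl_skew (hc : 0 < c) (hF : Decays c F) : IsSkew (skewSympl F) := fun x y => by
  have := pairing_tail_add_swap hc hF x y
  simp only [skewSympl]
  linarith

theorem skewOrtho_skew (hc : 0 < c) (hF : Decays c F) : IsSkew (skewOrtho F) := fun x y => by
  have := pairing_tail_add_swap hc hF x y
  simp only [skewOrtho]
  linarith

theorem signKernel_skew : IsSkew signKernel := fun x y => by
  rw [signKernel, signKernel, ← neg_sub y x, Real.sign_neg]
  ring

theorem blockSympl_skew (hc : 0 < c) (hF : Decays c F) (hF' : Decays c F')
    (hd : ∀ x, HasDerivAt F (F' x) x) : IsBlockSkew (blockSympl F F') := fun x y => by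
  have h1 := skewSympl_skew hc hF x y
  have h2 := pairing_deriv_add_swap hc hF hF' hd x y
  ext a b
  fin_cases a <;> fin_cases b
  · simpa [blockSympl] using h1
  · simp [blockSympl]
  · simp [blockSympl]
  · simp [blockSympl]
    linarith

theorem blockOrtho_skew (hc : 0 < c) (hF : Decays c F) (hF' : Decays c F')
    (hd : ∀ x, HasDerivAt F (F' x) x) {e : ℝ → ℝ → ℝ} (he : IsSkew e) :
    IsBlockSkew (blockOrtho F F' e) := fun x y => by
  have h1 := skewOrtho_skew hc hF x y
  have h2 := pairing_deriv_add_swap hc hF hF' hd x y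
  have h3 := he x y
  ext a b
  fin_cases a <;> fin_cases b
  · simp [blockOrtho]
    linarith
  · simp [blockOrtho]
  · simp [blockOrtho]
  · simp [blockOrtho]
    linarith

/-- The derivatives of a skew kernel with known first derivative. -/
theorem derivatives_of_skew {B b b' : ℝ → ℝ → ℝ} (hB : IsSkew B)
    (h1 : ∀ x y, HasDerivAt (fun t => B t y) (b x y) x)
    (h2 : ∀ x y, HasDerivAt (fun t => b y t) (b' x y) x) :
    HasBlockDerivatives B ∧ (∀ x y, D B x y = b x y) ∧ (∀ x y, mulDT B x y = -b y x) ∧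
      ∀ x y, D (mulDT B) x y = -b' x y := by
  have h3 : ∀ x y, HasDerivAt (fun t => B x t) (-b y x) y := fun x y => by
    have : (fun t => B x t) = fun t => -B t x := funext fun t => hB x t
    rw [this]
    exact (h1 y x).neg
  have h4 : mulDT B = fun x y => -b y x := funext fun x => funext fun y => (h3 x y).deriv
  have h5 : ∀ x y, HasDerivAt (fun t => mulDT B t y) (-b' x y) x := fun x y => by
    rw [h4]
    exact (h2 x y).neg
  exact ⟨⟨fun x y => (h1 x y).differentiableAt, fun x y => (h3 x y).differentiableAt,
    fun x y => (h5 x y).differentiableAt⟩, fun x y => (h1 x y).deriv,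
    fun x y => (h3 x y).deriv, fun x y => (h5 x y).deriv⟩

theorem hasDerivAt_pairing_tail (hc : 0 < c) (hF : Decays c F) (x y : ℝ) :
    HasDerivAt (fun t => -pairing (tail F) F t y) (pairing F F x y) x := by
  have h := (hasDerivAt_pairing hc (hF.tail hc) hF.neg hF (hasDerivAt_tail hc hF) x y).neg
  have h1 : -pairing (fun t => -F t) F x y = pairing F F x y := by
    simp only [pairing, neg_mul, integral_neg, neg_neg]
  rwa [h1] at h

theorem skewSympl_derivatives (hc : 0 < c) (hF : Decays c F) (hF' : Decays c F')
    (hd : ∀ x, HasDerivAt F (F' x) x) :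
    HasBlockDerivatives (skewSympl F) ∧ ∀ x y, blockSympl F F' x y =
      !![skewSympl F x y, -mulDT (skewSympl F) x y;
        -D (skewSympl F) x y, D (mulDT (skewSympl F)) x y] := by
  have e1 : ∀ x y, HasDerivAt (fun t => skewSympl F t y) (skewSymplD F x y) x := fun x y => by
    have e := ((hasDerivAt_pairing_tail hc hF x y).const_mul (1 / 2)).add
      (((hasDerivAt_tail hc hF x).mul_const (tail F y)).const_mul (1 / 4))
    refine (e.congr_deriv ?_).congr_of_eventuallyEq (Eventually.of_forall fun t => ?_)
    · simp only [skewSymplD]; ring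
    · simp [skewSympl]
  have e2 : ∀ x y, HasDerivAt (fun t => skewSymplD F y t)
      ((1 / 2) * pairing F' F x y + (1 / 4) * (F x * F y)) x := fun x y => by
    have e := ((hasDerivAt_pairing hc hF hF' hF hd x y).const_mul (1 / 2)).sub
      (((hasDerivAt_tail hc hF x).const_mul (F y)).const_mul (1 / 4))
    refine (e.congr_deriv ?_).congr_of_eventuallyEq (Eventually.of_forall fun t => ?_)
    · ring
    · simp [skewSymplD, pairing_comm F F y]
  obtain ⟨h, h1, h2, h3⟩ := derivatives_of_skew
    (b' := fun x y => (1 / 2) * pairing F' F x y + (1 / 4) * (F x * F y))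
    (skewSympl_skew hc hF) e1 e2
  exact ⟨h, fun x y => by simp only [blockSympl, h1, h2, h3, neg_neg]⟩

theorem skewOrtho_derivatives (hc : 0 < c) (hF : Decays c F) (hF' : Decays c F')
    (hd : ∀ x, HasDerivAt F (F' x) x) (e : ℝ → ℝ → ℝ) :
    HasBlockDerivatives (skewOrtho F) ∧ ∀ x y, blockOrtho F F' e x y =
      !![skewOrtho F x y - e x y, -mulDT (skewOrtho F) x y;
        -D (skewOrtho F) x y, D (mulDT (skewOrtho F)) x y] := by
  have e1 : ∀ x y, HasDerivAt (fun t => skewOrtho F t y) (skewOrthoD F x y) x := fun x y => by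
    have e := ((hasDerivAt_pairing_tail hc hF x y).add
      (((hasDerivAt_tail hc hF x).mul_const (tail F y)).const_mul (1 / 2))).add
      (((hasDerivAt_tail hc hF x).const_sub (tail F y)).const_mul (1 / 2))
    refine (e.congr_deriv ?_).congr_of_eventuallyEq (Eventually.of_forall fun t => ?_)
    · simp only [skewOrthoD]; ring
    · simp [skewOrtho]
  have e2 : ∀ x y, HasDerivAt (fun t => skewOrthoD F y t)
      (pairing F' F x y + (1 / 2) * (F x * F y)) x := fun x y => by
    have e := ((hasDerivAt_pairing hc hF hF' hF hd x y).sub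
      (((hasDerivAt_tail hc hF x).const_mul (F y)).const_mul (1 / 2))).add_const
      ((1 / 2) * F y)
    refine (e.congr_deriv ?_).congr_of_eventuallyEq (Eventually.of_forall fun t => ?_)
    · ring
    · simp [skewOrthoD, pairing_comm F F y]
  obtain ⟨h, h1, h2, h3⟩ := derivatives_of_skew
    (b' := fun x y => pairing F' F x y + (1 / 2) * (F x * F y))
    (skewOrtho_skew hc hF) e1 e2
  exact ⟨h, fun x y => by simp only [blockOrtho, h1, h2, h3, neg_neg]⟩

section Kernels

variable {A : ℝ → ℝ} {s : ℝ}

theorem kernelSympl_eq : kernelSympl A s = scalarSympl fun x => A (x + s) := by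
  funext x y
  rw [kernelSympl, scalarSympl, add_comm s x]
  rfl

theorem kernelOrtho_eq : kernelOrtho A s = scalarOrtho fun x => A (x + s) := by
  funext x y
  rw [kernelOrtho, scalarOrtho, add_comm s x]
  rfl

theorem dInv_kernelK_eq (hc : 0 < c) (hF : Decays c fun x => A (x + s))
    (hF' : Decays c F') (hd : ∀ x, HasDerivAt (fun x => A (x + s)) (F' x) x) (x y : ℝ) :
    DInv (kernelK A s) x y =
      -pairing (tail fun x => A (x + s)) (fun x => A (x + s)) x y := by
  rw [← integral_pairing hc hF hF' hF hd]
  rfl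

theorem bSympl_eq (hc : 0 < c) (hF : Decays c fun x => A (x + s))
    (hF' : Decays c F') (hd : ∀ x, HasDerivAt (fun x => A (x + s)) (F' x) x) :
    bSympl A s = skewSympl fun x => A (x + s) := by
  funext x y
  have h1 := (hF.pairing_left hc hF' hF hd y).integrableOn hc x
  have h2 : IntegrableOn (fun u => (1 / 2) * A (u + s) * tail (fun x => A (x + s)) y) (Ioi x) :=
    ((hF.integrableOn hc x).const_mul _).mul_const _
  rw [bSympl, DInv, kernelSympl_eq]
  simp only [scalarSympl]
  rw [integral_sub h1 h2, integral_pairing hc hF hF' hF hd, integral_mul_const, integral_const_mul,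
    ← tail_eq fun x => A (x + s), skewSympl]
  ring

theorem bOrtho_eq (hc : 0 < c) (hF : Decays c fun x => A (x + s))
    (hF' : Decays c F') (hd : ∀ x, HasDerivAt (fun x => A (x + s)) (F' x) x) :
    bOrtho A s = skewOrtho fun x => A (x + s) := by
  funext x y
  rw [bOrtho, dInv_kernelK_eq hc hF hF' hd]
  rfl

end Kernels

/-! ### The sign kernel -/

/-- Only the first term on the right depends on `t`, so differentiation of the sign kernel reduces
to the fundamental theorem of calculus. -/
theorem integral_signKernel_mul {f : ℝ → ℝ} (hf : IntegrableOn f (Ioi 0)) {t : ℝ} (ht : 0 < t) :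
    ∫ y in Ioi (0 : ℝ), signKernel t y * f y =
      (∫ y in (0 : ℝ)..t, f y) - (1 / 2) * ∫ y in Ioi (0 : ℝ), f y := by
  have hu : Ioi (0 : ℝ) = Ioc 0 t ∪ Ioi t := (Ioc_union_Ioi_eq_Ioi ht.le).symm
  have hd : Disjoint (Ioc (0 : ℝ) t) (Ioi t) := by
    rw [Set.disjoint_left]; intro y hy hy'; exact absurd hy.2 (not_le.2 hy')
  have i1 : IntegrableOn f (Ioc 0 t) := hf.mono_set Ioc_subset_Ioi_self
  have i2 : IntegrableOn f (Ioi t) := hf.mono_set (Ioi_subset_Ioi ht.le)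
  have e1 : ∀ y ∈ Ioi t, signKernel t y * f y = -(1 / 2) * f y := fun y hy => by
    rw [signKernel, Real.sign_of_neg (sub_neg.2 hy)]; ring
  have e2 : ∀ᵐ y ∂volume.restrict (Ioc 0 t), signKernel t y * f y = (1 / 2) * f y := by
    rw [← restrict_Ioo_eq_restrict_Ioc]
    filter_upwards [ae_restrict_mem measurableSet_Ioo] with y hy
    rw [signKernel, Real.sign_of_pos (sub_pos.2 hy.2)]; ring
  have j1 : IntegrableOn (fun y => signKernel t y * f y) (Ioc 0 t) :=
    (i1.const_mul (1 / 2)).congr (e2.mono fun y hy => hy.symm)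
  have j2 : IntegrableOn (fun y => signKernel t y * f y) (Ioi t) :=
    IntegrableOn.congr_fun (i2.const_mul (-(1 / 2))) (fun y hy => (e1 y hy).symm)
      measurableSet_Ioi
  rw [intervalIntegral.integral_of_le ht.le, hu, setIntegral_union hd measurableSet_Ioi j1 j2,
    setIntegral_union hd measurableSet_Ioi i1 i2, integral_congr_ae e2,
    setIntegral_congr_fun measurableSet_Ioi e1, integral_const_mul, integral_const_mul]
  ring

theorem hasDerivAt_integral_signKernel {f : ℝ → ℝ} (hf : IntegrableOn f (Ioi 0))
    (hfc : ContinuousOn f (Ioi 0)) {x : ℝ} (hx : 0 < x) :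
    HasDerivAt (fun t => ∫ y in Ioi (0 : ℝ), signKernel t y * f y) (f x) x := by
  have h1 : HasDerivAt (fun t => ∫ y in (0 : ℝ)..t, f y) (f x) x := by
    refine intervalIntegral.integral_hasDerivAt_right ?_ ?_ (hfc.continuousAt (Ioi_mem_nhds hx))
    · rw [intervalIntegrable_iff_integrableOn_Ioc_of_le hx.le]
      exact hf.mono_set Ioc_subset_Ioi_self
    · exact hfc.stronglyMeasurableAtFilter isOpen_Ioi x hx
  refine (h1.sub_const ((1 / 2) * ∫ y in Ioi (0 : ℝ), f y)).congr_of_eventuallyEq ?_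
  filter_upwards [Ioi_mem_nhds hx] with t ht using integral_signKernel_mul hf ht

theorem signKernel_zero {x : ℝ} (hx : 0 < x) : signKernel x 0 = 1 / 2 := by
  rw [signKernel, Real.sign_of_pos (by simpa using hx)]; norm_num

theorem tendsto_signKernel (x : ℝ) :
    Tendsto (fun y => signKernel x y) atTop (𝓝 (-(1 / 2))) := by
  refine tendsto_const_nhds.congr' ?_
  filter_upwards [eventually_gt_atTop x] with y hy
  rw [signKernel, Real.sign_of_neg (sub_neg.2 hy)]; norm_num

/-! ### Uniform bounds and limits of the kernels -/

/-- Uniform bounds for the scalar and matrix kernels in terms of bounds for the function and its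
derivative. -/
theorem exists_kernel_bound {c C₁ : ℝ} (hc : 0 < c) (hC₁ : 0 ≤ C₁) :
    ∃ C, 0 ≤ C ∧ ∀ F F' : ℝ → ℝ, (∀ x, 0 ≤ x → |F x| ≤ C₁ * Real.exp (-c * x)) →
      (∀ x, 0 ≤ x → |F' x| ≤ C₁ * Real.exp (-c * x)) → ∀ x y, 0 < x → 0 < y →
      |scalarSympl F x y| ≤ C * Real.exp (-c * x) ∧
      |scalarOrtho F x y| ≤ C * Real.exp (-c * x) ∧
      (∀ a b, |blockSympl F F' x y a b| ≤ C * (compWeight c a x * compWeight c b y)) ∧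
      ∀ e : ℝ → ℝ → ℝ, |e x y| ≤ 1 / 2 →
        ∀ a b, |blockOrtho F F' e x y a b| ≤ C * (compWeight c a x * compWeight c b y) := by
  obtain ⟨E, hE⟩ : ∃ E, E = C₁ + C₁ / c := ⟨_, rfl⟩
  have hE1 : C₁ ≤ E := by
    have : 0 ≤ C₁ / c := by positivity
    linarith
  have hE2 : C₁ / c ≤ E := by rw [hE]; linarith
  have hE0 : 0 ≤ E := hC₁.trans hE1
  obtain ⟨P, hP⟩ : ∃ P, P = E * E / (2 * c) := ⟨_, rfl⟩
  have hP0 : 0 ≤ P := by rw [hP]; positivity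
  have hEE : 0 ≤ E * E := by positivity
  -- `E` bounds `F`, `F'` and `tail F` simultaneously. `P` accounts for the pairings, `E * E` for
  -- products, `E` for single functions and `1 / 2` for the kernel `e`.
  refine ⟨P + E * E + E + 1 / 2, by positivity, fun F F' hF hF' x y hx hy => ?_⟩
  have bF : ∀ x, 0 ≤ x → |F x| ≤ E * Real.exp (-c * x) := fun x hx =>
    (hF x hx).trans (by gcongr)
  have bF' : ∀ x, 0 ≤ x → |F' x| ≤ E * Real.exp (-c * x) := fun x hx =>
    (hF' x hx).trans (by gcongr)
  have bT : ∀ x, 0 ≤ x → |tail F x| ≤ E * Real.exp (-c * x) := fun x hx =>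
    (abs_tail_le hc hF hx).trans (by gcongr)
  have p1 : |pairing F F x y| ≤ P * (Real.exp (-c * x) * Real.exp (-c * y)) :=
    hP ▸ abs_pairing_le hc bF bF hx.le hy.le
  have p1' : |pairing F F y x| ≤ P * (Real.exp (-c * x) * Real.exp (-c * y)) := by
    rw [pairing_comm]; exact p1
  have p2 : |pairing (tail F) F x y| ≤ P * (Real.exp (-c * x) * Real.exp (-c * y)) :=
    hP ▸ abs_pairing_le hc bT bF hx.le hy.le
  have p3 : |pairing F' F x y| ≤ P * (Real.exp (-c * x) * Real.exp (-c * y)) :=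
    hP ▸ abs_pairing_le hc bF' bF hx.le hy.le
  have hu : Real.exp (-c * x) ≤ 1 := Real.exp_le_one_iff.2 (by nlinarith)
  have hv : Real.exp (-c * y) ≤ 1 := Real.exp_le_one_iff.2 (by nlinarith)
  have qm : ∀ {f g : ℝ → ℝ}, (∀ x, 0 ≤ x → |f x| ≤ E * Real.exp (-c * x)) →
      (∀ x, 0 ≤ x → |g x| ≤ E * Real.exp (-c * x)) →
      |f x * g y| ≤ E * E * (Real.exp (-c * x) * Real.exp (-c * y)) := fun hf hg => by
    rw [abs_mul]
    refine (mul_le_mul (hf x hx.le) (hg y hy.le) (abs_nonneg _)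
      ((abs_nonneg _).trans (hf x hx.le))).trans (le_of_eq (by ring))
  have q1 := qm bF bT
  have q2 := qm bT bT
  have q3 := qm bF bF
  have q4 := qm bT bF
  have r1 := bF x hx.le
  have r2 := bF y hy.le
  have r3 := bT x hx.le
  have r4 := bT y hy.le
  have w0 : ∀ z, compWeight c 0 z = 1 := fun z => rfl
  have wx : compWeight c 1 x = Real.exp (-c * x) := rfl
  have wy : compWeight c 1 y = Real.exp (-c * y) := rfl
  have hu0 := Real.exp_pos (-c * x)
  have hv0 := Real.exp_pos (-c * y)
  generalize Real.exp (-c * x) = u at *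
  generalize Real.exp (-c * y) = v at *
  have huv : u * v ≤ u := by nlinarith
  have huv' : u * v ≤ v := by nlinarith
  have m1 := mul_le_mul_of_nonneg_left huv hP0
  have m2 := mul_le_mul_of_nonneg_left huv' hP0
  have m3 := mul_le_mul_of_nonneg_left huv hEE
  have m4 := mul_le_mul_of_nonneg_left huv' hEE
  have m5 := mul_le_mul_of_nonneg_left hu hP0
  have m6 := mul_le_mul_of_nonneg_left hu hEE
  have m7 := mul_le_mul_of_nonneg_left hu hE0
  have m8 := mul_le_mul_of_nonneg_left hv hE0
  have n1 : 0 ≤ E * (u * v) := by positivity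
  have n2 : 0 ≤ E * u := by positivity
  have n3 : 0 ≤ E * v := by positivity
  have n4 : 0 ≤ E * E * u := by positivity
  have n5 : 0 ≤ E * E * v := by positivity
  have n6 : 0 ≤ E * E * (u * v) := by positivity
  have n7 : 0 ≤ P * u := by positivity
  have n8 : 0 ≤ P * v := by positivity
  have n9 : 0 ≤ P * (u * v) := by positivity
  have n10 : 0 ≤ u * v := by positivity
  clear hF hF' bF bF' bT qm hE1 hE2
  rw [mul_comm (F x) (F y)] at q3
  simp only [abs_le] at *
  obtain ⟨p1a, p1b⟩ := p1
  obtain ⟨p1a', p1b'⟩ := p1'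
  obtain ⟨p2a, p2b⟩ := p2
  obtain ⟨p3a, p3b⟩ := p3
  obtain ⟨q1a, q1b⟩ := q1
  obtain ⟨q2a, q2b⟩ := q2
  obtain ⟨q3a, q3b⟩ := q3
  obtain ⟨q4a, q4b⟩ := q4
  obtain ⟨r1a, r1b⟩ := r1
  obtain ⟨r2a, r2b⟩ := r2
  obtain ⟨r3a, r3b⟩ := r3
  obtain ⟨r4a, r4b⟩ := r4
  refine ⟨?_, ?_, fun a b => ?_, fun e ⟨ea, eb⟩ a b => ?_⟩
  · simp only [scalarSympl]
    constructor <;> linarith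
  · simp only [scalarOrtho]
    constructor <;> linarith
  · fin_cases a <;> fin_cases b <;>
      simp [blockSympl, skewSympl, skewSymplD, w0, wx, wy] <;> constructor <;> linarith
  · fin_cases a <;> fin_cases b <;>
      simp [blockOrtho, skewOrtho, skewOrthoD, w0, wx, wy] <;> constructor <;> linarith

section Limits

variable {c C₁ : ℝ} {F F' : ℕ → ℝ → ℝ} {G G' : ℝ → ℝ}

theorem tendsto_kernels (hc : 0 < c)
    (hdF : ∀ j, Decays c (F j)) (hcF' : ∀ j, Continuous (F' j))
    (hF : ∀ j x, 0 ≤ x → |F j x| ≤ C₁ * Real.exp (-c * x))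
    (hF' : ∀ j x, 0 ≤ x → |F' j x| ≤ C₁ * Real.exp (-c * x))
    (hG : ∀ x, 0 ≤ x → Tendsto (fun j => F j x) atTop (𝓝 (G x)))
    (hG' : ∀ x, 0 ≤ x → Tendsto (fun j => F' j x) atTop (𝓝 (G' x))) {x y : ℝ}
    (hx : 0 < x) (hy : 0 < y) :
    Tendsto (fun j => scalarSympl (F j) x y) atTop (𝓝 (scalarSympl G x y)) ∧
    Tendsto (fun j => scalarOrtho (F j) x y) atTop (𝓝 (scalarOrtho G x y)) ∧
    (∀ a b, Tendsto (fun j => blockSympl (F j) (F' j) x y a b) atTop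
      (𝓝 (blockSympl G G' x y a b))) ∧
    ∀ e a b, Tendsto (fun j => blockOrtho (F j) (F' j) e x y a b) atTop
      (𝓝 (blockOrtho G G' e x y a b)) := by
  have hcF : ∀ j, Continuous (F j) := fun j => (hdF j).cont
  have hT : ∀ x, 0 ≤ x → Tendsto (fun j => tail (F j) x) atTop (𝓝 (tail G x)) :=
    fun x hx => tail_tendsto hc hcF hF hG hx
  have bT : ∀ j x, 0 ≤ x → |tail (F j) x| ≤ (C₁ / c) * Real.exp (-c * x) :=
    fun j x hx => abs_tail_le hc (hF j) hx
  have cT : ∀ j, Continuous (tail (F j)) := fun j => ((hdF j).tail hc).cont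
  have p1 := pairing_tendsto hc hcF hcF hF hF hG hG hx.le hy.le
  have p1' := pairing_tendsto hc hcF hcF hF hF hG hG hy.le hx.le
  have p2 := pairing_tendsto hc cT hcF bT hF hT hG hx.le hy.le
  have p3 := pairing_tendsto hc hcF' hcF hF' hF hG' hG hx.le hy.le
  have f1 := hG x hx.le
  have f2 := hG y hy.le
  have t1 := hT x hx.le
  have t2 := hT y hy.le
  refine ⟨?_, ?_, fun a b => ?_, fun e a b => ?_⟩
  · exact p1.sub ((f1.const_mul (1 / 2)).mul t2)
  · exact p1.add (f1.mul (t2.const_sub 1))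
  · fin_cases a <;> fin_cases b
    · exact (p2.const_mul (1 / 2)).neg.add ((t1.mul t2).const_mul (1 / 4))
    · exact (p1'.const_mul (1 / 2)).sub ((f2.mul t1).const_mul (1 / 4))
    · exact ((p1.const_mul (1 / 2)).sub ((f1.mul t2).const_mul (1 / 4))).neg
    · exact ((p3.const_mul (1 / 2)).add ((f1.mul f2).const_mul (1 / 4))).neg
  · fin_cases a <;> fin_cases b
    · exact ((p2.neg.add ((t1.mul t2).const_mul (1 / 2))).add
        ((t2.sub t1).const_mul (1 / 2))).sub_const _
    · exact (p1'.sub ((f2.mul t1).const_mul (1 / 2))).add (f2.const_mul (1 / 2))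
    · exact ((p1.sub ((f1.mul t2).const_mul (1 / 2))).add (f1.const_mul (1 / 2))).neg
    · exact (p3.add ((f1.mul f2).const_mul (1 / 2))).neg

end Limits

/-! ### Finite sums of exponentials -/

section ExpSums

open Matrix

variable {κ : Type*}

/-- The exponential `exp(-λₖ x)`. -/
def expFun (lam : κ → ℝ) (k : κ) (x : ℝ) : ℝ := Real.exp (-lam k * x)

variable {lam : κ → ℝ}

theorem measurable_expFun (lam : κ → ℝ) (k : κ) : Measurable (expFun lam k) := by
  unfold expFun
  fun_prop

theorem integral_expFun (hlam : ∀ k, 0 < lam k) (k : κ) :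
    ∫ x in Ioi (0 : ℝ), expFun lam k x = 1 / lam k := by
  have h := integral_exp_mul_Ioi (neg_lt_zero.2 (hlam k)) 0
  simp only [expFun]
  rw [h]
  simp

theorem integrableOn_expFun (hlam : ∀ k, 0 < lam k) (k : κ) :
    IntegrableOn (expFun lam k) (Ioi 0) := exp_neg_integrableOn_Ioi 0 (hlam k)

theorem expFun_mul (lam : κ → ℝ) (k l : κ) :
    (fun x => expFun lam k x * expFun lam l x) =
      fun x => expFun (fun p : κ × κ => lam p.1 + lam p.2) (k, l) x := by
  funext x
  simp only [expFun]
  rw [← Real.exp_add]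
  ring_nf

theorem integral_expFun_mul (hlam : ∀ k, 0 < lam k) (k l : κ) :
    ∫ x in Ioi (0 : ℝ), expFun lam k x * expFun lam l x = 1 / (lam k + lam l) := by
  rw [expFun_mul]
  exact integral_expFun (fun p => add_pos (hlam p.1) (hlam p.2)) (k, l)

theorem integrableOn_expFun_mul (hlam : ∀ k, 0 < lam k) (k l : κ) :
    IntegrableOn (fun x => expFun lam k x * expFun lam l x) (Ioi 0) := by
  rw [expFun_mul]
  exact integrableOn_expFun (fun p => add_pos (hlam p.1) (hlam p.2)) (k, l)

theorem expFun_add (lam : κ → ℝ) (k : κ) (x r : ℝ) :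
    expFun lam k (x + r) = expFun lam k x * expFun lam k r := by
  simp only [expFun]
  rw [← Real.exp_add]
  ring_nf

/-- The skew form of the symplectic-like matrix kernel of an exponential sum. -/
def expForm (lam α : κ → ℝ) : Matrix κ κ ℝ :=
  of fun k l => α k * α l * (lam k - lam l) / (4 * lam k * lam l * (lam k + lam l))

theorem expForm_transpose (lam α : κ → ℝ) : (expForm lam α).transpose = -expForm lam α := by
  ext k l
  simp only [expForm, transpose_apply, of_apply, Matrix.neg_apply]
  rw [← neg_div]
  congr 1 <;> ring

/-- The skew pairing of the exponentials and their derivatives. -/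
def expSkew (lam : κ → ℝ) : Matrix κ κ ℝ := of fun k l => (lam l - lam k) / (lam k + lam l)

theorem expSkew_transpose (lam : κ → ℝ) : (expSkew lam).transpose = -expSkew lam := by
  ext k l
  simp only [expSkew, transpose_apply, of_apply, Matrix.neg_apply]
  rw [← neg_div]
  congr 1 <;> ring

/-- The Gram matrix of the exponentials. -/
def expGram (lam : κ → ℝ) : Matrix κ κ ℝ := of fun k l => 1 / (lam k + lam l)

theorem skewGram_expFun (hlam : ∀ k, 0 < lam k) :
    skewGram (expFun lam) (fun k x => lam k * expFun lam k x) = expSkew lam := by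
  ext k l
  have e : ∀ k l, ∫ x in Ioi (0 : ℝ), expFun lam k x * (lam l * expFun lam l x) =
      lam l / (lam k + lam l) := fun k l => by
    simp only [mul_left_comm _ (lam l)]
    rw [integral_const_mul, integral_expFun_mul hlam]
    ring
  simp only [skewGram, expSkew, of_apply, e]
  rw [add_comm (lam l), ← sub_div]

section Sums

variable [Fintype κ]

/-- The exponential sum `∑ αₖ exp(-λₖ x)`. -/
def expSum (lam α : κ → ℝ) (x : ℝ) : ℝ := ∑ k, α k * expFun lam k x

theorem tail_expSum (hlam : ∀ k, 0 < lam k) (α : κ → ℝ) :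
    tail (expSum lam α) = expSum lam fun k => α k / lam k := by
  funext x
  simp only [tail, expSum, expFun_add]
  rw [integral_finsetSum _ fun k _ => ((integrableOn_expFun hlam k).const_mul _).const_mul _]
  refine Finset.sum_congr rfl fun k _ => ?_
  rw [integral_const_mul, integral_const_mul, integral_expFun hlam]
  ring

theorem pairing_expSum (hlam : ∀ k, 0 < lam k) (α β : κ → ℝ) (x y : ℝ) :
    pairing (expSum lam α) (expSum lam β) x y =
      ∑ k, ∑ l, α k * β l / (lam k + lam l) * (expFun lam k x * expFun lam l y) := by
  have h : ∀ r, expSum lam α (x + r) * expSum lam β (y + r) =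
      ∑ k, ∑ l, α k * β l * (expFun lam k x * expFun lam l y) *
        (expFun lam k r * expFun lam l r) := fun r => by
    simp only [expSum, expFun_add, Finset.sum_mul_sum]
    exact Finset.sum_congr rfl fun k _ => Finset.sum_congr rfl fun l _ => by ring
  simp only [pairing, h]
  have hi : ∀ k l, IntegrableOn (fun r => α k * β l * (expFun lam k x * expFun lam l y) *
        (expFun lam k r * expFun lam l r)) (Ioi 0) := fun k l =>
    (integrableOn_expFun_mul hlam k l).const_mul _
  rw [integral_finsetSum _ fun k _ => integrable_finsetSum _ fun l _ => hi k l]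
  refine Finset.sum_congr rfl fun k _ => ?_
  rw [integral_finsetSum _ fun l _ => hi k l]
  refine Finset.sum_congr rfl fun l _ => ?_
  rw [integral_const_mul, integral_expFun_mul hlam]
  ring

theorem expSum_mul (lam α β : κ → ℝ) (x y : ℝ) :
    expSum lam α x * expSum lam β y =
      ∑ k, ∑ l, α k * β l * (expFun lam k x * expFun lam l y) := by
  simp only [expSum, Finset.sum_mul_sum]
  exact Finset.sum_congr rfl fun k _ => Finset.sum_congr rfl fun l _ => by ring

theorem hasDerivAt_expSum (lam α : κ → ℝ) (x : ℝ) :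
    HasDerivAt (expSum lam α) (expSum lam (fun k => -lam k * α k) x) x := by
  have : ∀ k, HasDerivAt (fun x => α k * expFun lam k x) (-lam k * α k * expFun lam k x) x := by
    intro k
    have h := (((hasDerivAt_id x).const_mul (-lam k)).exp).const_mul (α k)
    refine h.congr_deriv ?_
    simp [expFun]
    ring
  have h := HasDerivAt.fun_sum (u := Finset.univ) fun k _ => this k
  exact h

theorem decays_expSum {c : ℝ} (hlam : ∀ k, c ≤ lam k) (α : κ → ℝ) : Decays c (expSum lam α) where
  cont := continuous_iff_continuousAt.2 fun x => (hasDerivAt_expSum lam α x).continuousAt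
  bound T := by
    refine ⟨∑ k, |α k| * Real.exp (-(lam k - c) * T), by positivity, fun x hx => ?_⟩
    rw [Finset.sum_mul]
    refine (Finset.abs_sum_le_sum_abs _ _).trans (Finset.sum_le_sum fun k _ => ?_)
    rw [abs_mul, mul_assoc, ← Real.exp_add, expFun, Real.abs_exp]
    gcongr
    have := hlam k
    nlinarith

/-- The scalar and Pfaffian sides differ exactly by this rank-one matrix: `2λₗ/(λₖ+λₗ) =
(λₗ-λₖ)/(λₖ+λₗ) + 1`. -/
theorem two_smul_expGram_mul [DecidableEq κ] (hlam : ∀ k, 0 < lam k) :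
    (2 : ℝ) • (expGram lam * diagonal lam) = expSkew lam + vecMulVec 1 1 := by
  ext k l
  have := hlam k
  have := hlam l
  simp only [Matrix.smul_apply, mul_diagonal, expGram, expSkew, Matrix.add_apply, vecMulVec_apply,
    of_apply, Pi.one_apply, smul_eq_mul]
  field_simp
  ring

/-- Differentiating `exp(-λₖ x)` gives `-λₖ exp(-λₖ x)`. The off-diagonal entries of the matrix
kernel carry a minus sign, so the second row consists of the exponentials times `+λₖ`. -/
theorem blockSympl_expSum (hlam : ∀ k, 0 < lam k) (α : κ → ℝ) :
    blockSympl (expSum lam α) (expSum lam fun k => -lam k * α k) =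
      pairKernel (expFun lam) (fun k x => lam k * expFun lam k x) (expForm lam α) := by
  funext x y
  ext a b
  fin_cases a <;> fin_cases b <;>
    simp only [blockSympl, skewSympl, skewSymplD, tail_expSum hlam, pairing_expSum hlam,
      expSum_mul, pairKernel, rowPair, expForm, of_apply, Fin.zero_eta, Fin.mk_one, Fin.isValue,
      if_true, one_ne_zero, if_false, cons_val_zero, cons_val_one, cons_val', cons_val_fin_one]
  · simp only [Finset.mul_sum, ← Finset.sum_neg_distrib, ← Finset.sum_add_distrib]
    refine Finset.sum_congr rfl fun k _ => Finset.sum_congr rfl fun l _ => ?_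
    have := hlam k
    have := hlam l
    field_simp
    ring
  · simp only [Finset.mul_sum, ← Finset.sum_sub_distrib]
    rw [Finset.sum_comm]
    refine Finset.sum_congr rfl fun k _ => Finset.sum_congr rfl fun l _ => ?_
    have := hlam k
    have := hlam l
    field_simp
    ring
  · simp only [Finset.mul_sum, ← Finset.sum_neg_distrib, ← Finset.sum_sub_distrib]
    refine Finset.sum_congr rfl fun k _ => Finset.sum_congr rfl fun l _ => ?_
    have := hlam k
    have := hlam l
    field_simp
    ring
  · simp only [Finset.mul_sum, ← Finset.sum_neg_distrib, ← Finset.sum_add_distrib]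
    refine Finset.sum_congr rfl fun k _ => Finset.sum_congr rfl fun l _ => ?_
    have := hlam k
    have := hlam l
    field_simp
    ring

/-- The factorization of `scalarSympl` for an exponential sum. -/
theorem scalarSympl_expSum (hlam : ∀ k, 0 < lam k) (α : κ → ℝ) :
    scalarSympl (expSum lam α) = fun x y => ∑ k, expFun lam k x *
      ∑ l, -(2 * lam k * expForm lam α k l) * expFun lam l y := by
  funext x y
  simp only [scalarSympl, mul_assoc (1 / 2 : ℝ), tail_expSum hlam, pairing_expSum hlam, expSum_mul,
    expForm, of_apply, Finset.mul_sum, ← Finset.sum_sub_distrib]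
  refine Finset.sum_congr rfl fun k _ => Finset.sum_congr rfl fun l _ => ?_
  have := hlam k
  have := hlam l
  field_simp
  ring

theorem integral_sum_expFun_mul (hlam : ∀ k, 0 < lam k) (m : κ → ℝ) (l : κ) :
    IntegrableOn (fun x => (∑ k, m k * expFun lam k x) * expFun lam l x) (Ioi 0) ∧
      ∫ x in Ioi (0 : ℝ), (∑ k, m k * expFun lam k x) * expFun lam l x =
        ∑ k, m k * expGram lam k l := by
  have hi : ∀ k, IntegrableOn (fun x => m k * expFun lam k x * expFun lam l x) (Ioi 0) :=
    fun k => by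
      simp only [mul_assoc]
      exact (integrableOn_expFun_mul hlam k l).const_mul _
  simp only [Finset.sum_mul]
  refine ⟨integrable_finsetSum _ fun k _ => hi k, ?_⟩
  rw [integral_finsetSum _ fun k _ => hi k]
  refine Finset.sum_congr rfl fun k _ => ?_
  simp only [mul_assoc]
  rw [integral_const_mul, integral_expFun_mul hlam, expGram, of_apply]

theorem fredholmDet_scalarSympl_expSum [DecidableEq κ] (hlam : ∀ k, 0 < lam k) (α : κ → ℝ) :
    fredholmDet (scalarSympl (expSum lam α)) =
      fredholmPf (blockSympl (expSum lam α) (expSum lam fun k => -lam k * α k)) ^ 2 := by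
  -- The Pfaffian side is `det (1 + β S)`. The rank-one term turns `S` into `2 G Λ`, and cycling `Λ`
  -- to the front produces the Gram matrix of the scalar kernel `2 D B`.
  rw [scalarSympl_expSum hlam, fredholmDet_finiteRank fun k l =>
      (integral_sum_expFun_mul hlam _ l).1, blockSympl_expSum hlam,
    fredholmPf_pairKernel_sq (expForm_transpose lam α) fun k l => ?_, skewGram_expFun hlam,
    ← det_one_add_mul_add_vecMulVec (expForm_transpose lam α) (expSkew_transpose lam) 1,
    ← two_smul_expGram_mul hlam, Matrix.mul_smul, ← Matrix.smul_mul, ← Matrix.mul_assoc,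
    det_one_add_mul_comm]
  · congr 1
    ext k l
    simp only [Matrix.sub_apply, Matrix.add_apply, of_apply, (integral_sum_expFun_mul hlam _ l).2,
      diagonal_mul]
    rw [sub_eq_add_neg, Matrix.smul_mul, Matrix.smul_apply, Matrix.mul_apply]
    congr 1
    rw [← Finset.sum_neg_distrib, smul_eq_mul, Finset.mul_sum, Finset.mul_sum]
    exact Finset.sum_congr rfl fun m _ => by ring
  · simp only [mul_left_comm _ (lam l)]
    exact (integrableOn_expFun_mul hlam k l).const_mul _

end Sums

end ExpSums

/-! ### Step approximations of the sign kernel -/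

/-- The index of the cell of length `1 / N` that contains `x`, truncated at `N²`. -/
def stepIndex (N : ℕ) (x : ℝ) : Fin (N * N + 1) :=
  ⟨min ⌊(N : ℝ) * x⌋₊ (N * N), Nat.lt_succ_of_le (min_le_right _ _)⟩

/-- The indicator function of a cell. -/
def stepFun (N : ℕ) (i : Fin (N * N + 1)) (x : ℝ) : ℝ := if stepIndex N x = i then 1 else 0

/-- The values of the step approximation of the sign kernel. -/
def stepForm (N : ℕ) : Matrix (Fin (N * N + 1)) (Fin (N * N + 1)) ℝ :=
  Matrix.of fun i j => (1 / 2) * Real.sign ((i : ℕ) - (j : ℕ))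

/-- The step approximation of the sign kernel. -/
def stepKernel (N : ℕ) (x y : ℝ) : ℝ := ∑ i, ∑ j, stepFun N i x * stepForm N i j * stepFun N j y

theorem stepKernel_eq (N : ℕ) (x y : ℝ) :
    stepKernel N x y = (1 / 2) * Real.sign ((stepIndex N x : ℕ) - (stepIndex N y : ℕ)) := by
  simp [stepKernel, stepFun, stepForm]

theorem stepForm_transpose (N : ℕ) : (stepForm N).transpose = -stepForm N := by
  ext i j
  simp only [stepForm, Matrix.transpose_apply, Matrix.of_apply, Matrix.neg_apply]
  rw [← neg_sub (((i : ℕ) : ℝ)), Real.sign_neg]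
  ring

theorem stepKernel_skew (N : ℕ) : IsSkew (stepKernel N) := fun x y => by
  rw [stepKernel_eq, stepKernel_eq, ← neg_sub (((stepIndex N y : ℕ) : ℝ)), Real.sign_neg]
  ring

theorem abs_half_mul_sign_le (r : ℝ) : |1 / 2 * Real.sign r| ≤ 1 / 2 := by
  rcases Real.sign_apply_eq r with h | h | h <;> rw [h] <;> norm_num [abs_le]

theorem abs_stepKernel_le (N : ℕ) (x y : ℝ) : |stepKernel N x y| ≤ 1 / 2 := by
  rw [stepKernel_eq]
  exact abs_half_mul_sign_le _

theorem stepIndex_lt_stepIndex {N : ℕ} {x y : ℝ} (hx : 0 < x) (hN : x < N)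
    (hxy : 1 ≤ N * (y - x)) : (stepIndex N x : ℕ) < stepIndex N y := by
  have hN0 : (0 : ℝ) < N := hx.trans hN
  have h1 : ⌊(N : ℝ) * x⌋₊ < N * N := by
    rw [Nat.floor_lt (by positivity)]
    push_cast
    exact mul_lt_mul_of_pos_left hN hN0
  have h2 : ⌊(N : ℝ) * x⌋₊ < ⌊(N : ℝ) * y⌋₊ := by
    have : ⌊(N : ℝ) * x⌋₊ + 1 ≤ ⌊(N : ℝ) * y⌋₊ := by
      rw [← Nat.floor_add_one (by positivity)]
      exact Nat.floor_le_floor (by linarith)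
    exact this
  simp only [stepIndex]
  -- The truncation does not affect `x`, since `x < N`. It may affect `y`, but the index of `x` is
  -- still below `N * N`.
  rw [min_eq_left h1.le]
  exact lt_min h2 h1

theorem eventually_stepKernel_eq {x y : ℝ} (hx : 0 < x) (hxy : x < y) :
    ∀ᶠ N : ℕ in atTop, stepKernel N x y = signKernel x y := by
  have h1 : Tendsto (fun N : ℕ => (N : ℝ) * (y - x)) atTop atTop :=
    tendsto_natCast_atTop_atTop.atTop_mul_const (sub_pos.2 hxy)
  filter_upwards [h1.eventually_ge_atTop 1, tendsto_natCast_atTop_atTop.eventually_gt_atTop x]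
    with N hN hN'
  have h2 : ((stepIndex N x : ℕ) : ℝ) < (stepIndex N y : ℕ) :=
    Nat.cast_lt.2 (stepIndex_lt_stepIndex hx hN' hN)
  rw [stepKernel_eq, signKernel, Real.sign_of_neg (sub_neg.2 h2), Real.sign_of_neg (sub_neg.2 hxy)]

theorem tendsto_stepKernel {x y : ℝ} (hx : 0 < x) (hy : 0 < y) :
    Tendsto (fun N => stepKernel N x y) atTop (𝓝 (signKernel x y)) := by
  refine tendsto_nhds_of_eventually_eq ?_
  rcases lt_trichotomy x y with h | h | h
  · exact eventually_stepKernel_eq hx h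
  · exact Eventually.of_forall fun N => by simp [stepKernel_eq, signKernel, h]
  · filter_upwards [eventually_stepKernel_eq hy h] with N hN
    rw [stepKernel_skew N x y, hN, signKernel_skew x y]

theorem measurable_stepFun (N : ℕ) (i : Fin (N * N + 1)) : Measurable (stepFun N i) := by
  have h : Measurable fun x : ℝ => min ⌊(N : ℝ) * x⌋₊ (N * N) :=
    (Nat.measurable_floor.comp (measurable_const_mul (N : ℝ))).min measurable_const
  have hs : MeasurableSet {x | stepIndex N x = i} := by
    have : {x | stepIndex N x = i} = (fun x : ℝ => min ⌊(N : ℝ) * x⌋₊ (N * N)) ⁻¹' {(i : ℕ)} := by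
      ext x
      simp [stepIndex, Fin.ext_iff]
    rw [this]
    exact h (measurableSet_singleton _)
  exact Measurable.ite hs measurable_const measurable_const

theorem integrableOn_stepFun_mul (N : ℕ) (i : Fin (N * N + 1)) {f : ℝ → ℝ}
    (hf : IntegrableOn f (Ioi 0)) : IntegrableOn (fun x => stepFun N i x * f x) (Ioi 0) := by
  refine Integrable.bdd_mul (c := 1) hf (measurable_stepFun N i).aestronglyMeasurable
    (Eventually.of_forall fun x => ?_)
  unfold stepFun
  split_ifs <;> simp

/-- The pairing of two functions with the step kernel. -/
theorem sum_integral_stepFun (N : ℕ) {f g : ℝ → ℝ} (hf : IntegrableOn f (Ioi 0))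
    (hg : IntegrableOn g (Ioi 0)) :
    (∀ x, ∫ y in Ioi (0 : ℝ), stepKernel N x y * g y =
      ∑ i, ∑ j, stepFun N i x * stepForm N i j * ∫ y in Ioi (0 : ℝ), stepFun N j y * g y) ∧
    ∫ x in Ioi (0 : ℝ), f x * ∫ y in Ioi (0 : ℝ), stepKernel N x y * g y =
      ∑ i, ∑ j, (∫ x in Ioi (0 : ℝ), stepFun N i x * f x) * stepForm N i j *
        ∫ y in Ioi (0 : ℝ), stepFun N j y * g y := by
  have h1 : ∀ x, ∫ y in Ioi (0 : ℝ), stepKernel N x y * g y =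
      ∑ i, ∑ j, stepFun N i x * stepForm N i j * ∫ y in Ioi (0 : ℝ), stepFun N j y * g y := by
    intro x
    have hi : ∀ i j, IntegrableOn
        (fun y => stepFun N i x * stepForm N i j * stepFun N j y * g y) (Ioi 0) := fun i j => by
      simp only [mul_assoc (stepFun N i x * stepForm N i j)]
      exact (integrableOn_stepFun_mul N j hg).const_mul _
    simp only [stepKernel, Finset.sum_mul]
    rw [integral_finsetSum _ fun i _ => integrable_finsetSum _ fun j _ => hi i j]
    refine Finset.sum_congr rfl fun i _ => ?_
    rw [integral_finsetSum _ fun j _ => hi i j]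
    refine Finset.sum_congr rfl fun j _ => ?_
    simp only [mul_assoc (stepFun N i x * stepForm N i j)]
    rw [integral_const_mul]
  refine ⟨h1, ?_⟩
  have hi : ∀ i j, IntegrableOn (fun x => stepFun N i x * f x * (stepForm N i j *
      ∫ y in Ioi (0 : ℝ), stepFun N j y * g y)) (Ioi 0) := fun i j =>
    (integrableOn_stepFun_mul N i hf).mul_const _
  have h2 : ∀ x, f x * ∫ y in Ioi (0 : ℝ), stepKernel N x y * g y =
      ∑ i, ∑ j, stepFun N i x * f x * (stepForm N i j *
        ∫ y in Ioi (0 : ℝ), stepFun N j y * g y) := fun x => by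
    rw [h1]
    simp only [Finset.mul_sum]
    exact Finset.sum_congr rfl fun i _ => Finset.sum_congr rfl fun j _ => by ring
  simp only [h2]
  rw [integral_finsetSum _ fun i _ => integrable_finsetSum _ fun j _ => hi i j]
  refine Finset.sum_congr rfl fun i _ => ?_
  rw [integral_finsetSum _ fun j _ => hi i j]
  refine Finset.sum_congr rfl fun j _ => ?_
  rw [integral_mul_const]
  ring

/-- Dominated convergence in each variable in turn, with the uniform bound `1 / 2` on the step
kernels. -/
theorem tendsto_sum_integral_stepFun {f g : ℝ → ℝ} (hf : IntegrableOn f (Ioi 0))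
    (hg : IntegrableOn g (Ioi 0)) :
    Tendsto (fun N => ∑ i, ∑ j, (∫ x in Ioi (0 : ℝ), stepFun N i x * f x) * stepForm N i j *
      ∫ y in Ioi (0 : ℝ), stepFun N j y * g y) atTop
      (𝓝 (∫ x in Ioi (0 : ℝ), f x * ∫ y in Ioi (0 : ℝ), signKernel x y * g y)) := by
  simp only [← (sum_integral_stepFun _ hf hg).2]
  have hm : ∀ N x, Measurable (stepKernel N x) := fun N x => by
    have := measurable_stepFun N
    unfold stepKernel
    fun_prop
  have hb : ∀ N x y, ‖stepKernel N x y * g y‖ ≤ 1 / 2 * ‖g y‖ := fun N x y => by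
    rw [norm_mul]
    exact mul_le_mul_of_nonneg_right (abs_stepKernel_le N x y) (norm_nonneg _)
  have h1 : ∀ x, 0 < x → Tendsto (fun N => ∫ y in Ioi (0 : ℝ), stepKernel N x y * g y) atTop
      (𝓝 (∫ y in Ioi (0 : ℝ), signKernel x y * g y)) := fun x hx => by
    refine tendsto_integral_of_dominated_convergence (fun y => 1 / 2 * ‖g y‖)
      (fun N => (hm N x).aestronglyMeasurable.mul hg.aestronglyMeasurable)
      (hg.norm.const_mul _) (fun N => Eventually.of_forall (hb N x)) ?_
    filter_upwards [ae_restrict_mem measurableSet_Ioi] with y hy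
    exact (tendsto_stepKernel hx hy).mul_const _
  refine tendsto_integral_of_dominated_convergence
    (fun x => ‖f x‖ * ∫ y in Ioi (0 : ℝ), 1 / 2 * ‖g y‖) (fun N => ?_) (hf.norm.mul_const _)
    (fun N => Eventually.of_forall fun x => ?_) ?_
  · refine hf.aestronglyMeasurable.mul ?_
    simp only [(sum_integral_stepFun N hf hg).1]
    have := measurable_stepFun N
    exact Measurable.aestronglyMeasurable (by fun_prop)
  · rw [norm_mul]
    exact mul_le_mul_of_nonneg_left (norm_integral_le_of_norm_le (hg.norm.const_mul _)
      (Eventually.of_forall (hb N x))) (norm_nonneg _)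
  · filter_upwards [ae_restrict_mem measurableSet_Ioi] with x hx
    exact (h1 x hx).const_mul _

/-! ### The orthogonal-like identity for exponential sums -/

section StepPerturbation

open Matrix

variable {κ ι : Type*} [Fintype κ] [DecidableEq κ] [Fintype ι] [DecidableEq ι]

/-- A Schur complement eliminates the cells: the determinant returns to the fixed size `κ`, and the
dependence on the step kernel is confined to `Z E Zᵀ`, where a limit makes sense. -/
theorem det_one_add_fromBlocks_step (β W : Matrix κ κ ℝ) (E : Matrix ι ι ℝ) (Z : Matrix κ ι ℝ) :
    (1 + fromBlocks β 0 0 (-E) * fromBlocks W (-Z) Z.transpose 0).det =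
      (1 + β * (W - Z * E * Z.transpose)).det := by
  rw [fromBlocks_multiply, ← fromBlocks_one, fromBlocks_add]
  simp only [Matrix.zero_mul, Matrix.mul_zero, add_zero, zero_add]
  rw [det_fromBlocks_one₂₂]
  congr 1
  simp only [Matrix.mul_neg, Matrix.neg_mul, Matrix.mul_sub, neg_neg, Matrix.mul_assoc]
  abel

end StepPerturbation

section PairKernel

open Matrix

variable {κ ι : Type*}

/-- The cell functions have zero second row, so they alter only the upper left entry, which is where
`ε` sits. -/
theorem pairKernel_sumElim [Fintype κ] [Fintype ι] (θ ψ : κ → ℝ → ℝ) (e : ι → ℝ → ℝ) (β : Matrix κ κ ℝ)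
    (E : Matrix ι ι ℝ) (x y : ℝ) :
    pairKernel (Sum.elim θ e) (Sum.elim ψ 0) (fromBlocks β 0 0 (-E)) x y =
      pairKernel θ ψ β x y - !![∑ i, ∑ j, e i x * E i j * e j y, 0; 0, 0] := by
  ext a b
  fin_cases a <;> fin_cases b <;>
    simp [pairKernel, rowPair, Fintype.sum_sum_type, sub_eq_add_neg]

theorem skewGram_sumElim (θ ψ : κ → ℝ → ℝ) (e : ι → ℝ → ℝ) :
    skewGram (Sum.elim θ e) (Sum.elim ψ 0) =
      fromBlocks (skewGram θ ψ) (-of fun k i => ∫ x in Ioi (0 : ℝ), e i x * ψ k x)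
        (of fun k i => ∫ x in Ioi (0 : ℝ), e i x * ψ k x).transpose 0 := by
  ext (k | i) (l | j) <;> simp [skewGram]

end PairKernel

section ExpSums

open Matrix

variable {κ : Type*} {lam : κ → ℝ}

/-- The exponentials and the constant function `1`. -/
def expOne (lam : κ → ℝ) : κ ⊕ Unit → ℝ → ℝ := Sum.elim (expFun lam) 1

/-- The derivatives of `expOne`, up to sign. -/
def expOneD (lam : κ → ℝ) : κ ⊕ Unit → ℝ → ℝ :=
  Sum.elim (fun k x => lam k * expFun lam k x) 0

theorem integrableOn_expOneD (hlam : ∀ k, 0 < lam k) (k : κ ⊕ Unit) :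
    IntegrableOn (expOneD lam k) (Ioi 0) := by
  rcases k with k | k
  · exact (integrableOn_expFun hlam k).const_mul _
  · exact integrable_zero _ _ _

theorem integrableOn_expOne_mul (hlam : ∀ k, 0 < lam k) (k l : κ ⊕ Unit) :
    IntegrableOn (fun x => expOne lam k x * expOneD lam l x) (Ioi 0) := by
  rcases k with k | k <;> rcases l with l | l
  · simp only [expOne, expOneD, Sum.elim_inl, mul_left_comm _ (lam l)]
    exact (integrableOn_expFun_mul hlam k l).const_mul _
  · simp [expOneD]
  · simpa [expOne] using integrableOn_expOneD hlam (Sum.inl l)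
  · simp [expOneD]

theorem skewGram_expOne (hlam : ∀ k, 0 < lam k) :
    skewGram (expOne lam) (expOneD lam) = borderedForm (expSkew lam) 1 := by
  have h1 : ∀ k, ∫ x in Ioi (0 : ℝ), lam k * expFun lam k x = 1 := fun k => by
    rw [integral_const_mul, integral_expFun hlam, mul_one_div_cancel (hlam k).ne']
  ext (k | k) (l | l)
  · rw [borderedForm, fromBlocks_apply₁₁, ← skewGram_expFun hlam]
    rfl
  · simp [skewGram, expOne, expOneD, borderedForm, h1]
  · simp [skewGram, expOne, expOneD, borderedForm, h1]
  · simp [skewGram, expOne, expOneD, borderedForm]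

/-- The sign kernel inverts the derivative up to a constant, so this pairing is a multiple of the
skew Gram matrix. Subtracting it leaves half of `expSkew`. -/
theorem integral_signKernel_expFun (hlam : ∀ k, 0 < lam k) (k l : κ) :
    ∫ x in Ioi (0 : ℝ), lam k * expFun lam k x *
      ∫ y in Ioi (0 : ℝ), signKernel x y * (lam l * expFun lam l y) = (1 / 2) * expSkew lam k l := by
  have hi : ∀ l, IntegrableOn (fun y => lam l * expFun lam l y) (Ioi 0) := fun l =>
    (integrableOn_expFun hlam l).const_mul _
  have h1 : ∀ x ∈ Ioi (0 : ℝ), lam k * expFun lam k x *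
      (∫ y in Ioi (0 : ℝ), signKernel x y * (lam l * expFun lam l y)) =
      (1 / 2) * lam k * expFun lam k x - lam k * (expFun lam k x * expFun lam l x) := by
    intro x hx
    have h2 : ∫ y in Ioi x, expFun lam l y = expFun lam l x / lam l := by
      have h := integral_exp_mul_Ioi (neg_lt_zero.2 (hlam l)) x
      simp only [expFun]
      rw [h, neg_div_neg_eq]
    rw [integral_signKernel_mul (hi l) hx, ← intervalIntegral.integral_Ioi_sub_Ioi' (hi l)
      ((hi l).mono_set (Ioi_subset_Ioi (le_of_lt hx))), integral_const_mul, integral_const_mul, h2,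
      integral_expFun hlam]
    have := hlam l
    field_simp
    ring
  rw [setIntegral_congr_fun measurableSet_Ioi h1, integral_sub
    ((integrableOn_expFun hlam k).const_mul _) ((integrableOn_expFun_mul hlam k l).const_mul _),
    integral_const_mul, integral_const_mul, integral_expFun hlam, integral_expFun_mul hlam,
    expSkew, of_apply]
  have := hlam k
  have := hlam l
  field_simp
  ring

/-- The pairings of the derivatives with the cells. -/
def stepGram (lam : κ → ℝ) (N : ℕ) : Matrix (κ ⊕ Unit) (Fin (N * N + 1)) ℝ :=
  of fun k i => ∫ x in Ioi (0 : ℝ), stepFun N i x * expOneD lam k x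

theorem tendsto_stepGram (hlam : ∀ k, 0 < lam k) :
    Tendsto (fun N => skewGram (expOne lam) (expOneD lam) -
        stepGram lam N * stepForm N * (stepGram lam N).transpose) atTop
      (𝓝 (borderedForm ((1 / 2 : ℝ) • expSkew lam) 1)) := by
  rw [skewGram_expOne hlam]
  have h0 : ∀ k l, Tendsto (fun N => (stepGram lam N * stepForm N *
      (stepGram lam N).transpose) k l) atTop (𝓝 (∫ x in Ioi (0 : ℝ), expOneD lam k x *
        ∫ y in Ioi (0 : ℝ), signKernel x y * expOneD lam l y)) := fun k l => by
    refine (tendsto_sum_integral_stepFun (integrableOn_expOneD hlam k)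
      (integrableOn_expOneD hlam l)).congr fun N => ?_
    simp only [Matrix.mul_apply, Finset.sum_mul, transpose_apply, stepGram, of_apply]
    exact Finset.sum_comm
  refine tendsto_pi_nhds.2 fun k => tendsto_pi_nhds.2 fun l => ?_
  have h := (h0 k l).const_sub (borderedForm (expSkew lam) 1 k l)
  have h3 : ∀ x : ℝ, expOneD lam (Sum.inr ()) x = 0 := fun x => rfl
  refine h.trans_eq (congrArg 𝓝 (Eq.symm ?_))
  rcases k with k | k <;> rcases l with l | l
  · have h4 := integral_signKernel_expFun hlam k l
    simp only [borderedForm, fromBlocks_apply₁₁, Matrix.smul_apply, smul_eq_mul]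
    change _ = expSkew lam k l - ∫ x in Ioi (0 : ℝ), lam k * expFun lam k x *
      ∫ y in Ioi (0 : ℝ), signKernel x y * (lam l * expFun lam l y)
    rw [h4]
    ring
  · simp [borderedForm, h3]
  · simp [borderedForm, h3]
  · simp [borderedForm, h3]

end ExpSums

/-! ### Finite-rank form and identity for the orthogonal-like kernels -/

section Fintype

open Matrix

theorem blockOrtho_zero (F F' : ℝ → ℝ) (x y : ℝ) : blockOrtho F F' 0 x y =
    (2 : ℝ) • blockSympl F F' x y + !![(1 / 2) * (tail F y - tail F x), (1 / 2) * F y;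
      -((1 / 2) * F x), 0] := by
  ext a b
  fin_cases a <;> fin_cases b <;>
    simp [blockOrtho, blockSympl, skewOrtho, skewSympl, skewOrthoD, skewSymplD] <;> ring

theorem blockOrtho_eq_sub (F F' : ℝ → ℝ) (e : ℝ → ℝ → ℝ) (x y : ℝ) :
    blockOrtho F F' e x y = blockOrtho F F' 0 x y - !![e x y, 0; 0, 0] := by
  ext a b
  fin_cases a <;> fin_cases b <;> simp [blockOrtho]

variable {κ : Type*} [Fintype κ] {lam : κ → ℝ}

theorem blockOrtho_expSum (hlam : ∀ k, 0 < lam k) (α : κ → ℝ) (x y : ℝ) :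
    blockOrtho (expSum lam α) (expSum lam fun k => -lam k * α k) 0 x y =
      pairKernel (expOne lam) (expOneD lam)
        (borderedForm ((2 : ℝ) • expForm lam α) ((1 / 2 : ℝ) • fun k => α k / lam k)) x y := by
  rw [blockOrtho_zero, blockSympl_expSum hlam, tail_expSum hlam]
  have e1 : ∀ z, ∑ k, lam k * expFun lam k z * (1 / 2 * (α k / lam k)) =
      1 / 2 * expSum lam α z := fun z => by
    rw [expSum, Finset.mul_sum]
    refine Finset.sum_congr rfl fun k _ => ?_
    have := hlam k
    field_simp
  have e2 : ∀ z, ∑ k, expFun lam k z * (1 / 2 * (α k / lam k)) =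
      1 / 2 * expSum lam (fun k => α k / lam k) z := fun z => by
    rw [expSum, Finset.mul_sum]
    exact Finset.sum_congr rfl fun k _ => by ring
  have e3 : ∀ (f g : κ → ℝ) (β : κ → κ → ℝ), ∑ k, ∑ l, f k * (2 * β k l) * g l =
      2 * ∑ k, ∑ l, f k * β k l * g l := fun f g β => by
    simp only [Finset.mul_sum]
    exact Finset.sum_congr rfl fun k _ => Finset.sum_congr rfl fun l _ => by ring
  have e4 : ∀ f g : κ → ℝ, ∑ k, f k * g k = ∑ k, g k * f k := fun f g =>
    Finset.sum_congr rfl fun k _ => mul_comm _ _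
  ext a b
  fin_cases a <;> fin_cases b <;>
    simp only [pairKernel, rowPair, of_apply, Fin.zero_eta, Fin.mk_one, Fin.isValue,
      if_true, one_ne_zero, if_false, cons_val_zero, cons_val_one, cons_val', cons_val_fin_one,
      Fintype.sum_sum_type, borderedForm, fromBlocks_apply₁₁, fromBlocks_apply₁₂,
      fromBlocks_apply₂₁, fromBlocks_apply₂₂, expOne, expOneD, Sum.elim_inl, Sum.elim_inr,
      Finset.univ_unique, Finset.sum_singleton, replicateCol_apply, replicateRow_apply,
      Matrix.zero_apply, Pi.zero_apply, Pi.one_apply, Pi.neg_apply, Pi.smul_apply,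
      Matrix.smul_apply, Matrix.add_apply, smul_eq_mul, mul_zero, zero_mul, add_zero, mul_one,
      one_mul, Finset.sum_const_zero, Finset.sum_add_distrib, mul_neg,
      Finset.sum_neg_distrib, e1, e2]
  · rw [e4 _ fun k => expFun lam k y, e2]
    have := e3 (fun k => expFun lam k x) (fun l => expFun lam l y) (expForm lam α)
    linarith
  · rw [e4 _ fun k => lam k * expFun lam k y, e1]
    have := e3 (fun k => expFun lam k x) (fun l => lam l * expFun lam l y) (expForm lam α)
    linarith
  · have := e3 (fun k => lam k * expFun lam k x) (fun l => expFun lam l y) (expForm lam α)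
    linarith
  · exact (e3 (fun k => lam k * expFun lam k x) (fun l => lam l * expFun lam l y)
      (expForm lam α)).symm

/-- The factorization of `scalarOrtho` for an exponential sum. -/
theorem scalarOrtho_expSum (hlam : ∀ k, 0 < lam k) (α : κ → ℝ) :
    scalarOrtho (expSum lam α) = fun x y => ∑ k, expFun lam k x *
      (α k - ∑ l, lam k * ((2 : ℝ) • expForm lam α + (1 / 2 : ℝ) • vecMulVec
        (fun k => α k / lam k) fun k => α k / lam k) k l * expFun lam l y) := by
  funext x y
  have e1 : expSum lam α x = ∑ k, expFun lam k x * α k :=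
    Finset.sum_congr rfl fun k _ => mul_comm _ _
  have e2 : pairing (expSum lam α) (expSum lam α) x y - expSum lam α x * tail (expSum lam α) y =
      -∑ k, expFun lam k x * ∑ l, lam k * ((2 : ℝ) • expForm lam α + (1 / 2 : ℝ) • vecMulVec
        (fun k => α k / lam k) fun k => α k / lam k) k l * expFun lam l y := by
    simp only [tail_expSum hlam, pairing_expSum hlam, expSum_mul, expForm, Matrix.add_apply,
      Matrix.smul_apply, vecMulVec_apply, smul_eq_mul,
      of_apply, Finset.mul_sum, ← Finset.sum_sub_distrib, ← Finset.sum_neg_distrib]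
    refine Finset.sum_congr rfl fun k _ => Finset.sum_congr rfl fun l _ => ?_
    have := hlam k
    have := hlam l
    field_simp
    ring
  simp only [mul_sub, Finset.sum_sub_distrib]
  rw [scalarOrtho, ← e1]
  linarith

/-- Measurability is recorded here because the finite-rank form makes it evident; convergence as `N`
grows needs it. -/
theorem fredholmPf_step_sq [DecidableEq κ] (hlam : ∀ k, 0 < lam k) (α : κ → ℝ) (N : ℕ) :
    (∀ n, Measurable fun x : Fin n → ℝ => pfaffian (blockMatrix
      (blockOrtho (expSum lam α) (expSum lam fun k => -lam k * α k) (stepKernel N)) x)) ∧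
    fredholmPf (blockOrtho (expSum lam α) (expSum lam fun k => -lam k * α k) (stepKernel N)) ^ 2 =
      (1 + borderedForm ((2 : ℝ) • expForm lam α) ((1 / 2 : ℝ) • fun k => α k / lam k) *
        (skewGram (expOne lam) (expOneD lam) -
          stepGram lam N * stepForm N * (stepGram lam N).transpose)).det := by
  have h1 : blockOrtho (expSum lam α) (expSum lam fun k => -lam k * α k) (stepKernel N) =
      pairKernel (Sum.elim (expOne lam) (stepFun N)) (Sum.elim (expOneD lam) 0)
        (fromBlocks (borderedForm ((2 : ℝ) • expForm lam α) ((1 / 2 : ℝ) • fun k => α k / lam k))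
          0 0 (-stepForm N)) := by
    funext x y
    rw [blockOrtho_eq_sub, pairKernel_sumElim, blockOrtho_expSum hlam]
    rfl
  have h2 : (borderedForm ((2 : ℝ) • expForm lam α)
      ((1 / 2 : ℝ) • fun k => α k / lam k)).transpose =
      -borderedForm ((2 : ℝ) • expForm lam α) ((1 / 2 : ℝ) • fun k => α k / lam k) :=
    borderedForm_transpose (by rw [transpose_smul, expForm_transpose, smul_neg]) _
  rw [h1]
  refine ⟨fun n => measurable_pfaffian_pairKernel ?_ ?_ _ n, ?_⟩
  · rintro ((k | k) | i)
    · exact measurable_expFun lam k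
    · exact measurable_const
    · exact measurable_stepFun N i
  · rintro ((k | k) | i)
    · exact (measurable_expFun lam k).const_mul _
    · exact measurable_const
    · exact measurable_const
  · rw [fredholmPf_pairKernel_sq, skewGram_sumElim, ← det_one_add_fromBlocks_step]
    · rfl
    · rw [fromBlocks_transpose, fromBlocks_neg, h2, transpose_neg, stepForm_transpose]
      simp
    · rintro (k | i) (l | j)
      · exact integrableOn_expOne_mul hlam k l
      · simp
      · exact integrableOn_stepFun_mul N i (integrableOn_expOneD hlam l)
      · simp

theorem fredholmPf_blockOrtho_expSum_sq [DecidableEq κ] {c : ℝ} (hc : 0 < c)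
    (hlam : ∀ k, c ≤ lam k) (α : κ → ℝ) :
    FredholmPfConverges
      (blockOrtho (expSum lam α) (expSum lam fun k => -lam k * α k) signKernel) ∧
    fredholmPf (blockOrtho (expSum lam α) (expSum lam fun k => -lam k * α k) signKernel) ^ 2 =
      (1 + borderedForm ((2 : ℝ) • expForm lam α) ((1 / 2 : ℝ) • fun k => α k / lam k) *
        borderedForm ((1 / 2 : ℝ) • expSkew lam) 1).det := by
  have hpos : ∀ k, 0 < lam k := fun k => hc.trans_le (hlam k)
  have hF := decays_expSum hlam α
  have hF' := decays_expSum hlam fun k => -lam k * α k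
  obtain ⟨C₁, hC₁, h1⟩ := hF.bound 0
  obtain ⟨C₂, hC₂, h2⟩ := hF'.bound 0
  obtain ⟨C, hC, hb⟩ := exists_kernel_bound hc (hC₁.trans (le_max_left C₁ C₂))
  have hb' := hb (expSum lam α) (expSum lam fun k => -lam k * α k)
    (fun x hx => (h1 x hx).trans (by gcongr; exact le_max_left _ _))
    (fun x hx => (h2 x hx).trans (by gcongr; exact le_max_right _ _))
  have hconv := fredholmPf_tendsto
    (K := fun N => blockOrtho (expSum lam α) (expSum lam fun k => -lam k * α k) (stepKernel N))
    (L := blockOrtho (expSum lam α) (expSum lam fun k => -lam k * α k) signKernel) hC hc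
    (fun N n => ((fredholmPf_step_sq hpos α N).1 n).aestronglyMeasurable)
    (fun N x y _ _ => blockOrtho_skew hc hF hF' (hasDerivAt_expSum lam α) (stepKernel_skew N) x y)
    (fun N x y a b hx hy => (hb' x y hx hy).2.2.2 _ (abs_stepKernel_le N x y) a b)
    (fun x y a b hx hy => by
      simp only [blockOrtho_eq_sub _ _ (stepKernel _), blockOrtho_eq_sub _ _ signKernel]
      have := (tendsto_stepKernel hx hy).const_sub
        (blockOrtho (expSum lam α) (expSum lam fun k => -lam k * α k) 0 x y 0 0)
      fin_cases a <;> fin_cases b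
      · exact this
      all_goals simp)
  -- The squared Pfaffians have two limits as `N → ∞`: one by convergence of the step kernels, one
  -- by continuity of a determinant of fixed size.
  refine ⟨hconv.1, tendsto_nhds_unique (hconv.2.pow 2) ?_⟩
  simp only [(fredholmPf_step_sq hpos α _).2]
  have hcont : Continuous fun M : Matrix (κ ⊕ Unit) (κ ⊕ Unit) ℝ =>
      (1 + borderedForm ((2 : ℝ) • expForm lam α) ((1 / 2 : ℝ) • fun k => α k / lam k) * M).det :=
    by fun_prop
  exact (hcont.tendsto _).comp (tendsto_stepGram hpos)

/-- The orthogonal-like identity for exponential sums. -/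
theorem fredholmDet_scalarOrtho_expSum [DecidableEq κ] {c : ℝ} (hc : 0 < c)
    (hlam : ∀ k, c ≤ lam k) (α : κ → ℝ) :
    fredholmDet (scalarOrtho (expSum lam α)) = fredholmPf
      (blockOrtho (expSum lam α) (expSum lam fun k => -lam k * α k) signKernel) ^ 2 := by
  have hpos : ∀ k, 0 < lam k := fun k => hc.trans_le (hlam k)
  rw [(fredholmPf_blockOrtho_expSum_sq hc hlam α).2, det_bordered
    (by rw [transpose_smul, expForm_transpose, smul_neg])
    (by rw [transpose_smul, expSkew_transpose, smul_neg])]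
  set v : κ → ℝ := fun k => α k / lam k with hv
  set β := (2 : ℝ) • expForm lam α + (1 / 2 : ℝ) • vecMulVec v v with hβ
  have h1 : ∀ k l, IntegrableOn (fun x => (α k - ∑ m, lam k * β k m * expFun lam m x) *
      expFun lam l x) (Ioi 0) ∧ ∫ x in Ioi (0 : ℝ), (α k - ∑ m, lam k * β k m * expFun lam m x) *
      expFun lam l x = α k * (1 / lam l) - ∑ m, lam k * β k m * expGram lam m l := fun k l => by
    simp only [sub_mul (α k)]
    have i1 := (integrableOn_expFun hpos l).const_mul (α k)
    obtain ⟨i2, i3⟩ := integral_sum_expFun_mul hpos (fun m => lam k * β k m) l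
    refine ⟨i1.sub i2, ?_⟩
    rw [integral_sub i1 i2, i3, integral_const_mul, integral_expFun hpos]
  -- The rank-one term from `det_bordered` completes the halved skew matrix to `G Λ`; cycling `Λ`
  -- then gives the Gram matrix of the scalar kernel.
  have h2 : (1 / 2 : ℝ) • expSkew lam + (1 / 2 : ℝ) • vecMulVec (1 : κ → ℝ) 1 =
      expGram lam * diagonal lam := by
    rw [← smul_add, ← two_smul_expGram_mul hpos, smul_smul]
    norm_num
  have h3 : 1 + β * (expGram lam * diagonal lam) - vecMulVec v 1 =
      1 + (β * expGram lam - vecMulVec v fun l => 1 / lam l) * diagonal lam := by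
    rw [Matrix.sub_mul, ← Matrix.mul_assoc, add_sub_assoc]
    congr 2
    ext k l
    rw [mul_diagonal, vecMulVec_apply, vecMulVec_apply, mul_assoc,
      one_div_mul_cancel (hpos l).ne', Pi.one_apply]
  rw [h2, h3, det_one_add_mul_comm, scalarOrtho_expSum hpos, ← hβ,
    fredholmDet_finiteRank fun k l => (h1 k l).1]
  congr 1
  ext k l
  rw [Matrix.sub_apply, Matrix.add_apply, of_apply, (h1 k l).2, diagonal_mul, Matrix.sub_apply,
    Matrix.mul_apply, vecMulVec_apply, mul_sub, Finset.mul_sum]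
  have h4 : lam k * (v k * (1 / lam l)) = α k * (1 / lam l) := by
    have := hpos k
    simp only [hv]
    field_simp
  have h5 : ∑ m, lam k * (β k m * expGram lam m l) = ∑ m, lam k * β k m * expGram lam m l :=
    Finset.sum_congr rfl fun m _ => (mul_assoc _ _ _).symm
  rw [h4, h5]
  ring

end Fintype

/-! ### Approximation by exponential sums -/

theorem tail_deriv_eq {c : ℝ} {f f' : ℝ → ℝ} (hc : 0 < c) (hf : Decays c f) (hf' : Decays c f')
    (hd : ∀ x, HasDerivAt f (f' x) x) (x : ℝ) : tail f' x = -f x := by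
  rw [tail_eq, integral_Ioi_of_hasDerivAt_of_tendsto' (fun t _ => hd t) (hf'.integrableOn hc x)
    (hf.tendsto_zero hc), zero_sub]

theorem Decays.sub {c : ℝ} {f g : ℝ → ℝ} (hf : Decays c f) (hg : Decays c g) :
    Decays c fun x => f x - g x where
  cont := hf.cont.sub hg.cont
  bound T := by
    obtain ⟨C₁, hC₁, h1⟩ := hf.bound T
    obtain ⟨C₂, hC₂, h2⟩ := hg.bound T
    refine ⟨C₁ + C₂, by positivity, fun x hx => (abs_sub _ _).trans ?_⟩
    rw [add_mul]
    exact add_le_add (h1 x hx) (h2 x hx)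

/-- In the variable `t = exp(-μ x)` a function decaying at rate `2 μ` is `t` times a continuous
function on the unit interval. -/
theorem continuousOn_log_div {μ : ℝ} {f : ℝ → ℝ} (hμ : 0 < μ) (hf : Decays (2 * μ) f) :
    ContinuousOn (fun t => f (-Real.log t / μ) / t) (Icc 0 1) := by
  intro t ht
  rcases ht.1.eq_or_lt with h | h
  · subst h
    obtain ⟨C, hC, hb⟩ := hf.bound 0
    have h0 : Tendsto (fun t : ℝ => C * t) (𝓝[Icc 0 1] 0) (𝓝 0) := by
      have : Tendsto (fun t : ℝ => C * t) (𝓝 0) (𝓝 (C * 0)) := tendsto_id.const_mul C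
      rw [mul_zero] at this
      exact this.mono_left nhdsWithin_le_nhds
    -- Decay at rate `2 * μ` is `O(t ^ 2)`, which leaves `O(t)` after the division. The default
    -- value of division by zero is the right limit at `t = 0`.
    have h1 : Tendsto (fun t => f (-Real.log t / μ) / t) (𝓝[Icc 0 1] 0) (𝓝 0) := by
      refine squeeze_zero_norm' ?_ h0
      filter_upwards [self_mem_nhdsWithin] with t ht
      rcases ht.1.eq_or_lt with h | h
      · simp [← h]
      · have h2 : 0 ≤ -Real.log t / μ :=
          div_nonneg (neg_nonneg.2 (Real.log_nonpos ht.1 ht.2)) hμ.le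
        have h3 : Real.exp (-(2 * μ) * (-Real.log t / μ)) = t * t := by
          rw [show -(2 * μ) * (-Real.log t / μ) = Real.log t + Real.log t by field_simp; ring,
            Real.exp_add, Real.exp_log h]
        rw [norm_div, Real.norm_of_nonneg ht.1, div_le_iff₀ h, mul_assoc, ← h3]
        exact hb _ h2
    simpa [ContinuousWithinAt] using h1
  · have := hf.cont
    refine ContinuousAt.continuousWithinAt ?_
    have h1 : ContinuousAt (fun t => -Real.log t / μ) t :=
      ((Real.continuousAt_log h.ne').neg).div_const μ
    exact (this.continuousAt.comp h1).div continuousAt_id h.ne'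

theorem exists_expSum_near {μ : ℝ} {F F' : ℝ → ℝ} (hμ : 0 < μ) (hF : Decays (2 * μ) F)
    (hF' : Decays (2 * μ) F') (hd : ∀ x, HasDerivAt F (F' x) x) {ε : ℝ} (hε : 0 < ε) :
    ∃ (n : ℕ) (lam α : Fin n → ℝ), (∀ k, μ ≤ lam k) ∧ ∀ x, 0 ≤ x →
      |expSum lam α x - F x| ≤ ε / μ * Real.exp (-μ * x) ∧
      |expSum lam (fun k => -lam k * α k) x - F' x| ≤ ε * Real.exp (-μ * x) := by
  -- It is `F'` that is approximated, by `t * p(t)` with `t = exp(-μ x)`. The extra factor `t` keeps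
  -- all exponents at least `μ`, and `α` is chosen so that the derivative of the exponential sum is
  -- this polynomial.
  obtain ⟨p, hp⟩ := exists_polynomial_near_of_continuousOn 0 1 _ (continuousOn_log_div hμ hF') ε hε
  have hμ2 : μ ≤ 2 * μ := by linarith
  refine ⟨p.natDegree + 1, fun k => μ * ((k : ℕ) + 1), fun k => -(p.coeff k) / (μ * ((k : ℕ) + 1)),
    fun k => ?_, ?_⟩
  · have : (0 : ℝ) ≤ (k : ℕ) := Nat.cast_nonneg _
    nlinarith
  set lam : Fin (p.natDegree + 1) → ℝ := fun k => μ * ((k : ℕ) + 1) with hlam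
  set α : Fin (p.natDegree + 1) → ℝ := fun k => -(p.coeff k) / (μ * ((k : ℕ) + 1)) with hα
  have hle : ∀ k, μ ≤ lam k := fun k => by
    have : (0 : ℝ) ≤ (k : ℕ) := Nat.cast_nonneg _
    simp only [hlam]
    nlinarith
  have h1 : ∀ x, expSum lam (fun k => -lam k * α k) x =
      Real.exp (-μ * x) * p.eval (Real.exp (-μ * x)) := fun x => by
    rw [Polynomial.eval_eq_sum_range, Finset.sum_range, Finset.mul_sum, expSum]
    refine Finset.sum_congr rfl fun k _ => ?_
    have h2 : (0 : ℝ) < μ * ((k : ℕ) + 1) := by positivity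
    have h3 : expFun lam k x = Real.exp (-μ * x) * Real.exp (-μ * x) ^ (k : ℕ) := by
      rw [← pow_succ', ← Real.exp_nat_mul, expFun]
      simp only [hlam]
      push_cast
      ring_nf
    rw [h3]
    simp only [hlam, hα]
    field_simp
  have h2 : ∀ x, 0 ≤ x →
      |expSum lam (fun k => -lam k * α k) x - F' x| ≤ ε * Real.exp (-μ * x) := fun x hx => by
    have ht := Real.exp_pos (-μ * x)
    have h3 := (hp (Real.exp (-μ * x)) ⟨ht.le, Real.exp_le_one_iff.2 (by nlinarith)⟩).le
    have h4 : -Real.log (Real.exp (-μ * x)) / μ = x := by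
      rw [Real.log_exp]
      field_simp
    simp only [h4] at h3
    have h5 : Real.exp (-μ * x) * p.eval (Real.exp (-μ * x)) - F' x =
        (p.eval (Real.exp (-μ * x)) - F' x / Real.exp (-μ * x)) * Real.exp (-μ * x) := by
      field_simp
    rw [h1, h5, abs_mul, Real.abs_exp]
    exact mul_le_mul_of_nonneg_right h3 ht.le
  refine fun x hx => ⟨?_, h2 x hx⟩
  -- The error in `F` is minus the tail of the error in `F'`; integrating the exponential costs the
  -- factor `1 / μ`.
  have h3 := tail_deriv_eq hμ ((decays_expSum hle α).sub (hF.of_le hμ2))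
    ((decays_expSum hle fun k => -lam k * α k).sub (hF'.of_le hμ2))
    (fun x => (hasDerivAt_expSum lam α x).sub (hd x)) x
  rw [← abs_neg, ← h3]
  exact abs_tail_le hμ h2 hx

/-! ### The identities for decaying functions -/

theorem measurable_det_scalarMatrix {K : ℝ → ℝ → ℝ} (hK : Measurable fun p : ℝ × ℝ => K p.1 p.2)
    (n : ℕ) : Measurable fun x : Fin n → ℝ => (scalarMatrix K x).det := by
  have : ∀ i j, Measurable fun x : Fin n → ℝ => K (x i) (x j) := fun i j =>
    hK.comp (g := fun p : ℝ × ℝ => K p.1 p.2) (f := fun x : Fin n → ℝ => (x i, x j)) (by fun_prop)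
  simp only [Matrix.det_apply', scalarMatrix, Matrix.of_apply]
  fun_prop

theorem measurable_scalar_expSum {κ : Type*} [Fintype κ] {lam : κ → ℝ} (hlam : ∀ k, 0 < lam k)
    (α : κ → ℝ) : (Measurable fun p : ℝ × ℝ => scalarSympl (expSum lam α) p.1 p.2) ∧
      Measurable fun p : ℝ × ℝ => scalarOrtho (expSum lam α) p.1 p.2 := by
  have := measurable_expFun lam
  rw [scalarSympl_expSum hlam, scalarOrtho_expSum hlam]
  constructor <;> fun_prop

theorem fredholm_identities {c : ℝ} {F F' : ℝ → ℝ} (hc : 0 < c) (hF : Decays c F)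
    (hF' : Decays c F') (hd : ∀ x, HasDerivAt F (F' x) x) :
    (FredholmDetConverges (scalarSympl F) ∧ FredholmPfConverges (blockSympl F F') ∧
      fredholmDet (scalarSympl F) = fredholmPf (blockSympl F F') ^ 2) ∧
    FredholmDetConverges (scalarOrtho F) ∧ FredholmPfConverges (blockOrtho F F' signKernel) ∧
      fredholmDet (scalarOrtho F) = fredholmPf (blockOrtho F F' signKernel) ^ 2 := by
  -- Half of the decay rate is given up for the approximation; all uniform bounds below are at rate
  -- `μ`.
  obtain ⟨μ, hμ⟩ : ∃ μ, μ = c / 2 := ⟨_, rfl⟩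
  have hμ0 : 0 < μ := by rw [hμ]; positivity
  have hcμ : 2 * μ = c := by rw [hμ]; ring
  rw [← hcμ] at hF hF'
  have hpos : ∀ j : ℕ, (0 : ℝ) < 1 / ((j : ℝ) + 1) := fun j => by positivity
  choose n lam α hlam happ using fun j : ℕ => exists_expSum_near hμ0 hF hF' hd (hpos j)
  have hlam0 : ∀ j k, 0 < lam j k := fun j k => hμ0.trans_le (hlam j k)
  have hF1 := hF.of_le (by linarith : μ ≤ 2 * μ)
  have hF1' := hF'.of_le (by linarith : μ ≤ 2 * μ)
  obtain ⟨C₁, hC₁, b1⟩ := hF1.bound 0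
  obtain ⟨C₂, hC₂, b2⟩ := hF1'.bound 0
  have hle1 : ∀ j : ℕ, 1 / ((j : ℝ) + 1) ≤ 1 := fun j => by
    rw [div_le_one (by positivity)]
    linarith [(Nat.cast_nonneg j : (0 : ℝ) ≤ j)]
  obtain ⟨E, hE⟩ : ∃ E, E = C₁ + C₂ + 1 / μ + 1 := ⟨_, rfl⟩
  have hμ1 : 0 ≤ 1 / μ := by positivity
  have hE0 : 0 ≤ E := by rw [hE]; positivity
  have bF : ∀ j x, 0 ≤ x → |expSum (lam j) (α j) x| ≤ E * Real.exp (-μ * x) := fun j x hx => by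
    have h1 := (happ j x hx).1
    have h2 := b1 x hx
    have h3 : 1 / ((j : ℝ) + 1) / μ ≤ 1 / μ := div_le_div_of_nonneg_right (hle1 j) hμ0.le
    have h4 := mul_le_mul_of_nonneg_right h3 (Real.exp_pos (-μ * x)).le
    have h5 := abs_sub_abs_le_abs_sub (expSum (lam j) (α j) x) (F x)
    have h6 : (C₁ + 1 / μ) * Real.exp (-μ * x) ≤ E * Real.exp (-μ * x) :=
      mul_le_mul_of_nonneg_right (by linarith) (Real.exp_pos _).le
    linarith
  have bF' : ∀ j x, 0 ≤ x → |expSum (lam j) (fun k => -lam j k * α j k) x| ≤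
      E * Real.exp (-μ * x) := fun j x hx => by
    have h1 := (happ j x hx).2
    have h2 := b2 x hx
    have h4 := mul_le_mul_of_nonneg_right (hle1 j) (Real.exp_pos (-μ * x)).le
    have h5 := abs_sub_abs_le_abs_sub (expSum (lam j) (fun k => -lam j k * α j k) x) (F' x)
    have h6 : (C₂ + 1) * Real.exp (-μ * x) ≤ E * Real.exp (-μ * x) :=
      mul_le_mul_of_nonneg_right (by linarith) (Real.exp_pos _).le
    linarith
  have h0 : Tendsto (fun j : ℕ => 1 / ((j : ℝ) + 1)) atTop (𝓝 0) :=
    tendsto_one_div_add_atTop_nhds_zero_nat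
  have lF : ∀ x, 0 ≤ x → Tendsto (fun j => expSum (lam j) (α j) x) atTop (𝓝 (F x)) :=
    fun x hx => tendsto_iff_norm_sub_tendsto_zero.2 <| squeeze_zero (fun j => norm_nonneg _)
      (fun j => (happ j x hx).1) <| by
        simpa using (h0.div_const μ).mul_const (Real.exp (-μ * x))
  have lF' : ∀ x, 0 ≤ x →
      Tendsto (fun j => expSum (lam j) (fun k => -lam j k * α j k) x) atTop (𝓝 (F' x)) :=
    fun x hx => tendsto_iff_norm_sub_tendsto_zero.2 <| squeeze_zero (fun j => norm_nonneg _)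
      (fun j => (happ j x hx).2) <| by simpa using h0.mul_const (Real.exp (-μ * x))
  obtain ⟨C, hC, hb⟩ := exists_kernel_bound hμ0 hE0
  have hb' := fun j => hb _ _ (bF j) (bF' j)
  have dF := fun j => decays_expSum (hlam j) (α j)
  have dF' := fun j => decays_expSum (hlam j) fun k => -lam j k * α j k
  have hl := fun x y => tendsto_kernels (x := x) (y := y) hμ0 dF (fun j => (dF' j).cont)
    bF bF' lF lF'
  have hs : ∀ x y, |signKernel x y| ≤ 1 / 2 := fun x y => abs_half_mul_sign_le _
  have t1 := fredholmDet_tendsto hC hμ0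
    (fun j m => (measurable_det_scalarMatrix
      (measurable_scalar_expSum (hlam0 j) (α j)).1 m).aestronglyMeasurable)
    (fun j x y hx hy => (hb' j x y hx hy).1) (fun x y hx hy => (hl x y hx hy).1)
  have t2 := fredholmDet_tendsto hC hμ0
    (fun j m => (measurable_det_scalarMatrix
      (measurable_scalar_expSum (hlam0 j) (α j)).2 m).aestronglyMeasurable)
    (fun j x y hx hy => (hb' j x y hx hy).2.1) (fun x y hx hy => (hl x y hx hy).2.1)
  have t3 := fredholmPf_tendsto hC hμ0
    (K := fun j => blockSympl (expSum (lam j) (α j)) (expSum (lam j) fun k => -lam j k * α j k))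
    (L := blockSympl F F') (fun j m => by
      rw [blockSympl_expSum (hlam0 j)]
      exact (measurable_pfaffian_pairKernel (measurable_expFun _)
        (fun k => (measurable_expFun _ k).const_mul _) _ m).aestronglyMeasurable)
    (fun j x y _ _ => blockSympl_skew hμ0 (dF j) (dF' j) (hasDerivAt_expSum _ _) x y)
    (fun j x y a b hx hy => (hb' j x y hx hy).2.2.1 a b)
    (fun x y a b hx hy => (hl x y hx hy).2.2.1 a b)
  have t4 := fredholmPf_tendsto hC hμ0
    (K := fun j => blockOrtho (expSum (lam j) (α j)) (expSum (lam j) fun k => -lam j k * α j k)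
      signKernel)
    (L := blockOrtho F F' signKernel)
    -- With the true sign kernel the rank is infinite; measurability is inherited from the
    -- integrability obtained in the step limit.
    (fun j m => ((fredholmPf_blockOrtho_expSum_sq hμ0 (hlam j) (α j)).1.1 m).aestronglyMeasurable)
    (fun j x y _ _ => blockOrtho_skew hμ0 (dF j) (dF' j) (hasDerivAt_expSum _ _)
      signKernel_skew x y)
    (fun j x y a b hx hy => (hb' j x y hx hy).2.2.2 _ (hs x y) a b)
    (fun x y a b hx hy => (hl x y hx hy).2.2.2 _ a b)
  refine ⟨⟨t1.1, t3.1, tendsto_nhds_unique t1.2 ?_⟩, t2.1, t4.1, tendsto_nhds_unique t2.2 ?_⟩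
  · exact (t3.2.pow 2).congr fun j => (fredholmDet_scalarSympl_expSum (hlam0 j) (α j)).symm
  · exact (t4.2.pow 2).congr fun j => (fredholmDet_scalarOrtho_expSum hμ0 (hlam j) (α j)).symm

end FredholmPfaffian

end

/-! ### The theorem for the shifted function x ↦ A(x + s) -/

theorem mainTheorem11 (A : ℝ → ℝ) (hA : ContDiff ℝ ∞ A)
    (hdecay : FredholmPfaffian.ExpDecay A) (hdecay' : FredholmPfaffian.ExpDecay (deriv A))
    (s : ℝ) :
    -- `D⁻¹ K_s` is the antiderivative of `K_s` vanishing at infinity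
    ((∀ x y : ℝ, HasDerivAt (fun t => FredholmPfaffian.DInv (FredholmPfaffian.kernelK A s) t y)
        (FredholmPfaffian.kernelK A s x y) x) ∧
      (∀ y : ℝ, Tendsto (fun t => FredholmPfaffian.DInv (FredholmPfaffian.kernelK A s) t y)
        atTop (𝓝 0))) ∧
    -- the symplectic-like case
    ((∀ x y : ℝ, FredholmPfaffian.bSympl A s x y =
        (1 / 2) * FredholmPfaffian.DInv (FredholmPfaffian.kernelK A s) x y +
          (1 / 4) * (FredholmPfaffian.kernelAOne A s x * FredholmPfaffian.kernelAOne A s y)) ∧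
      FredholmPfaffian.IsSkew (FredholmPfaffian.bSympl A s) ∧
      FredholmPfaffian.HasBlockDerivatives (FredholmPfaffian.bSympl A s) ∧
      FredholmPfaffian.IsBlockSkew (FredholmPfaffian.pfKernelSympl A s) ∧
      FredholmPfaffian.FredholmDetConverges (FredholmPfaffian.kernelSympl A s) ∧
      FredholmPfaffian.FredholmPfConverges (FredholmPfaffian.pfKernelSympl A s) ∧
      FredholmPfaffian.fredholmDet (FredholmPfaffian.kernelSympl A s) =
        FredholmPfaffian.fredholmPf (FredholmPfaffian.pfKernelSympl A s) ^ 2) ∧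
    -- the orthogonal-like case
    (FredholmPfaffian.IsSkew (FredholmPfaffian.bOrtho A s) ∧
      FredholmPfaffian.HasBlockDerivatives (FredholmPfaffian.bOrtho A s) ∧
      FredholmPfaffian.IsBlockSkew (FredholmPfaffian.pfKernelOrtho A s) ∧
      FredholmPfaffian.FredholmDetConverges (FredholmPfaffian.kernelOrtho A s) ∧
      FredholmPfaffian.FredholmPfConverges (FredholmPfaffian.pfKernelOrtho A s) ∧
      FredholmPfaffian.fredholmDet (FredholmPfaffian.kernelOrtho A s) =
        FredholmPfaffian.fredholmPf (FredholmPfaffian.pfKernelOrtho A s) ^ 2) ∧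
    -- the sign kernel: it is skew, `D ε = I`, `ε δ₀ = 1/2` and `ε δ_∞ = -1/2`
    (FredholmPfaffian.IsSkew FredholmPfaffian.signKernel ∧
      (∀ f : ℝ → ℝ, IntegrableOn f (Ioi 0) → ContinuousOn f (Ioi 0) → ∀ x : ℝ, 0 < x →
        HasDerivAt (fun t => ∫ y in Ioi (0 : ℝ), FredholmPfaffian.signKernel t y * f y)
          (f x) x) ∧
      (∀ x : ℝ, 0 < x → FredholmPfaffian.signKernel x 0 = 1 / 2) ∧
      (∀ x : ℝ, Tendsto (fun y => FredholmPfaffian.signKernel x y) atTop (𝓝 (-(1 / 2))))) := by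
  obtain ⟨c₁, hc₁, h1⟩ := FredholmPfaffian.exists_decays hA.continuous hdecay
  obtain ⟨c₂, hc₂, h2⟩ := FredholmPfaffian.exists_decays
    (hA.continuous_deriv (by simp)) hdecay'
  -- `A` and its derivative may decay at different rates; the smaller rate serves for both.
  have hc : 0 < min c₁ c₂ := lt_min hc₁ hc₂
  have hF := (h1.of_le (min_le_left c₁ c₂)).shift s
  have hF' := (h2.of_le (min_le_right c₁ c₂)).shift s
  have hd : ∀ x, HasDerivAt (fun x => A (x + s)) (deriv A (x + s)) x := fun x =>
    ((hA.differentiable (by simp)) (x + s)).hasDerivAt.comp_add_const x s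
  have hK := FredholmPfaffian.dInv_kernelK_eq hc hF hF' hd
  have hS := FredholmPfaffian.bSympl_eq hc hF hF' hd
  have hO := FredholmPfaffian.bOrtho_eq hc hF hF' hd
  obtain ⟨dS, eS⟩ := FredholmPfaffian.skewSympl_derivatives hc hF hF' hd
  obtain ⟨dO, eO⟩ := FredholmPfaffian.skewOrtho_derivatives hc hF hF' hd
    FredholmPfaffian.signKernel
  have kS : FredholmPfaffian.pfKernelSympl A s =
      FredholmPfaffian.blockSympl (fun x => A (x + s)) fun x => deriv A (x + s) := by
    funext x y
    rw [FredholmPfaffian.pfKernelSympl, hS, eS]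
  have kO : FredholmPfaffian.pfKernelOrtho A s =
      FredholmPfaffian.blockOrtho (fun x => A (x + s)) (fun x => deriv A (x + s))
        FredholmPfaffian.signKernel := by
    funext x y
    rw [FredholmPfaffian.pfKernelOrtho, hO, eO]
  have hI := FredholmPfaffian.fredholm_identities hc hF hF' hd
  rw [kS, kO, hS, hO, FredholmPfaffian.kernelSympl_eq, FredholmPfaffian.kernelOrtho_eq]
  refine ⟨⟨fun x y => ?_, fun y => ?_⟩,
    ⟨fun x y => ?_, FredholmPfaffian.skewSympl_skew hc hF, dS,
      FredholmPfaffian.blockSympl_skew hc hF hF' hd, hI.1⟩,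
    ⟨FredholmPfaffian.skewOrtho_skew hc hF, dO,
      FredholmPfaffian.blockOrtho_skew hc hF hF' hd FredholmPfaffian.signKernel_skew, hI.2⟩,
    FredholmPfaffian.signKernel_skew,
    fun f hf hfc x hx => FredholmPfaffian.hasDerivAt_integral_signKernel hf hfc hx,
    fun x hx => FredholmPfaffian.signKernel_zero hx, FredholmPfaffian.tendsto_signKernel⟩
  · simp only [hK]
    exact FredholmPfaffian.hasDerivAt_pairing_tail hc hF x y
  · simp only [hK]
    simpa using (((hF.tail hc).pairing_left hc hF.neg hF
      (FredholmPfaffian.hasDerivAt_tail hc hF) y).tendsto_zero hc).neg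
  · rw [hK, FredholmPfaffian.skewSympl]
    change _ = _ + 1 / 4 * (FredholmPfaffian.tail (fun x => A (x + s)) x *
      FredholmPfaffian.tail (fun x => A (x + s)) y)
    ring
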